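/- Let $\Bbbk$ be a field, let $I=\{i\}$ with a Cartan datum $i\cdot i\in 2\mathbb Z_{>0}$ (type $A_1$), let $m,n\ge 0$, and let $\mathbf s=(s_1,\dots,s_m)$ be positive integers. **The algebra $R$.** Let $\tilde I=\{i,\bar i\}$ with $\bar i\cdot\bar i=i\cdot i$ and $i\cdot\bar i=-\tfrac12\, i\cdot i$, and put $Q_{ab}(u,v)=0$ if $a=b$, $Q_{i\bar i}(u,v)=u-v$, $Q_{\bar i i}(u,v)=v-u$. Let $D=s_1+\dots+s_m+n$. The Khovanov–Lauda–Rouquier algebra $R=R_{D}(\overline Q_{\tilde C})$ is the unital $\Bbbk$-algebra generated by $e(\mathbf a)$ ($\mathbf a\in\tilde I^{D}$), $x_1,\dots,x_D$, $\psi_1,\dots,\psi_{D-1}$ with the relations: $e(\mathbf a)e(\mathbf b)=\delta_{\mathbf a\mathbf b}e(\mathbf a)$, $\sum_{\mathbf a}e(\mathbf a)=1$, $x_je(\mathbf a)=e(\mathbf a)x_j$, $\psi_je(\mathbf a)=e(\sigma_j\mathbf a)\psi_j$ with $\sigma_j$ the swap of entries $j,j+1$, $x_jx_k=x_kx_j$,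 $\psi_jx_k=x_k\psi_j$ for $k\ne j,j+1$, $\psi_j\psi_k=\psi_k\psi_j$ for $|j-k|>1$, $(x_j\psi_j-\psi_jx_{j+1})e(\mathbf a)=(\psi_jx_j-x_{j+1}\psi_j)e(\mathbf a)=\delta_{a_j,a_{j+1}}e(\mathbf a)$, $\psi_j^2e(\mathbf a)=Q_{a_ja_{j+1}}(x_j,x_{j+1})e(\mathbf a)$, and $(\psi_j\psi_{j+1}\psi_j-\psi_{j+1}\psi_j\psi_{j+1})e(\mathbf a)=\varepsilon\, e(\mathbf a)$, where $\varepsilon=1$ if $(a_j,a_{j+1},a_{j+2})=(i,\bar i,i)$, $\varepsilon=-1$ if it is $(\bar i,i,\bar i)$, and $\varepsilon=0$ otherwise. **The subalgebra $S_C(\lambda,\nu)$.** Let $\lambda=(s_1\bar i,\dots,s_m\bar i)$ and $\nu=(i,\dots,i)$ ($n$ entries). $\mathrm{Seq}(\lambda,\nu)$ is the set of sequences $\mathbf i=(\mathbf i_1,\dots,\mathbf i_{m+n})$ that contain $n$ entries $i$ and each of $\lambda_1,\dots,\lambda_m$ once, in this order. Reading an entry $i$ as one strand labelled $i$ and an entry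 $\lambda_k$ as $s_k$ consecutive strands labelled $\bar i$ turns $\mathbf i$ into a word $\mathbf a(\mathbf i)\in\tilde I^{D}$. Let $e(\mathbf i)\in R$ be $e(\mathbf a(\mathbf i))$ multiplied, for each $k$, by the nilHecke idempotent $x_1^{s_k-1}x_2^{s_k-2}\cdots x_{s_k-1}\psi_{w_0}$ on the strands of $\lambda_k$. Set $y_je(\mathbf i)=x_\alpha e(\mathbf i)$ if $\mathbf i_j=i$ is strand number $\alpha$, and $y_je(\mathbf i)=0$ otherwise; let $E_{k,d}e(\mathbf i)$ ($1\le d\le s_k$) be the $d$-th elementary symmetric polynomial in the $x$'s of the strands of $\lambda_k$, times $e(\mathbf i)$; let $\beta$ be the number of the first strand of $\mathbf i_j$ and put $\Psi_je(\mathbf i)=\psi_\beta e(\mathbf i)$ for $(\mathbf i_j,\mathbf i_{j+1})=(i,i)$, $\psi_\beta\psi_{\beta+1}\cdots\psi_{\beta+s_k-1}e(\mathbf i)$ for $(\lambda_k,i)$, $\psi_{\beta+s_k-1}\cdots\psi_{\beta+1}\psi_\beta e(\mathbf i)$ for $(i,\lambda_k)$, and $0$ for two thick entries. $S_C(\lambda,\nu)$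 is the (non-unital) $\Bbbk$-subalgebra of $R$ generated by all $e(\mathbf i)$, $y_je(\mathbf i)$, $E_{k,d}e(\mathbf i)$, $\Psi_je(\mathbf i)$; its unit is $\sum_{\mathbf i}e(\mathbf i)$. **The redotted Webster algebra $W(\mathbf s,n)$.** Let $\mathrm{Seq}(\mathbf s,n)$ be the set of sequences of length $m+n$ with $n$ black entries $b$ and red entries $s_1,\dots,s_m$, once each and in this order; it is identified with $\mathrm{Seq}(\lambda,\nu)$ by $b\leftrightarrow i$, $s_k\leftrightarrow\lambda_k$. $W(\mathbf s,n)$ is the unital $\Bbbk$-algebra generated by $e(\mathbf i)$ ($\mathbf i\in\mathrm{Seq}(\mathbf s,n)$), $x_j$ ($1\le j\le m+n$), $E_{k,d}$ ($1\le k\le m$, $d\ge 0$, with $E_{k,0}=1$ and $E_{k,d}=0$ for $d>s_k$), $\psi_j$ ($1\le j\le m+n-1$) with the relations: - $e(\mathbf i)e(\mathbf j)=\delta_{\mathbf i\mathbf j}e(\mathbf i)$, $\sum_{\mathbf i} e(\mathbf i)=1$, $x_je(\mathbf i)=e(\mathbf i)x_j$, and $x_je(\mathbf i)=0$ if $\mathbf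 i_j$ is red; the $E_{k,d}$ commute with all generators; - $\psi_je(\mathbf i)=0$ if $\mathbf i_j,\mathbf i_{j+1}$ are both red, and $\psi_je(\mathbf i)=e(\sigma_j\mathbf i)\psi_j$ otherwise; - $x_jx_l=x_lx_j$, $\psi_jx_l=x_l\psi_j$ for $l\neq j,j+1$, and $\psi_j\psi_l=\psi_l\psi_j$ for $|j-l|>1$; - $(x_j\psi_j-\psi_jx_{j+1})e(\mathbf i)=(\psi_jx_j-x_{j+1}\psi_j)e(\mathbf i)=e(\mathbf i)$ if $\mathbf i_j=\mathbf i_{j+1}=b$, and both are $0$ otherwise; - $\psi_j^2e(\mathbf i)=\sum_{d=0}^{s_k}(-1)^dx_j^{s_k-d}E_{k,d}e(\mathbf i)$ if $(\mathbf i_j,\mathbf i_{j+1})=(b,s_k)$, $\psi_j^2e(\mathbf i)=\sum_{d=0}^{s_k}(-1)^dx_{j+1}^{s_k-d}E_{k,d}e(\mathbf i)$ if it is $(s_k,b)$, and $0$ otherwise; - $(\psi_j\psi_{j+1}\psi_j-\psi_{j+1}\psi_j\psi_{j+1})e(\mathbf i)=\sum_{a+b+c=s_k-1}(-1)^cx_j^aE_{k,c}x_{j+2}^be(\mathbf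 i)$ if $(\mathbf i_j,\mathbf i_{j+1},\mathbf i_{j+2})=(b,s_k,b)$, and $0$ otherwise. **Theorem.** The algebra $S_C(\lambda,\nu)$ is isomorphic to $W(\mathbf s,n)$. More precisely, there is an isomorphism of $\Bbbk$-algebras $\varphi:W(\mathbf s,n)\to S_C(\lambda,\nu)$ with $\varphi(e(\mathbf i))=e(\mathbf i)$, $\varphi(x_je(\mathbf i))=y_je(\mathbf i)$, $\varphi(E_{k,d}e(\mathbf i))=E_{k,d}e(\mathbf i)$ and $\varphi(\psi_je(\mathbf i))=\Psi_je(\mathbf i)$. -/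

import Mathlib

open scoped BigOperators

namespace KLRSub

/-! ### Cartan data and scalar parameters -/

/-- A Cartan datum on `I`; the bilinear form on `ℤ[I]` is given by its values on basis vectors. -/
structure CartanDatum (I : Type) where
  form : I → I → ℤ
  form_symm : ∀ i j, form i j = form j i
  form_self_pos : ∀ i, 0 < form i i
  form_self_even : ∀ i, Even (form i i)
  form_dvd : ∀ i j, i ≠ j → form i i ∣ 2 * form i j
  form_nonpos : ∀ i j, i ≠ j → form i j ≤ 0

/-- The entries `c(i,j) = 2 (i·j)/(i·i)` of the Cartan matrix (an exact division). -/
def CartanDatum.c {I : Type} (D : CartanDatum I) (i j : I) : ℤ :=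
  2 * D.form i j / D.form i i

/-- Scalar parameters `t(i,j)`, `r(i)`, `s^{pq}(i,j)`. The scalars `s^{pq}(i,j)` are set to `0`
outside the range where they are free. -/
structure ScalarParams (𝕜 : Type*) [CommRing 𝕜] {I : Type} (D : CartanDatum I) where
  t : I → I → 𝕜ˣ
  r : I → 𝕜ˣ
  s : I → I → ℕ → ℕ → 𝕜
  t_self : ∀ i, t i i = 1
  t_symm : ∀ i j, D.form i j = 0 → t i j = t j i
  s_symm : ∀ i j (p q : ℕ), s i j p q = s j i q p
  s_zero : ∀ i j (p q : ℕ),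
    ¬ (i ≠ j ∧ 0 < p ∧ 0 < q ∧ (p : ℤ) * D.form i i + q * D.form j j = -2 * D.form i j) →
      s i j p q = 0

/-! ### Positions

Positions are numbered from `0`. An index `k : Fin (n - 1)` stands for the pair of neighbouring
positions `lo k = k` and `hi k = k + 1` in `Fin n`. -/

def lo {n : ℕ} (k : Fin (n - 1)) : Fin n := ⟨k, by omega⟩

def hi {n : ℕ} (k : Fin (n - 1)) : Fin n := ⟨k + 1, by omega⟩

/-- The action of a simple transposition on sequences. -/
def swapSeq {n : ℕ} {B : Type*} (k : Fin (n - 1)) (i : Fin n → B) : Fin n → B :=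
  fun p => i (Equiv.swap (lo k) (hi k) p)

/-! ### Khovanov–Lauda–Rouquier algebras -/

/-- The generators `e(i)`, `x_j`, `ψ_k`. -/
inductive KLRGen (I : Type) (n : ℕ) : Type
  | e : (Fin n → I) → KLRGen I n
  | x : Fin n → KLRGen I n
  | psi : Fin (n - 1) → KLRGen I n

section KLR

variable {𝕜 : Type*} [CommRing 𝕜] {I : Type} [Fintype I] [DecidableEq I]

/-- The right-hand side of the quadratic relation for neighbouring labels `a`, `b`, evaluated at
`X`, `Y`. If `s^{pq}(a,b) ≠ 0` then `p ≤ -c(a,b)` and `q ≤ -c(b,a)`, so the finite sum runs over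
all nonzero terms. -/
def quadRHS {D : CartanDatum I} (Q : ScalarParams 𝕜 D) {A : Type*} [Ring A] [Algebra 𝕜 A]
    (a b : I) (X Y : A) : A :=
  if a = b then 0
  else if D.form a b = 0 then (Q.t a b : 𝕜) • (1 : A)
  else (Q.t a b : 𝕜) • X ^ (-D.c a b).toNat + (Q.t b a : 𝕜) • Y ^ (-D.c b a).toNat
    + ∑ p ∈ Finset.range ((-D.c a b).toNat + 1), ∑ q ∈ Finset.range ((-D.c b a).toNat + 1),
        Q.s a b p q • (X ^ p * Y ^ q)

/-- The right-hand side of the cubic relation for neighbouring labels `a`, `b`, `a'`, evaluated at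
`X`, `Y`, `Z`. The sums over `d` run over the exponents `d₁ = d`, `d₂ = N - 1 - d`
with `d₁ + d₂ = N - 1`, where `N = -c(a,b)` respectively `N = p`. -/
def cubicRHS {D : CartanDatum I} (Q : ScalarParams 𝕜 D) {A : Type*} [Ring A] [Algebra 𝕜 A]
    (a b a' : I) (X Y Z : A) : A :=
  if a = a' ∧ D.c a b + 1 ≤ 0 then
    ((Q.r a : 𝕜) * (Q.t a b : 𝕜)) •
        ∑ d ∈ Finset.range (-D.c a b).toNat, X ^ d * Z ^ ((-D.c a b).toNat - 1 - d)
      + (Q.r a : 𝕜) •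
        ∑ p ∈ Finset.range ((-D.c a b).toNat + 1), ∑ q ∈ Finset.range ((-D.c b a).toNat + 1),
          Q.s a b p q • ∑ d ∈ Finset.range p, X ^ d * Y ^ q * Z ^ (p - 1 - d)
  else 0

variable (n : ℕ)

namespace Free

variable (𝕜 I) in
abbrev e (i : Fin n → I) : FreeAlgebra 𝕜 (KLRGen I n) := FreeAlgebra.ι 𝕜 (KLRGen.e i)

variable (𝕜 I) in
abbrev x (j : Fin n) : FreeAlgebra 𝕜 (KLRGen I n) := FreeAlgebra.ι 𝕜 (KLRGen.x j)

variable (𝕜 I) in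
abbrev psi (k : Fin (n - 1)) : FreeAlgebra 𝕜 (KLRGen I n) := FreeAlgebra.ι 𝕜 (KLRGen.psi k)

end Free

open Free in
/-- The defining relations of the Khovanov–Lauda–Rouquier algebra. -/
inductive KLRRel {D : CartanDatum I} (Q : ScalarParams 𝕜 D) :
    FreeAlgebra 𝕜 (KLRGen I n) → FreeAlgebra 𝕜 (KLRGen I n) → Prop
  | sum_e : KLRRel Q (∑ i : Fin n → I, e 𝕜 I n i) 1
  | e_e (i j : Fin n → I) :
      KLRRel Q (e 𝕜 I n i * e 𝕜 I n j) (if i = j then e 𝕜 I n i else 0)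
  | x_e (j : Fin n) (i : Fin n → I) : KLRRel Q (x 𝕜 I n j * e 𝕜 I n i) (e 𝕜 I n i * x 𝕜 I n j)
  | psi_e (k : Fin (n - 1)) (i : Fin n → I) :
      KLRRel Q (psi 𝕜 I n k * e 𝕜 I n i) (e 𝕜 I n (swapSeq k i) * psi 𝕜 I n k)
  | x_x (j l : Fin n) : KLRRel Q (x 𝕜 I n j * x 𝕜 I n l) (x 𝕜 I n l * x 𝕜 I n j)
  | psi_x (k : Fin (n - 1)) (l : Fin n) (h₁ : l ≠ lo k) (h₂ : l ≠ hi k) :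
      KLRRel Q (psi 𝕜 I n k * x 𝕜 I n l) (x 𝕜 I n l * psi 𝕜 I n k)
  | psi_psi (j k : Fin (n - 1)) (h : (j : ℕ) + 1 < k) :
      KLRRel Q (psi 𝕜 I n j * psi 𝕜 I n k) (psi 𝕜 I n k * psi 𝕜 I n j)
  | slide₁ (k : Fin (n - 1)) (i : Fin n → I) :
      KLRRel Q
        (x 𝕜 I n (lo k) * psi 𝕜 I n k * e 𝕜 I n i - psi 𝕜 I n k * x 𝕜 I n (hi k) * e 𝕜 I n i)
        (if i (lo k) = i (hi k) then (Q.r (i (lo k)) : 𝕜) • e 𝕜 I n i else 0)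
  | slide₂ (k : Fin (n - 1)) (i : Fin n → I) :
      KLRRel Q
        (psi 𝕜 I n k * x 𝕜 I n (lo k) * e 𝕜 I n i - x 𝕜 I n (hi k) * psi 𝕜 I n k * e 𝕜 I n i)
        (if i (lo k) = i (hi k) then (Q.r (i (lo k)) : 𝕜) • e 𝕜 I n i else 0)
  | quad (k : Fin (n - 1)) (i : Fin n → I) :
      KLRRel Q (psi 𝕜 I n k * psi 𝕜 I n k * e 𝕜 I n i)
        (quadRHS Q (i (lo k)) (i (hi k)) (x 𝕜 I n (lo k)) (x 𝕜 I n (hi k)) * e 𝕜 I n i)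
  | cubic (k l : Fin (n - 1)) (h : (l : ℕ) = k + 1) (i : Fin n → I) :
      KLRRel Q
        ((psi 𝕜 I n k * psi 𝕜 I n l * psi 𝕜 I n k - psi 𝕜 I n l * psi 𝕜 I n k * psi 𝕜 I n l)
          * e 𝕜 I n i)
        (cubicRHS Q (i (lo k)) (i (lo l)) (i (hi l))
          (x 𝕜 I n (lo k)) (x 𝕜 I n (lo l)) (x 𝕜 I n (hi l)) * e 𝕜 I n i)

/-- The Khovanov–Lauda–Rouquier algebra `R_n(Q)`. -/
def KLR {D : CartanDatum I} (Q : ScalarParams 𝕜 D) : Type _ := RingQuot (KLRRel n Q)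

variable {D : CartanDatum I} (Q : ScalarParams 𝕜 D)

instance : Ring (KLR n Q) := inferInstanceAs (Ring (RingQuot (KLRRel n Q)))

instance : Algebra 𝕜 (KLR n Q) := inferInstanceAs (Algebra 𝕜 (RingQuot (KLRRel n Q)))

namespace KLR

noncomputable def mk : FreeAlgebra 𝕜 (KLRGen I n) →ₐ[𝕜] KLR n Q :=
  RingQuot.mkAlgHom 𝕜 (KLRRel n Q)

noncomputable def e (i : Fin n → I) : KLR n Q := mk n Q (Free.e 𝕜 I n i)

/-- `x_j`, with the convention `0` for `j` outside `0, …, n - 1`. -/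
noncomputable def x (j : ℕ) : KLR n Q :=
  if h : j < n then mk n Q (Free.x 𝕜 I n ⟨j, h⟩) else 0

/-- `ψ_k`, the crossing of the strands in positions `k` and `k + 1`, with the convention `0` for
`k` outside `0, …, n - 2`. -/
noncomputable def psi (k : ℕ) : KLR n Q :=
  if h : k < n - 1 then mk n Q (Free.psi 𝕜 I n ⟨k, h⟩) else 0

/-- `ψ_{w₀}` for the longest permutation of the `w` positions starting at `b`, through the reduced
expression `s₁ (s₂ s₁) (s₃ s₂ s₁) ⋯`. -/
noncomputable def psiLongest (b w : ℕ) : KLR n Q :=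
  ((List.range w).map fun r => ((List.range r).reverse.map fun t => psi n Q (b + t)).prod).prod

/-- `x_1^{w-1} x_2^{w-2} ⋯ x_{w-1} ψ_{w₀}` on the `w` positions starting at `b`. -/
noncomputable def nilIdem (b w : ℕ) : KLR n Q :=
  ((List.range w).map fun t => x n Q (b + t) ^ (w - 1 - t)).prod * psiLongest n Q b w

/-- The `d`-th elementary symmetric function in the dots on the `w` positions starting at `b`. -/
noncomputable def elemSymm (b w d : ℕ) : KLR n Q :=
  (((List.range w).sublistsLen d).map fun T => (T.map fun t => x n Q (b + t)).prod).sum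

end KLR

end KLR

/-! ### The extended Cartan datum

The index set `I ∪ Ī` is `I ⊕ I`, with `i = inl i` and `ī = inr i`. -/

section Extended

variable {I : Type} [DecidableEq I]

def extForm (D : CartanDatum I) : I ⊕ I → I ⊕ I → ℤ
  | Sum.inl a, Sum.inl b => D.form a b
  | Sum.inl a, Sum.inr b => if a = b then -(D.form a a / 2) else 0
  | Sum.inr a, Sum.inl b => if a = b then -(D.form a a / 2) else 0
  | Sum.inr a, Sum.inr b => if a = b then D.form a a else 0

def CartanDatum.ext (D : CartanDatum I) : CartanDatum (I ⊕ I) where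
  form := extForm D
  form_symm := by
    rintro (a | a) (b | b)
    · exact D.form_symm a b
    · by_cases h : a = b <;> simp [extForm, h, eq_comm]
    · by_cases h : a = b <;> simp [extForm, h, eq_comm]
    · by_cases h : a = b <;> simp [extForm, h, eq_comm]
  form_self_pos := by
    rintro (a | a)
    · exact D.form_self_pos a
    · simpa [extForm] using D.form_self_pos a
  form_self_even := by
    rintro (a | a)
    · exact D.form_self_even a
    · simpa [extForm] using D.form_self_even a
  form_dvd := by
    rintro (a | a) (b | b) h
    · exact D.form_dvd a b (fun hab => h (by rw [hab]))
    · by_cases hab : a = b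
      · have := (D.form_self_even b).two_dvd
        subst hab
        simp [extForm, Int.mul_ediv_cancel' this]
      · simp [extForm, hab]
    · by_cases hab : a = b
      · have := (D.form_self_even b).two_dvd
        subst hab
        simp [extForm, Int.mul_ediv_cancel' this]
      · simp [extForm, hab]
    · have hab : a ≠ b := fun hab => h (by rw [hab])
      simp [extForm, hab]
  form_nonpos := by
    rintro (a | a) (b | b) h
    · exact D.form_nonpos a b (fun hab => h (by rw [hab]))
    · have := D.form_self_pos a
      by_cases hab : a = b
      · simp only [extForm, hab, if_true]
        subst hab
        omega
      · simp [extForm, hab]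
    · have := D.form_self_pos a
      by_cases hab : a = b
      · simp only [extForm, hab, if_true]
        subst hab
        omega
      · simp [extForm, hab]
    · have hab : a ≠ b := fun hab => h (by rw [hab])
      simp [extForm, hab]

variable {𝕜 : Type*} [CommRing 𝕜] {D : CartanDatum I}

def barT (Q : ScalarParams 𝕜 D) : I ⊕ I → I ⊕ I → 𝕜ˣ
  | Sum.inl a, Sum.inl b => if D.form a b = 0 then 1 else Q.t a b
  | Sum.inl _, Sum.inr _ => 1
  | Sum.inr a, Sum.inl b => if a = b then -1 else 1
  | Sum.inr _, Sum.inr _ => 1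

/-- The specialised scalar parameters of the extended Cartan datum: `t(k̄,k) = -1`, `t(k,k̄) = 1`,
`t = 1` on orthogonal pairs, `r = 1`, `s = 0`; the other `t(i,j)` are those of `Q`. -/
def ScalarParams.bar (Q : ScalarParams 𝕜 D) : ScalarParams 𝕜 D.ext where
  t := barT Q
  r := fun _ => 1
  s := fun _ _ _ _ => 0
  t_self := by
    rintro (a | a)
    · simp [barT, (D.form_self_pos a).ne', Q.t_self a]
    · rfl
  t_symm := by
    rintro (a | a) (b | b) h
    · have h₁ : D.form a b = 0 := h
      have h₂ : D.form b a = 0 := by rw [D.form_symm]; exact h₁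
      simp [barT, h₁, h₂]
    · by_cases hab : b = a
      · subst hab
        have h₁ : -(D.form b b / 2) = 0 := by simpa [CartanDatum.ext, extForm] using h
        have := D.form_self_pos b
        have := (D.form_self_even b).two_dvd
        omega
      · simp [barT, hab]
    · by_cases hab : a = b
      · subst hab
        have h₁ : -(D.form a a / 2) = 0 := by simpa [CartanDatum.ext, extForm] using h
        have := D.form_self_pos a
        have := (D.form_self_even a).two_dvd
        omega
      · simp [barT, hab]
    · rfl
  s_symm := by simp
  s_zero := by simp

end Extended

/-! ### The sequences `Seq(λ, ν)` -/

/-- `i` is a sequence in which every entry of `ν` and every one of the `m` thick entries (given by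
its index in `Fin m`) appears exactly once, the thick entries in increasing order. -/
def IsShuffle {A : Type} {m ℓ : ℕ} (ν : Fin ℓ → A) (i : Fin (m + ℓ) → A ⊕ Fin m) : Prop :=
  ∃ π : Fin (m + ℓ) ≃ Fin ℓ ⊕ Fin m,
    (∀ j, i j = Sum.map ν id (π j)) ∧ StrictMono fun k : Fin m => π.symm (Sum.inr k)

/-- The set `Seq(λ, ν)` for `λ` of length `m`. -/
abbrev ShuffleSeq {A : Type} (m : ℕ) {ℓ : ℕ} (ν : Fin ℓ → A) : Type :=
  {i : Fin (m + ℓ) → A ⊕ Fin m // IsShuffle ν i}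

/-! ### The subalgebra `S_C(λ, ν)`

Here `I = Fin N`, and `lam k a` is the coefficient of `ā` in `λ_k`. -/

section Subalgebra

variable {N m ℓ : ℕ} (lam : Fin m → Fin N → ℕ)

/-- The number `|λ| + ℓ` of strands. -/
def strands (ℓ : ℕ) : ℕ := (∑ k, ∑ a, lam k a) + ℓ

/-- The labels of the strands that an entry of a sequence stands for: one solid strand, or the
dashed strands `1̄ ⋯ 1̄ 2̄ ⋯ 2̄ ⋯ N̄ ⋯ N̄`. -/
def blockWord : Fin N ⊕ Fin m → List (Fin N ⊕ Fin N)
  | Sum.inl a => [Sum.inl a]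
  | Sum.inr k => (List.finRange N).flatMap fun a => List.replicate (lam k a) (Sum.inr a)

/-- The number of strands that an entry of a sequence stands for. -/
def width : Fin N ⊕ Fin m → ℕ
  | Sum.inl _ => 1
  | Sum.inr k => ∑ a, lam k a

theorem length_blockWord (z : Fin N ⊕ Fin m) : (blockWord lam z).length = width lam z := by
  rcases z with a | k
  · rfl
  · simp [blockWord, width, List.length_flatMap, List.sum_ofFn, ← List.ofFn_eq_map]

variable {lam} {ν : Fin ℓ → Fin N}

variable (lam) in
def wordList (i : ShuffleSeq m ν) : List (Fin N ⊕ Fin N) :=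
  (List.ofFn fun j => blockWord lam (i.1 j)).flatten

theorem length_wordList (i : ShuffleSeq m ν) : (wordList lam i).length = strands lam ℓ := by
  obtain ⟨i, π, hπ, -⟩ := i
  have h : (wordList lam ⟨i, π, hπ, ‹_›⟩).length = ∑ j, width lam (i j) := by
    simp [wordList, List.length_flatten, List.map_ofFn, List.sum_ofFn, Function.comp_def,
      length_blockWord]
  rw [h]
  simp only [hπ]
  rw [Equiv.sum_comp π fun z => width lam (Sum.map ν id z)]
  simp [width, strands, add_comm]

variable (lam) in
/-- The sequence in `Ĩ` underlying an element of `Seq(λ, ν)`. -/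
def word (i : ShuffleSeq m ν) : Fin (strands lam ℓ) → Fin N ⊕ Fin N :=
  fun p => (wordList lam i).get (p.cast (length_wordList i).symm)

variable (lam) in
/-- The number of strands to the left of the `j`-th entry. -/
def offset (i : ShuffleSeq m ν) (j : Fin (m + ℓ)) : ℕ :=
  ∑ p ∈ Finset.univ.filter (· < j), width lam (i.1 p)

variable (lam) in
/-- The number of strands in the thick strand `k` to the left of its block of colour `ā`. -/
def blockOffset (k : Fin m) (a : Fin N) : ℕ :=
  ∑ b ∈ Finset.univ.filter (· < a), lam k b

variable {𝕜 : Type*} [CommRing 𝕜] {D : CartanDatum (Fin N)} (Q : ScalarParams 𝕜 D)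

/-- The ambient algebra `R_{|λ|+ℓ}` of the extended Cartan datum. -/
abbrev Ambient (lam : Fin m → Fin N → ℕ) (ℓ : ℕ) {𝕜 : Type*} [CommRing 𝕜]
    {D : CartanDatum (Fin N)} (Q : ScalarParams 𝕜 D) : Type _ :=
  KLR (strands lam ℓ) Q.bar

variable (lam) in
/-- The idempotent of a single entry whose first strand is in position `b`: the identity for a
solid strand, `e_{λ_k}` for a thick strand. -/
noncomputable def entryIdem (b : ℕ) : Fin N ⊕ Fin m → Ambient lam ℓ Q
  | Sum.inl _ => 1
  | Sum.inr k => ((List.finRange N).map fun a =>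
      KLR.nilIdem (strands lam ℓ) Q.bar (b + blockOffset lam k a) (lam k a)).prod

variable (lam) in
/-- The idempotent `e(i)` for `i ∈ Seq(λ, ν)`. -/
noncomputable def eS (i : ShuffleSeq m ν) : Ambient lam ℓ Q :=
  ((List.finRange (m + ℓ)).map fun j => entryIdem lam Q (offset lam i j) (i.1 j)).prod
    * KLR.e (strands lam ℓ) Q.bar (word lam i)

variable (lam) in
/-- The element `y_j e(i)`. -/
noncomputable def yS (j : Fin (m + ℓ)) (i : ShuffleSeq m ν) : Ambient lam ℓ Q :=
  match i.1 j with
  | Sum.inl _ => KLR.x (strands lam ℓ) Q.bar (offset lam i j) * eS lam Q i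
  | Sum.inr _ => 0

variable (lam) in
/-- The element `E_{k,d}^{(a)} e(i)`, where `j` is the position of the thick strand `k` in `i`. -/
noncomputable def thickDotS (k : Fin m) (a : Fin N) (d : ℕ) (j : Fin (m + ℓ))
    (i : ShuffleSeq m ν) : Ambient lam ℓ Q :=
  KLR.elemSymm (strands lam ℓ) Q.bar (offset lam i j + blockOffset lam k a) (lam k a) d
    * eS lam Q i

variable (lam) in
/-- The element `Ψ_j e(i)`. -/
noncomputable def PsiS (j : Fin (m + ℓ - 1)) (i : ShuffleSeq m ν) : Ambient lam ℓ Q :=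
  let b := offset lam i (lo j)
  match i.1 (lo j), i.1 (hi j) with
  | Sum.inl _, Sum.inl _ => KLR.psi (strands lam ℓ) Q.bar b * eS lam Q i
  | Sum.inr k, Sum.inl _ =>
      ((List.range (∑ a, lam k a)).map fun t => KLR.psi (strands lam ℓ) Q.bar (b + t)).prod
        * eS lam Q i
  | Sum.inl _, Sum.inr k =>
      ((List.range (∑ a, lam k a)).reverse.map fun t =>
        KLR.psi (strands lam ℓ) Q.bar (b + t)).prod * eS lam Q i
  | Sum.inr _, Sum.inr _ => 0

variable (lam ν) in
/-- The generators of `S_C(λ, ν)`. -/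
inductive IsGenS : Ambient lam ℓ Q → Prop
  | e (i : ShuffleSeq m ν) : IsGenS (eS lam Q i)
  | y (j : Fin (m + ℓ)) (i : ShuffleSeq m ν) : IsGenS (yS lam Q j i)
  | E (k : Fin m) (a : Fin N) (d : ℕ) (h₁ : 1 ≤ d) (h₂ : d ≤ lam k a) (j : Fin (m + ℓ))
      (i : ShuffleSeq m ν) (h : i.1 j = Sum.inr k) : IsGenS (thickDotS lam Q k a d j i)
  | Psi (j : Fin (m + ℓ - 1)) (i : ShuffleSeq m ν) : IsGenS (PsiS lam Q j i)

variable (lam ν) in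
/-- The subalgebra `S_C(λ, ν)`. Its unit is the sum of the `e(i)`, not the unit of the ambient
algebra, so it is a subalgebra in the non-unital sense. -/
def S : NonUnitalSubalgebra 𝕜 (Ambient lam ℓ Q) :=
  NonUnitalAlgebra.adjoin 𝕜 {z | IsGenS lam ν Q z}

/-- The sequence `λ = (s_1 ī, …, s_m ī)` for `I = {i}`. -/
def lamOne (s : Fin m → ℕ) : Fin m → Fin 1 → ℕ := fun k _ => s k

end Subalgebra

/-! ### The redotted Webster algebra `W(s, n)` -/

section Webster

variable (𝕜 : Type*) [CommRing 𝕜] {m : ℕ} (s : Fin m → ℕ) (n : ℕ)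

/-- The sequences with `n` black entries `inl 0` and the red entries `inr 0, …, inr (m - 1)` once
each and in this order; the red entry `inr k` carries the label `s k`. -/
abbrev WSeq (m n : ℕ) : Type := ShuffleSeq m (fun _ : Fin n => (0 : Fin 1))

/-- Generators: idempotents, dots `x_j` on the strand in position `j` if it is black, dots `E_{k,d}`
with label `d` on the `k`-th red strand, crossings `ψ_j` of the strands in positions `j`, `j + 1`. -/
inductive WGen (m n : ℕ) : Type
  | e : WSeq m n → WGen m n
  | x : Fin (m + n) → WGen m n
  | E : Fin m → ℕ → WGen m n
  | psi : Fin (m + n - 1) → WGen m n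

namespace WFree

variable (m)

abbrev e (i : WSeq m n) : FreeAlgebra 𝕜 (WGen m n) := FreeAlgebra.ι 𝕜 (WGen.e i)

abbrev x (j : Fin (m + n)) : FreeAlgebra 𝕜 (WGen m n) := FreeAlgebra.ι 𝕜 (WGen.x j)

abbrev E (k : Fin m) (d : ℕ) : FreeAlgebra 𝕜 (WGen m n) := FreeAlgebra.ι 𝕜 (WGen.E k d)

abbrev psi (j : Fin (m + n - 1)) : FreeAlgebra 𝕜 (WGen m n) := FreeAlgebra.ι 𝕜 (WGen.psi j)

end WFree

variable {𝕜 n}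

/-- The right-hand side of the relation for `ψ_j²`: two black strands give `0`, a black strand and
the red strand `k` give `∑ (-1)^d x^{s_k - d} E_{k,d}`, where `x` is the dot on the black strand. Two
red strands never cross. -/
def wQuad (p q : Fin 1 ⊕ Fin m) (j : Fin (m + n - 1)) : FreeAlgebra 𝕜 (WGen m n) :=
  match p, q with
  | Sum.inl _, Sum.inr k => ∑ d ∈ Finset.range (s k + 1),
      (-1) ^ d * (WFree.x 𝕜 m n (lo j) ^ (s k - d) * WFree.E 𝕜 m n k d)
  | Sum.inr k, Sum.inl _ => ∑ d ∈ Finset.range (s k + 1),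
      (-1) ^ d * (WFree.x 𝕜 m n (hi j) ^ (s k - d) * WFree.E 𝕜 m n k d)
  | _, _ => 0

/-- The right-hand side of the relation for `ψ_j ψ_{j+1} ψ_j - ψ_{j+1} ψ_j ψ_{j+1}`, where `l = j + 1`:
for the strands black, red `k`, black it is the sum of `(-1)^c x_j^a E_{k,c} x_{j+2}^b` over
`a + b + c = s_k - 1`; it is `0` in all other cases. -/
def wCubic (p q r : Fin 1 ⊕ Fin m) (j l : Fin (m + n - 1)) : FreeAlgebra 𝕜 (WGen m n) :=
  match p, q, r with
  | Sum.inl _, Sum.inr k, Sum.inl _ =>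
      ∑ c ∈ Finset.range (s k), ∑ a ∈ Finset.range (s k - c),
        (-1) ^ c * (WFree.x 𝕜 m n (lo j) ^ a * WFree.E 𝕜 m n k c *
          WFree.x 𝕜 m n (hi l) ^ (s k - 1 - c - a))
  | _, _, _ => 0

open scoped Classical in
open WFree in
/-- The defining relations of `W(s, n)`. Here `Sum.isLeft` selects the black strands. -/
inductive WRel : FreeAlgebra 𝕜 (WGen m n) → FreeAlgebra 𝕜 (WGen m n) → Prop
  | sum_e : WRel (∑ i : WSeq m n, e 𝕜 m n i) 1
  | e_e (i j : WSeq m n) : WRel (e 𝕜 m n i * e 𝕜 m n j) (if i = j then e 𝕜 m n i else 0)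
  | x_e (j : Fin (m + n)) (i : WSeq m n) :
      WRel (x 𝕜 m n j * e 𝕜 m n i) (e 𝕜 m n i * x 𝕜 m n j)
  | x_red (j : Fin (m + n)) (i : WSeq m n) (h : (i.1 j).isLeft = false) :
      WRel (x 𝕜 m n j * e 𝕜 m n i) 0
  | E_zero (k : Fin m) : WRel (E 𝕜 m n k 0) 1
  | E_large (k : Fin m) (d : ℕ) (h : s k < d) : WRel (E 𝕜 m n k d) 0
  | E_comm (k : Fin m) (d : ℕ) (g : WGen m n) :
      WRel (E 𝕜 m n k d * FreeAlgebra.ι 𝕜 g) (FreeAlgebra.ι 𝕜 g * E 𝕜 m n k d)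
  | psi_e (j : Fin (m + n - 1)) (i i' : WSeq m n) (h : i'.1 = swapSeq j i.1) :
      WRel (psi 𝕜 m n j * e 𝕜 m n i) (e 𝕜 m n i' * psi 𝕜 m n j)
  | psi_red_red (j : Fin (m + n - 1)) (i : WSeq m n)
      (h₁ : (i.1 (lo j)).isLeft = false) (h₂ : (i.1 (hi j)).isLeft = false) :
      WRel (psi 𝕜 m n j * e 𝕜 m n i) 0
  | x_x (j l : Fin (m + n)) : WRel (x 𝕜 m n j * x 𝕜 m n l) (x 𝕜 m n l * x 𝕜 m n j)
  | psi_x (j : Fin (m + n - 1)) (l : Fin (m + n)) (h₁ : l ≠ lo j) (h₂ : l ≠ hi j) :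
      WRel (psi 𝕜 m n j * x 𝕜 m n l) (x 𝕜 m n l * psi 𝕜 m n j)
  | psi_psi (j l : Fin (m + n - 1)) (h : (j : ℕ) + 1 < l) :
      WRel (psi 𝕜 m n j * psi 𝕜 m n l) (psi 𝕜 m n l * psi 𝕜 m n j)
  | slide₁ (j : Fin (m + n - 1)) (i : WSeq m n) :
      WRel
        (x 𝕜 m n (lo j) * psi 𝕜 m n j * e 𝕜 m n i - psi 𝕜 m n j * x 𝕜 m n (hi j) * e 𝕜 m n i)
        (if (i.1 (lo j)).isLeft = true ∧ (i.1 (hi j)).isLeft = true then e 𝕜 m n i else 0)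
  | slide₂ (j : Fin (m + n - 1)) (i : WSeq m n) :
      WRel
        (psi 𝕜 m n j * x 𝕜 m n (lo j) * e 𝕜 m n i - x 𝕜 m n (hi j) * psi 𝕜 m n j * e 𝕜 m n i)
        (if (i.1 (lo j)).isLeft = true ∧ (i.1 (hi j)).isLeft = true then e 𝕜 m n i else 0)
  | quad (j : Fin (m + n - 1)) (i : WSeq m n) :
      WRel (psi 𝕜 m n j * psi 𝕜 m n j * e 𝕜 m n i)
        (wQuad s (i.1 (lo j)) (i.1 (hi j)) j * e 𝕜 m n i)
  | cubic (j l : Fin (m + n - 1)) (h : (l : ℕ) = j + 1) (i : WSeq m n) :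
      WRel
        ((psi 𝕜 m n j * psi 𝕜 m n l * psi 𝕜 m n j - psi 𝕜 m n l * psi 𝕜 m n j * psi 𝕜 m n l)
          * e 𝕜 m n i)
        (wCubic s (i.1 (lo j)) (i.1 (lo l)) (i.1 (hi l)) j l * e 𝕜 m n i)

variable (𝕜 n)

/-- The redotted Webster algebra `W(s, n)`. -/
def W : Type _ := RingQuot (WRel (𝕜 := 𝕜) (n := n) s)

instance : Ring (W 𝕜 s n) := inferInstanceAs (Ring (RingQuot (WRel (𝕜 := 𝕜) (n := n) s)))

instance : Algebra 𝕜 (W 𝕜 s n) :=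
  inferInstanceAs (Algebra 𝕜 (RingQuot (WRel (𝕜 := 𝕜) (n := n) s)))

/-- The image of a generator in `W(s, n)`. -/
noncomputable def W.gen (g : WGen m n) : W 𝕜 s n :=
  RingQuot.mkAlgHom 𝕜 (WRel (𝕜 := 𝕜) (n := n) s) (FreeAlgebra.ι 𝕜 g)

end Webster

end KLRSub

/-! Both algebras act faithfully on polynomials, and on a common space a generator of `W` and its
proposed image act by the same operator. The isomorphism is the relation "acts in the same way".

Variables are attached to the letters of a word, indexed by colour and by rank within the colour.
The ambient algebra acts on one copy of the polynomial ring for each word. Neighbouring letters of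
equal colour cross by a divided difference in their two variables; a solid and a dashed letter cross
by multiplication by the difference of their variables in one direction and by `1` in the other. `W`
acts by the same recipe on copies indexed by its sequences (`PolyModel` covers both cases). A black
strand owns a solid variable, and the `k`-th red strand owns a block of `s k` dashed variables.
`E_{k,d}` is an elementary symmetric function of that block, and a black strand crosses it by the
product of the differences `x - z_t`, or by `1`. Expanding this product gives the quadratic
relation, and its difference quotient the cubic one.

The idempotent of a thick strand acts on polynomials as a projection (`nilOp_nilOp`), so `e(i)`
projects onto `thickInvariants`. On that subspace a thick crossing multiplies by the product of its
thin factors, which is exactly how the crossing of `W` acts. Hence `Linked` holds between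
corresponding generators. It is stable under sums, products and scalars, so every element of `W` is
linked to an element of `S`, and conversely (`exists_linked`, `exists_linked'`). That it is the
graph of a bijection is faithfulness on the two sides: `klr_eq_zero` and `w_eq_zero`. The relations
of `W` never have to be checked inside the ambient algebra.

Both faithfulness statements come from `eq_zero_of_forall`, with no basis theorem as input. The
relations alone show that a diagram on `r + 1` strands is a sum of products of a chain, which moves
the last strand to some position, and a diagram on `r` strands (`exists_eq_sum_chain`). Iterated
twisted commutators with dots (`twist`) annihilate the chains ending further to the right and reduce
the leading chain to an injective operator (`chain_cases`). So the coefficients vanish one after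
another, from left to right, and induction on `r` leaves the commutative diagonal part. There the
remaining generators act by algebraically independent polynomials
(`mul_idem_eq_zero_of_algebraicIndependent`). For `W` these are the black variables and the
elementary symmetric functions of the blocks (`algebraicIndependent_w`), tested on a nonzero product
of staircase monomials. -/

set_option linter.unusedSectionVars false

namespace KLRSub

/-! ### Divided difference operators on polynomial rings -/

section Demazure

open MvPolynomial

variable {𝕜 : Type*} [Field 𝕜] {τ : Type*} [DecidableEq τ]

/-- The automorphism of a polynomial ring exchanging two variables. -/
noncomputable def swapVar (𝕜 : Type*) [Field 𝕜] {τ : Type*} [DecidableEq τ] (u v : τ) :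
    MvPolynomial τ 𝕜 →ₐ[𝕜] MvPolynomial τ 𝕜 :=
  rename (Equiv.swap u v)

@[simp] theorem swapVar_X (u v t : τ) :
    swapVar 𝕜 u v (X t : MvPolynomial τ 𝕜) = X (Equiv.swap u v t) := by
  simp [swapVar]

theorem swapVar_swapVar (u v : τ) (f : MvPolynomial τ 𝕜) :
    swapVar 𝕜 u v (swapVar 𝕜 u v f) = f := by
  rw [swapVar, rename_rename]
  have : (⇑(Equiv.swap u v) ∘ ⇑(Equiv.swap u v) : τ → τ) = id := by
    funext t; simp
  rw [this, rename_id_apply]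

theorem swapVar_injective (u v : τ) : Function.Injective (swapVar 𝕜 u v) :=
  Function.LeftInverse.injective (swapVar_swapVar u v)

theorem swapVar_comm {u v u' v' : τ} (h₁ : u ≠ u') (h₂ : u ≠ v') (h₃ : v ≠ u') (h₄ : v ≠ v')
    (f : MvPolynomial τ 𝕜) :
    swapVar 𝕜 u v (swapVar 𝕜 u' v' f) = swapVar 𝕜 u' v' (swapVar 𝕜 u v f) := by
  rw [swapVar, swapVar, rename_rename, rename_rename]
  congr 2
  funext t
  simp only [Function.comp_apply, Equiv.swap_apply_def]
  split_ifs <;> simp_all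

theorem swapVar_braid {u v w : τ} (h₁ : u ≠ v) (h₂ : u ≠ w) (h₃ : v ≠ w)
    (f : MvPolynomial τ 𝕜) :
    swapVar 𝕜 u v (swapVar 𝕜 v w (swapVar 𝕜 u v f))
      = swapVar 𝕜 v w (swapVar 𝕜 u v (swapVar 𝕜 v w f)) := by
  simp only [swapVar, rename_rename]
  congr 2
  funext t
  simp only [Function.comp_apply, Equiv.swap_apply_def]
  split_ifs <;> simp_all

omit [DecidableEq τ] in
theorem X_sub_X_ne_zero {u v : τ} (h : u ≠ v) : (X u - X v : MvPolynomial τ 𝕜) ≠ 0 := by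
  rw [sub_ne_zero]
  exact fun H => h (X_injective H)

/-- Divisibility is clear for a single variable and passes to products through `p q - s(p) s(q) = (p
- s(p)) q + s(p) (q - s(q))`. The quotient is unique because the ring is a domain. -/
theorem exists_sub_swapVar (u v : τ) (f : MvPolynomial τ 𝕜) :
    ∃ g, (X u - X v) * g = f - swapVar 𝕜 u v f := by
  induction f using MvPolynomial.induction_on with
  | C a => exact ⟨0, by simp [swapVar]⟩
  | add p q hp hq =>
    obtain ⟨a, ha⟩ := hp
    obtain ⟨b, hb⟩ := hq
    exact ⟨a + b, by rw [map_add, mul_add, ha, hb]; ring⟩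
  | mul_X p t hp =>
    obtain ⟨a, ha⟩ := hp
    have ht : ∃ c, (X u - X v) * c = (X t - X (Equiv.swap u v t) : MvPolynomial τ 𝕜) := by
      rw [Equiv.swap_apply_def]
      split_ifs with h₁ h₂
      · exact ⟨1, by rw [h₁]; ring⟩
      · exact ⟨-1, by rw [h₂]; ring⟩
      · exact ⟨0, by ring⟩
    obtain ⟨c, hc⟩ := ht
    refine ⟨a * X t + swapVar 𝕜 u v p * c, ?_⟩
    rw [map_mul, swapVar_X]
    linear_combination X t * ha + swapVar 𝕜 u v p * hc

/-- The divided difference operator `f ↦ (f - s f) / (X u - X v)`, where `s` exchanges the distinct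
variables `u` and `v`. -/
noncomputable def demazure (𝕜 : Type*) [Field 𝕜] {τ : Type*} [DecidableEq τ] (u v : τ) :
    MvPolynomial τ 𝕜 →ₗ[𝕜] MvPolynomial τ 𝕜 :=
  if h : u = v then 0 else
  { toFun := fun f => (exists_sub_swapVar u v f).choose
    map_add' := fun f g => by
      apply mul_left_cancel₀ (X_sub_X_ne_zero (𝕜 := 𝕜) h)
      rw [mul_add, (exists_sub_swapVar u v _).choose_spec, (exists_sub_swapVar u v _).choose_spec,
        (exists_sub_swapVar u v _).choose_spec, map_add]
      ring
    map_smul' := fun c f => by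
      apply mul_left_cancel₀ (X_sub_X_ne_zero (𝕜 := 𝕜) h)
      rw [RingHom.id_apply, mul_smul_comm, (exists_sub_swapVar u v _).choose_spec,
        (exists_sub_swapVar u v _).choose_spec, map_smul, smul_sub] }

variable {u v : τ}

theorem X_sub_X_mul_demazure (h : u ≠ v) (f : MvPolynomial τ 𝕜) :
    (X u - X v) * demazure 𝕜 u v f = f - swapVar 𝕜 u v f := by
  rw [demazure, dif_neg h]
  exact (exists_sub_swapVar u v f).choose_spec

theorem demazure_eq_iff (h : u ≠ v) (f g : MvPolynomial τ 𝕜) :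
    demazure 𝕜 u v f = g ↔ f - swapVar 𝕜 u v f = (X u - X v) * g := by
  rw [← X_sub_X_mul_demazure h]
  exact ⟨fun H => by rw [H], fun H => mul_left_cancel₀ (X_sub_X_ne_zero h) H⟩

theorem demazure_mul (h : u ≠ v) (f g : MvPolynomial τ 𝕜) :
    demazure 𝕜 u v (f * g) = demazure 𝕜 u v f * g + swapVar 𝕜 u v f * demazure 𝕜 u v g := by
  rw [demazure_eq_iff h, map_mul]
  linear_combination -g * X_sub_X_mul_demazure h f - swapVar 𝕜 u v f * X_sub_X_mul_demazure h g

theorem demazure_eq_zero (h : u ≠ v) {f : MvPolynomial τ 𝕜} (hf : swapVar 𝕜 u v f = f) :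
    demazure 𝕜 u v f = 0 := by
  rw [demazure_eq_iff h, hf]; ring

theorem swapVar_eq_of_demazure_eq_zero (h : u ≠ v) {f : MvPolynomial τ 𝕜}
    (hf : demazure 𝕜 u v f = 0) : swapVar 𝕜 u v f = f := by
  rw [demazure_eq_iff h] at hf
  linear_combination -hf

theorem demazure_mul_of_swapVar_eq (h : u ≠ v) {f : MvPolynomial τ 𝕜}
    (hf : swapVar 𝕜 u v f = f) (g : MvPolynomial τ 𝕜) :
    demazure 𝕜 u v (f * g) = f * demazure 𝕜 u v g := by
  rw [demazure_mul h, demazure_eq_zero h hf, hf]; ring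

theorem demazure_X_left (h : u ≠ v) : demazure 𝕜 u v (X u) = 1 := by
  rw [demazure_eq_iff h]; simp

theorem demazure_X_right (h : u ≠ v) : demazure 𝕜 u v (X v) = -1 := by
  rw [demazure_eq_iff h]; simp

/-- Numerator and denominator of the difference quotient both change sign. -/
theorem swapVar_demazure (h : u ≠ v) (f : MvPolynomial τ 𝕜) :
    swapVar 𝕜 u v (demazure 𝕜 u v f) = demazure 𝕜 u v f := by
  apply mul_left_cancel₀ (X_sub_X_ne_zero (𝕜 := 𝕜) h)
  have H := congrArg (swapVar 𝕜 u v) (X_sub_X_mul_demazure h f)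
  simp only [map_mul, map_sub, swapVar_X, Equiv.swap_apply_left, Equiv.swap_apply_right,
    swapVar_swapVar] at H
  linear_combination -H - X_sub_X_mul_demazure h f

theorem demazure_demazure (h : u ≠ v) (f : MvPolynomial τ 𝕜) :
    demazure 𝕜 u v (demazure 𝕜 u v f) = 0 :=
  demazure_eq_zero h (swapVar_demazure h f)

theorem demazure_swapVar_comm {u' v' : τ} (h : u ≠ v) (h₁ : u ≠ u') (h₂ : u ≠ v') (h₃ : v ≠ u')
    (h₄ : v ≠ v') (f : MvPolynomial τ 𝕜) :
    demazure 𝕜 u v (swapVar 𝕜 u' v' f) = swapVar 𝕜 u' v' (demazure 𝕜 u v f) := by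
  have H := congrArg (swapVar 𝕜 u' v') (X_sub_X_mul_demazure h f)
  rw [demazure_eq_iff h, swapVar_comm h₁ h₂ h₃ h₄, ← map_sub, ← H]
  simp [Equiv.swap_apply_of_ne_of_ne, h₁, h₂, h₃, h₄]

theorem demazure_comm {u' v' : τ} (h : u ≠ v) (h' : u' ≠ v') (h₁ : u ≠ u') (h₂ : u ≠ v')
    (h₃ : v ≠ u') (h₄ : v ≠ v') (f : MvPolynomial τ 𝕜) :
    demazure 𝕜 u v (demazure 𝕜 u' v' f) = demazure 𝕜 u' v' (demazure 𝕜 u v f) := by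
  symm
  rw [demazure_eq_iff h', ← demazure_swapVar_comm h h₁ h₂ h₃ h₄, ← map_sub,
    ← X_sub_X_mul_demazure h', demazure_mul_of_swapVar_eq h]
  simp [Equiv.swap_apply_of_ne_of_ne, h₁.symm, h₂.symm, h₃.symm, h₄.symm]

/-- Clearing all denominators leaves the alternating sum of the permutations of the three variables.
This form makes the braid relation visible, since the sum depends on the chosen reduced word only
through the longest permutation. -/
theorem demazure_demazure_demazure {w : τ} (h₁ : u ≠ v) (h₂ : u ≠ w) (h₃ : v ≠ w)
    (f : MvPolynomial τ 𝕜) :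
    (X u - X v) * (X v - X w) * (X u - X w)
        * demazure 𝕜 u v (demazure 𝕜 v w (demazure 𝕜 u v f))
      = f - swapVar 𝕜 u v f - swapVar 𝕜 v w f + swapVar 𝕜 v w (swapVar 𝕜 u v f)
        + swapVar 𝕜 u v (swapVar 𝕜 v w f) - swapVar 𝕜 u v (swapVar 𝕜 v w (swapVar 𝕜 u v f)) := by
  set a := demazure 𝕜 u v f
  set b := demazure 𝕜 v w a
  have ha := X_sub_X_mul_demazure h₁ f
  have hb := X_sub_X_mul_demazure h₃ a
  have hc := X_sub_X_mul_demazure h₁ b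
  have ha₁ := congrArg (swapVar 𝕜 v w) ha
  have hb₁ := congrArg (swapVar 𝕜 u v) hb
  have ha₂ := congrArg (swapVar 𝕜 u v) ha₁
  have hs : swapVar 𝕜 u v a = a := swapVar_demazure h₁ f
  simp only [map_mul, map_sub, swapVar_X, Equiv.swap_apply_left, Equiv.swap_apply_right,
    Equiv.swap_apply_of_ne_of_ne h₂.symm h₃.symm, Equiv.swap_apply_of_ne_of_ne h₁ h₂, hs]
    at ha₁ hb₁ ha₂
  have e : ∀ p q : MvPolynomial τ 𝕜, (X u - X v) * p = (X u - X v) * q → p = q :=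
    fun p q H => mul_left_cancel₀ (X_sub_X_ne_zero h₁) H
  apply e
  linear_combination (X u - X v) * (X v - X w) * (X u - X w) * hc
    + (X u - X v) * (X u - X w) * hb - (X u - X v) * (X v - X w) * hb₁
    + (X u - X v) * ha - (X u - X v) * ha₁ + (X u - X v) * ha₂

theorem swapVar_symm (u v : τ) : swapVar 𝕜 u v = swapVar 𝕜 v u := by
  rw [swapVar, swapVar, Equiv.swap_comm]

theorem demazure_symm (h : u ≠ v) (f : MvPolynomial τ 𝕜) :
    demazure 𝕜 u v f = -demazure 𝕜 v u f := by
  rw [demazure_eq_iff h, swapVar_symm]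
  linear_combination -X_sub_X_mul_demazure h.symm f

/-- Reversing the order of the three variables exchanges the two composites. The Vandermonde factor
and the composite each pick up the sign `(-1)^3`, and the alternating sums agree by the braid
relation for exchanges. -/
theorem demazure_braid {w : τ} (h₁ : u ≠ v) (h₂ : u ≠ w) (h₃ : v ≠ w) (f : MvPolynomial τ 𝕜) :
    demazure 𝕜 u v (demazure 𝕜 v w (demazure 𝕜 u v f))
      = demazure 𝕜 v w (demazure 𝕜 u v (demazure 𝕜 v w f)) := by
  have hne : (X u - X v) * (X v - X w) * (X u - X w) ≠ (0 : MvPolynomial τ 𝕜) :=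
    mul_ne_zero (mul_ne_zero (X_sub_X_ne_zero h₁) (X_sub_X_ne_zero h₃)) (X_sub_X_ne_zero h₂)
  apply mul_left_cancel₀ hne
  have H := demazure_demazure_demazure (𝕜 := 𝕜) h₃.symm h₂.symm h₁.symm f
  rw [demazure_symm h₃.symm, demazure_symm h₁.symm, demazure_symm h₃.symm,
    swapVar_symm w v, swapVar_symm v u] at H
  simp only [map_neg, neg_neg] at H
  have H' := swapVar_braid (𝕜 := 𝕜) h₁ h₂ h₃ f
  linear_combination demazure_demazure_demazure h₁ h₂ h₃ f - H - H'

end Demazure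

/-! ### The longest element of a nilCoxeter algebra -/

section NilCoxeter

variable {A : Type*} [MonoidWithZero A]

/-- The product `d (r - 1) ⋯ d 1 d 0`. -/
def descProd (d : ℕ → A) (r : ℕ) : A := ((List.range r).reverse.map d).prod

/-- The product `d 0 (d 1 d 0) (d 2 d 1 d 0) ⋯` for the longest permutation of `w` letters. -/
def longestProd (d : ℕ → A) (w : ℕ) : A := ((List.range w).map (descProd d)).prod

variable (d : ℕ → A)

theorem descProd_succ (r : ℕ) : descProd d (r + 1) = d r * descProd d r := by
  simp [descProd, List.range_succ]

theorem longestProd_succ (w : ℕ) : longestProd d (w + 1) = longestProd d w * descProd d w := by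
  simp [longestProd, List.range_succ]

variable {d} (hsq : ∀ t, d t * d t = 0)
  (hbr : ∀ t, d t * d (t + 1) * d t = d (t + 1) * d t * d (t + 1))
  (hfar : ∀ t t', t + 1 < t' → d t * d t' = d t' * d t)

include hfar in
theorem commute_descProd {r t : ℕ} (h : r < t) : Commute (d t) (descProd d r) := by
  induction r with
  | zero => simp [descProd]
  | succ r ih =>
    rw [descProd_succ]
    exact (show Commute (d t) (d r) from (hfar r t h).symm).mul_right (ih (by omega))

include hfar in
theorem commute_longestProd {w t : ℕ} (h : w ≤ t) : Commute (d t) (longestProd d w) := by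
  induction w with
  | zero => simp [longestProd]
  | succ w ih =>
    rw [longestProd_succ]
    exact (ih (by omega)).mul_right (commute_descProd hfar (by omega))

include hbr hfar in
-- The factor `d t` commutes with everything until it meets `d (t + 1) * d t`. There one braid move
-- turns it into `d (t + 1)`, which commutes with the rest.
theorem mul_descProd {r t : ℕ} (h : t + 1 < r) :
    d t * descProd d r = descProd d r * d (t + 1) := by
  induction r with
  | zero => omega
  | succ r ih =>
    rw [descProd_succ]
    rcases Nat.lt_or_ge (t + 1) r with h' | h'
    · rw [← mul_assoc, hfar t r h', mul_assoc, ih h', mul_assoc]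
    · obtain rfl : r = t + 1 := by omega
      rw [descProd_succ, ← mul_assoc, ← mul_assoc, hbr, ← mul_assoc, mul_assoc,
        (commute_descProd hfar (Nat.lt_succ_self t)).eq]
      simp only [mul_assoc]

include hbr hfar in
theorem descProd_mul_descProd_succ {r r' : ℕ} (h : r' ≤ r) :
    ∃ y, descProd d r' * descProd d (r + 1) = descProd d (r + 1) * y := by
  induction r' with
  | zero => exact ⟨1, by simp [descProd]⟩
  | succ r' ih =>
    obtain ⟨y, hy⟩ := ih (by omega)
    exact ⟨d (r' + 1) * y, by
      rw [descProd_succ, mul_assoc, hy, ← mul_assoc, mul_descProd hbr hfar (by omega), mul_assoc]⟩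

include hsq hbr hfar in
-- Moving the shorter product `descProd d r` through the second factor leaves `d r` next to a
-- product that itself begins with `d r`, and `d r` squares to zero.
theorem descProd_mul_self (r : ℕ) : descProd d (r + 1) * descProd d (r + 1) = 0 := by
  obtain ⟨y, hy⟩ := descProd_mul_descProd_succ hbr hfar le_rfl (r := r)
  conv_lhs => rw [descProd_succ d r, mul_assoc, ← descProd_succ, hy, descProd_succ]
  rw [← mul_assoc, ← mul_assoc, hsq, zero_mul, zero_mul]

include hsq hbr hfar in
-- By induction only the largest index `t = w - 2` is new. There `d t` commutes past `longestProd d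
-- t` and completes `descProd d t` to `descProd d (t + 1)`, which meets a second copy of itself.
theorem mul_longestProd {w t : ℕ} (h : t + 1 < w) : d t * longestProd d w = 0 := by
  induction w with
  | zero => omega
  | succ w ih =>
    rw [longestProd_succ]
    rcases Nat.lt_or_ge (t + 1) w with h' | h'
    · rw [← mul_assoc, ih h', zero_mul]
    · obtain rfl : w = t + 1 := by omega
      rw [← mul_assoc, longestProd_succ, ← mul_assoc, (commute_longestProd hfar le_rfl).eq,
        mul_assoc (longestProd d t), ← descProd_succ, mul_assoc, descProd_mul_self hsq hbr hfar,
        mul_zero]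

end NilCoxeter

/-! ### The nilHecke idempotent on polynomials -/

section NilHecke

open MvPolynomial

variable {𝕜 : Type*} [Field 𝕜] {τ : Type*} [DecidableEq τ]

/-- The monomial `z 0 ^ (w - 1) * z 1 ^ (w - 2) * ⋯ * z (w - 2)`. -/
noncomputable def staircase (𝕜 : Type*) [Field 𝕜] {τ : Type*} (z : ℕ → τ) (w : ℕ) :
    MvPolynomial τ 𝕜 :=
  ((List.range w).map fun t => X (z t) ^ (w - 1 - t)).prod

/-- The operator by which the nilHecke idempotent on `w` strands acts on polynomials. -/
noncomputable def nilOp (𝕜 : Type*) [Field 𝕜] {τ : Type*} [DecidableEq τ] (z : ℕ → τ) (w : ℕ) :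
    Module.End 𝕜 (MvPolynomial τ 𝕜) :=
  LinearMap.mulLeft 𝕜 (staircase 𝕜 z w) * longestProd (fun t => demazure 𝕜 (z t) (z (t + 1))) w

variable {z : ℕ → τ}

theorem list_prod_map_range {M : Type*} [CommMonoid M] (f : ℕ → M) (w : ℕ) :
    ((List.range w).map f).prod = ∏ t ∈ Finset.range w, f t := by
  induction w with
  | zero => simp
  | succ w ih => rw [List.range_succ, Finset.prod_range_succ, ← ih]; simp

theorem swapVar_prod_pow (hz : Function.Injective z) (e : ℕ → ℕ) {w t : ℕ} (h : t + 1 < w)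
    (he : e t = e (t + 1)) :
    swapVar 𝕜 (z t) (z (t + 1)) (∏ u ∈ Finset.range w, X (z u) ^ e u)
      = ∏ u ∈ Finset.range w, X (z u) ^ e u := by
  rw [map_prod]
  refine Finset.prod_equiv (Equiv.swap t (t + 1)) (fun u => ?_) (fun u _ => ?_)
  · simp only [Finset.mem_range, Equiv.swap_apply_def]; split_ifs <;> omega
  · rw [map_pow, swapVar_X, hz.swap_apply]
    congr 1
    rw [Equiv.swap_apply_def]; split_ifs with h₁ h₂
    · rw [h₁, he]
    · rw [h₂, he]
    · rfl

/-- The last descending product lowers the staircase on `w + 1` variables to the one on `w`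
variables. Just before the `r`-th operator acts, the monomial is `X (z r)` times a factor symmetric
in `z r` and `z (r + 1)`, so the operator merely removes that `X (z r)`. -/
theorem longestProd_staircase (hz : Function.Injective z) (w : ℕ) (h : MvPolynomial τ 𝕜)
    (hh : ∀ t, t + 1 < w → swapVar 𝕜 (z t) (z (t + 1)) h = h) :
    longestProd (fun t => demazure 𝕜 (z t) (z (t + 1))) w (staircase 𝕜 z w * h) = h := by
  induction w with
  | zero => simp [longestProd, staircase]
  | succ w ih =>
    -- `e r u` is the exponent of `z u` after the first `r` operators: the variables with `u < r`
    -- have already lost one power.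
    set e : ℕ → ℕ → ℕ := fun r u => if r ≤ u then w - u else w - 1 - u with he
    have key : ∀ r, r ≤ w → descProd (fun t => demazure 𝕜 (z t) (z (t + 1))) r
        (staircase 𝕜 z (w + 1) * h) = (∏ u ∈ Finset.range (w + 1), X (z u) ^ e r u) * h := by
      intro r hr
      induction r with
      | zero => simp [descProd, staircase, list_prod_map_range, he]
      | succ r ihr =>
        rw [descProd_succ, Module.End.mul_apply, ihr (by omega)]
        have hne : z r ≠ z (r + 1) := fun H => by have := hz H; omega
        have h₁ : (∏ u ∈ Finset.range (w + 1), (X (z u) : MvPolynomial τ 𝕜) ^ e r u)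
            = X (z r) * ∏ u ∈ Finset.range (w + 1), X (z u) ^ e (r + 1) u := by
          have : (X (z r) : MvPolynomial τ 𝕜)
              = ∏ u ∈ Finset.range (w + 1), X (z u) ^ (if u = r then 1 else 0) := by
            simp only [pow_ite, pow_one, pow_zero]
            rw [Finset.prod_ite_eq' (Finset.range (w + 1)) r, if_pos (by simp; omega)]
          rw [this, ← Finset.prod_mul_distrib]
          refine Finset.prod_congr rfl fun u hu => ?_
          rw [← pow_add]
          congr 1
          simp only [he]
          have := Finset.mem_range.1 hu
          split_ifs <;> omega
        rw [h₁, mul_assoc, mul_comm, demazure_mul_of_swapVar_eq hne, demazure_X_left hne, mul_one]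
        rw [map_mul, swapVar_prod_pow hz _ (by omega), hh r (by omega)]
        simp only [he]; split_ifs <;> omega
    rw [longestProd_succ, Module.End.mul_apply, key w le_rfl]
    have h₂ : (∏ u ∈ Finset.range (w + 1), (X (z u) : MvPolynomial τ 𝕜) ^ e w u)
        = staircase 𝕜 z w := by
      rw [Finset.prod_range_succ, staircase, list_prod_map_range]
      have : e w w = 0 := by simp [he]
      rw [this, pow_zero, mul_one]
      refine Finset.prod_congr rfl fun u hu => ?_
      have := Finset.mem_range.1 hu
      simp only [he]; rw [if_neg (by omega)]
    rw [h₂]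
    exact ih fun t ht => hh t (by omega)

/-- Divided differences satisfy the nilCoxeter relations, so `mul_longestProd` applies. The
consequence used is that values of the longest product are symmetric in the block. -/
theorem demazure_longestProd (hz : Function.Injective z) (w t : ℕ) (ht : t + 1 < w)
    (f : MvPolynomial τ 𝕜) :
    demazure 𝕜 (z t) (z (t + 1))
      (longestProd (fun t => demazure 𝕜 (z t) (z (t + 1))) w f) = 0 := by
  have hne : ∀ a b, a ≠ b → z a ≠ z b := fun a b H H' => H (hz H')
  have := mul_longestProd (A := Module.End 𝕜 (MvPolynomial τ 𝕜))
    (d := fun t => demazure 𝕜 (z t) (z (t + 1)))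
    (fun t => LinearMap.ext fun f => demazure_demazure (hne _ _ (by omega)) f)
    (fun t => LinearMap.ext fun f =>
      demazure_braid (hne _ _ (by omega)) (hne _ _ (by omega)) (hne _ _ (by omega)) f)
    (fun t t' h => LinearMap.ext fun f => demazure_comm (hne _ _ (by omega)) (hne _ _ (by omega))
      (hne _ _ (by omega)) (hne _ _ (by omega)) (hne _ _ (by omega)) (hne _ _ (by omega)) f) ht
  exact LinearMap.congr_fun this f

/-- The operator has the form `f ↦ staircase * σ(f)` with `σ(f)` symmetric, and `σ` recovers `h`
from `staircase * h` for symmetric `h`. -/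
theorem nilOp_nilOp (hz : Function.Injective z) (w : ℕ) (f : MvPolynomial τ 𝕜) :
    nilOp 𝕜 z w (nilOp 𝕜 z w f) = nilOp 𝕜 z w f := by
  simp only [nilOp, Module.End.mul_apply, LinearMap.mulLeft_apply]
  rw [longestProd_staircase hz]
  intro t ht
  exact swapVar_eq_of_demazure_eq_zero (fun H => by have := hz H; omega)
    (demazure_longestProd hz w t ht f)

/-- The idempotent commutes with multiplication by polynomials symmetric in its strands. -/
theorem nilOp_mul (hz : Function.Injective z) (w : ℕ) {h : MvPolynomial τ 𝕜}
    (hh : ∀ t, t + 1 < w → swapVar 𝕜 (z t) (z (t + 1)) h = h) (f : MvPolynomial τ 𝕜) :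
    nilOp 𝕜 z w (h * f) = h * nilOp 𝕜 z w f := by
  have hd : ∀ r, r < w → ∀ f, descProd (fun t => demazure 𝕜 (z t) (z (t + 1))) r (h * f)
      = h * descProd (fun t => demazure 𝕜 (z t) (z (t + 1))) r f := by
    intro r hr
    induction r with
    | zero => simp [descProd]
    | succ r ih =>
      intro f
      rw [descProd_succ, Module.End.mul_apply, ih (by omega), Module.End.mul_apply,
        demazure_mul_of_swapVar_eq (fun H => by have := hz H; omega) (hh r hr)]
  have hl : ∀ r, r ≤ w → ∀ f, longestProd (fun t => demazure 𝕜 (z t) (z (t + 1))) r (h * f)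
      = h * longestProd (fun t => demazure 𝕜 (z t) (z (t + 1))) r f := by
    intro r hr
    induction r with
    | zero => simp [longestProd]
    | succ r ih =>
      intro f
      rw [longestProd_succ, Module.End.mul_apply, hd r (by omega), ih (by omega),
        Module.End.mul_apply]
  simp only [nilOp, Module.End.mul_apply, LinearMap.mulLeft_apply]
  rw [hl w le_rfl]; ring

theorem nilOp_staircase (hz : Function.Injective z) (w : ℕ) :
    nilOp 𝕜 z w (staircase 𝕜 z w) = staircase 𝕜 z w := by
  have := longestProd_staircase (𝕜 := 𝕜) hz w 1 (fun t _ => map_one _)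
  rw [mul_one] at this
  simp only [nilOp, Module.End.mul_apply, LinearMap.mulLeft_apply, this, mul_one]

end NilHecke

end KLRSub

namespace KLRSub

/-! ### Labelling the letters of a word by colour and rank -/

section Labels

variable {C : Type} {N : ℕ}

theorem lo_ne_hi (j : Fin (N - 1)) : lo j ≠ hi j := by
  intro h; have := congrArg Fin.val h; simp [lo, hi] at this

@[simp] theorem swapSeq_lo (j : Fin (N - 1)) (i : Fin N → C) : swapSeq j i (lo j) = i (hi j) := by
  simp [swapSeq]

@[simp] theorem swapSeq_hi (j : Fin (N - 1)) (i : Fin N → C) : swapSeq j i (hi j) = i (lo j) := by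
  simp [swapSeq]

theorem swapSeq_of_ne {j : Fin (N - 1)} {p : Fin N} (h₁ : p ≠ lo j) (h₂ : p ≠ hi j)
    (i : Fin N → C) : swapSeq j i p = i p := by
  simp [swapSeq, Equiv.swap_apply_of_ne_of_ne h₁ h₂]

@[simp] theorem swapSeq_swapSeq (j : Fin (N - 1)) (i : Fin N → C) :
    swapSeq j (swapSeq j i) = i := by
  funext p; simp [swapSeq]

theorem swapSeq_eq_self {j : Fin (N - 1)} {i : Fin N → C} (h : i (lo j) = i (hi j)) :
    swapSeq j i = i := by
  funext p
  simp only [swapSeq, Equiv.swap_apply_def]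
  split_ifs with h₁ h₂
  · rw [h₁, h]
  · rw [h₂, h]
  · rfl

variable [DecidableEq C]

/-- The number of earlier letters of the same colour. -/
def rank (i : Fin N → C) (p : Fin N) : ℕ := (Finset.univ.filter fun q => q < p ∧ i q = i p).card

/-- The letter in position `p` of a word, labelled by its colour and its rank. -/
def lab (i : Fin N → C) (p : Fin N) : C × ℕ := (i p, rank i p)

/-- The label of the next letter of the same colour. -/
def up (ℓ : C × ℕ) : C × ℕ := (ℓ.1, ℓ.2 + 1)

theorem up_ne (ℓ : C × ℕ) : ℓ ≠ up ℓ := by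
  intro h; have := congrArg Prod.snd h; simp [up] at this

@[simp] theorem lab_fst (i : Fin N → C) (p : Fin N) : (lab i p).1 = i p := rfl

theorem rank_lt_rank {i : Fin N → C} {p p' : Fin N} (h : p < p') (hi : i p = i p') :
    rank i p < rank i p' := by
  apply Finset.card_lt_card
  rw [Finset.ssubset_iff_of_subset]
  · exact ⟨p, by simp [h, hi], by simp⟩
  · intro q hq
    simp only [Finset.mem_filter, Finset.mem_univ, true_and] at hq ⊢
    exact ⟨hq.1.trans h, hq.2.trans hi⟩

theorem lab_injective (i : Fin N → C) : Function.Injective (lab i) := by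
  intro p p' h
  have h₁ : i p = i p' := congrArg Prod.fst h
  have h₂ : rank i p = rank i p' := congrArg Prod.snd h
  rcases lt_trichotomy p p' with H | H | H
  · have := rank_lt_rank H h₁; omega
  · exact H
  · have := rank_lt_rank H h₁.symm; omega

theorem swap_lt_swap_iff (j : Fin (N - 1)) (q p : Fin N)
    (h₁ : ¬ (q = lo j ∧ p = hi j)) (h₂ : ¬ (q = hi j ∧ p = lo j)) :
    Equiv.swap (lo j) (hi j) q < Equiv.swap (lo j) (hi j) p ↔ q < p := by
  simp only [Equiv.swap_apply_def, lo, hi, Fin.ext_iff, Fin.lt_def] at *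
  split_ifs <;> simp_all <;> omega

/-- Exchanging neighbours of different colours leaves the order within each colour alone, so a
letter carries its label along. This is why variables are attached to labels and not to positions: a
crossing of different colours then needs no renaming of variables. -/
theorem lab_swapSeq {j : Fin (N - 1)} {i : Fin N → C} (h : i (lo j) ≠ i (hi j)) (p : Fin N) :
    lab (swapSeq j i) p = lab i (Equiv.swap (lo j) (hi j) p) := by
  refine Prod.ext rfl ?_
  change rank _ _ = rank _ _
  unfold rank
  refine Finset.card_equiv (Equiv.swap (lo j) (hi j)) fun q => ?_
  rw [Finset.mem_filter, Finset.mem_filter]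
  simp only [Finset.mem_univ, true_and]
  refine and_congr_left fun hq => (swap_lt_swap_iff j q p ?_ ?_).symm
  · rintro ⟨rfl, rfl⟩
    simp only [swapSeq, Equiv.swap_apply_left, Equiv.swap_apply_right] at hq
    exact h hq.symm
  · rintro ⟨rfl, rfl⟩
    simp only [swapSeq, Equiv.swap_apply_left, Equiv.swap_apply_right] at hq
    exact h hq

theorem lab_hi {j : Fin (N - 1)} {i : Fin N → C} (h : i (lo j) = i (hi j)) :
    lab i (hi j) = up (lab i (lo j)) := by
  refine Prod.ext h.symm ?_
  have : (Finset.univ.filter fun q => q < hi j ∧ i q = i (hi j))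
      = insert (lo j) (Finset.univ.filter fun q => q < lo j ∧ i q = i (lo j)) := by
    ext q
    simp only [Finset.mem_filter, Finset.mem_univ, true_and, Finset.mem_insert, h]
    constructor
    · rintro ⟨h₁, h₂⟩
      by_cases hq : q = lo j
      · exact Or.inl hq
      · refine Or.inr ⟨?_, h₂⟩
        simp only [lo, hi, Fin.lt_def, Fin.ext_iff] at *
        omega
    · rintro (rfl | ⟨h₁, h₂⟩)
      · exact ⟨by simp [lo, hi, Fin.lt_def], h⟩
      · refine ⟨?_, h₂⟩
        simp only [lo, hi, Fin.lt_def] at *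
        omega
  simp only [lab, rank, up, this]
  rw [Finset.card_insert_of_notMem (by simp)]

end Labels

/-! ### Polynomial representations -/

open MvPolynomial in
/-- The combinatorial data of a polynomial representation: a set of words, the variables attached
to the letters whose colour may be repeated, and the polynomials by which crossings of letters of
different colours act, as functions of the labels of the left and the right letter of the result. -/
structure PolyModel (𝕜 : Type*) [Field 𝕜] (C τ J : Type) [DecidableEq τ] [DecidableEq C]
    (N : ℕ) where
  w : J → Fin N → C
  w_inj : Function.Injective w
  -- The active colours, those with dots. Every colour is active in the ambient algebra; in the
  -- Webster algebra only black is, since each red letter occurs once and two red letters never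
  -- cross.
  B : C → Prop
  v : C × ℕ → τ
  v_inj : ∀ a b, B a.1 → B b.1 → v a = v b → a = b
  rep : ∀ i p p', p ≠ p' → w i p = w i p' → B (w i p)
  ex : ∀ i j, (B (w i (lo j)) ∨ B (w i (hi j))) → ∃ i', w i' = swapSeq j (w i)
  q : C × ℕ → C × ℕ → MvPolynomial τ 𝕜
  q_ne : ∀ a b, a.1 ≠ b.1 → q a b ≠ 0
  -- Equivariance under renumbering two letters of one colour. It makes products of crossing
  -- polynomials commute with divided differences, both for distant crossings and for triples
  -- containing a neighbouring equal pair.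
  q_swap : ∀ ℓ a b, B ℓ.1 → a.1 ≠ b.1 →
    swapVar 𝕜 (v ℓ) (v (up ℓ)) (q a b) = q (Equiv.swap ℓ (up ℓ) a) (Equiv.swap ℓ (up ℓ) b)

namespace PolyModel

variable {𝕜 : Type*} [Field 𝕜] {C τ J : Type} [DecidableEq τ] [DecidableEq C] {N : ℕ}
  (M : PolyModel 𝕜 C τ J N)

/-- The representation space. -/
abbrev Space (_ : PolyModel 𝕜 C τ J N) : Type _ := J → MvPolynomial τ 𝕜

open scoped Classical in
/-- The variable of a labelled letter; `0` for the colours that are never repeated. -/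
noncomputable def X (ℓ : C × ℕ) : MvPolynomial τ 𝕜 :=
  if M.B ℓ.1 then MvPolynomial.X (M.v ℓ) else 0

/-- The automorphism exchanging the variables of `ℓ` and the next letter of the same colour. -/
noncomputable def s (ℓ : C × ℕ) : MvPolynomial τ 𝕜 →ₐ[𝕜] MvPolynomial τ 𝕜 :=
  swapVar 𝕜 (M.v ℓ) (M.v (up ℓ))

noncomputable def d (ℓ : C × ℕ) : MvPolynomial τ 𝕜 →ₗ[𝕜] MvPolynomial τ 𝕜 :=
  demazure 𝕜 (M.v ℓ) (M.v (up ℓ))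

theorem v_up_ne {ℓ : C × ℕ} (h : M.B ℓ.1) : M.v ℓ ≠ M.v (up ℓ) :=
  fun H => up_ne ℓ (M.v_inj _ _ h h H)

theorem s_X {ℓ : C × ℕ} (h : M.B ℓ.1) (a : C × ℕ) :
    M.s ℓ (M.X a) = M.X (Equiv.swap ℓ (up ℓ) a) := by
  by_cases ha : M.B a.1
  · have h' : M.B (Equiv.swap ℓ (up ℓ) a).1 := by
      rw [Equiv.swap_apply_def]; split_ifs <;> assumption
    rw [X, X, if_pos ha, if_pos h', s, swapVar_X]
    congr 1
    by_cases h₁ : a = ℓ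
    · rw [h₁, Equiv.swap_apply_left, Equiv.swap_apply_left]
    by_cases h₂ : a = up ℓ
    · rw [h₂, Equiv.swap_apply_right, Equiv.swap_apply_right]
    rw [Equiv.swap_apply_of_ne_of_ne h₁ h₂, Equiv.swap_apply_of_ne_of_ne]
    · exact fun H => h₁ (M.v_inj _ _ ha h H)
    · exact fun H => h₂ (M.v_inj _ _ ha (show M.B (up ℓ).1 from h) H)
  · have h' : ¬ M.B (Equiv.swap ℓ (up ℓ) a).1 := by
      rw [Equiv.swap_apply_of_ne_of_ne]
      · exact ha
      · rintro rfl; exact ha h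
      · rintro rfl; exact ha h
    rw [X, X, if_neg ha, if_neg h', map_zero]

theorem X_eq {ℓ : C × ℕ} (h : M.B ℓ.1) : M.X ℓ = MvPolynomial.X (M.v ℓ) := if_pos h

theorem d_eq_iff {ℓ : C × ℕ} (h : M.B ℓ.1) (f g : MvPolynomial τ 𝕜) :
    M.d ℓ f = g ↔ f - M.s ℓ f = (M.X ℓ - M.X (up ℓ)) * g := by
  rw [X_eq M h, X_eq M (show M.B (up ℓ).1 from h)]
  exact demazure_eq_iff (M.v_up_ne h) f g

theorem d_mul_of_s_eq {ℓ : C × ℕ} (h : M.B ℓ.1) {f : MvPolynomial τ 𝕜} (hf : M.s ℓ f = f)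
    (g : MvPolynomial τ 𝕜) : M.d ℓ (f * g) = f * M.d ℓ g :=
  demazure_mul_of_swapVar_eq (M.v_up_ne h) hf g

theorem d_X_mul {ℓ : C × ℕ} (h : M.B ℓ.1) (f : MvPolynomial τ 𝕜) :
    M.d ℓ (M.X ℓ * f) = f + M.X (up ℓ) * M.d ℓ f := by
  rw [X_eq M h, X_eq M (show M.B (up ℓ).1 from h), d, demazure_mul (M.v_up_ne h),
    demazure_X_left (M.v_up_ne h)]
  simp

theorem d_X_up_mul {ℓ : C × ℕ} (h : M.B ℓ.1) (f : MvPolynomial τ 𝕜) :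
    M.d ℓ (M.X (up ℓ) * f) = -f + M.X ℓ * M.d ℓ f := by
  rw [X_eq M h, X_eq M (show M.B (up ℓ).1 from h), d, demazure_mul (M.v_up_ne h),
    demazure_X_right (M.v_up_ne h)]
  simp

/-- Equal dots on both sides reduce the divided difference to the bare exchange of variables. This
is the source of the injective leading terms in the faithfulness argument. -/
theorem d_X_up_mul_sub {ℓ : C × ℕ} (h : M.B ℓ.1) (f : MvPolynomial τ 𝕜) :
    M.X (up ℓ) * M.d ℓ f - M.d ℓ (M.X (up ℓ) * f) = M.s ℓ f := by
  rw [d_X_up_mul M h]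
  linear_combination (M.d_eq_iff h f _).1 rfl

variable [DecidableEq J]

/-- The vector with component `f` at the word `i`. -/
noncomputable def single (i : J) : MvPolynomial τ 𝕜 →ₗ[𝕜] M.Space :=
  LinearMap.single 𝕜 (fun _ : J => MvPolynomial τ 𝕜) i

theorem single_apply (i i' : J) (f : MvPolynomial τ 𝕜) :
    M.single i f i' = if i' = i then f else 0 := by
  simp [single, Pi.single_apply]

@[simp] theorem single_self (i : J) (f : MvPolynomial τ 𝕜) : M.single i f i = f := by
  simp [single]

theorem single_of_ne {i i' : J} (h : i' ≠ i) (f : MvPolynomial τ 𝕜) : M.single i f i' = 0 := by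
  simp [single, h]

/-- Componentwise multiplication. -/
noncomputable def diag (h : J → MvPolynomial τ 𝕜) : Module.End 𝕜 M.Space :=
  LinearMap.pi fun i => LinearMap.mulLeft 𝕜 (h i) ∘ₗ LinearMap.proj i

@[simp] theorem diag_apply (h : J → MvPolynomial τ 𝕜) (f : M.Space) (i : J) :
    M.diag h f i = h i * f i := rfl

@[simp] theorem diag_single (h : J → MvPolynomial τ 𝕜) (i : J) (f : MvPolynomial τ 𝕜) :
    M.diag h (M.single i f) = M.single i (h i * f) := by
  funext i'
  by_cases hi : i' = i
  · subst hi; simp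
  · simp [M.single_of_ne hi]

/-- The idempotent of a word. -/
noncomputable def e (i : J) : Module.End 𝕜 M.Space := M.diag fun i' => if i' = i then 1 else 0

/-- The dot on the strand in position `p`. -/
noncomputable def x (p : Fin N) : Module.End 𝕜 M.Space := M.diag fun i => M.X (lab (M.w i) p)

@[simp] theorem e_single_self (i : J) (f : MvPolynomial τ 𝕜) :
    M.e i (M.single i f) = M.single i f := by simp [e]

theorem e_single_of_ne {i i' : J} (h : i' ≠ i) (f : MvPolynomial τ 𝕜) :
    M.e i (M.single i' f) = 0 := by simp [e, h]

theorem e_apply (i : J) (f : M.Space) : M.e i f = M.single i (f i) := by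
  funext i'
  by_cases h : i' = i
  · subst h; simp [e]
  · simp [e, h, M.single_of_ne h]

@[simp] theorem x_single (p : Fin N) (i : J) (f : MvPolynomial τ 𝕜) :
    M.x p (M.single i f) = M.single i (M.X (lab (M.w i) p) * f) := by simp [x]

variable [Fintype J]

theorem ext_single {M : PolyModel 𝕜 C τ J N} {T T' : Module.End 𝕜 M.Space}
    (h : ∀ i f, T (M.single i f) = T' (M.single i f)) : T = T' :=
  LinearMap.pi_ext h

theorem sum_single (f : M.Space) : ∑ i, M.single i (f i) = f := by
  funext i'
  simp [single_apply]

open scoped Classical in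
/-- The word obtained by exchanging two neighbouring letters, if there is one. -/
noncomputable def target (i : J) (j : Fin (N - 1)) : J :=
  -- The fallback `i` does not affect `psi`, which uses the target only when one of the two letters
  -- is active, and then `ex` provides the word.
  if h : ∃ i', M.w i' = swapSeq j (M.w i) then h.choose else i

theorem target_eq {i i' : J} {j : Fin (N - 1)} (h : M.w i' = swapSeq j (M.w i)) :
    M.target i j = i' := by
  have hex : ∃ i', M.w i' = swapSeq j (M.w i) := ⟨i', h⟩
  rw [target, dif_pos hex]
  exact M.w_inj (hex.choose_spec.trans h.symm)

open scoped Classical in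
/-- The crossing of the strands in positions `lo j` and `hi j`. -/
noncomputable def psi (j : Fin (N - 1)) : Module.End 𝕜 M.Space :=
  ∑ i, (if M.w i (lo j) = M.w i (hi j) then M.single i ∘ₗ M.d (lab (M.w i) (lo j))
    else if M.B (M.w i (lo j)) ∨ M.B (M.w i (hi j)) then
      M.single (M.target i j) ∘ₗ
        LinearMap.mulLeft 𝕜 (M.q (lab (M.w i) (hi j)) (lab (M.w i) (lo j)))
    else 0) ∘ₗ LinearMap.proj i

open scoped Classical in
theorem psi_single (j : Fin (N - 1)) (i : J) (f : MvPolynomial τ 𝕜) :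
    M.psi j (M.single i f) =
      if M.w i (lo j) = M.w i (hi j) then M.single i (M.d (lab (M.w i) (lo j)) f)
      else if M.B (M.w i (lo j)) ∨ M.B (M.w i (hi j)) then
        M.single (M.target i j) (M.q (lab (M.w i) (hi j)) (lab (M.w i) (lo j)) * f)
      else 0 := by
  rw [psi, LinearMap.sum_apply, Finset.sum_eq_single i]
  · simp only [LinearMap.comp_apply, LinearMap.proj_apply, single_self]
    split_ifs <;> rfl
  · intro i' _ h
    simp [LinearMap.comp_apply, M.single_of_ne h]
  · simp

theorem psi_same {j : Fin (N - 1)} {i : J} (h : M.w i (lo j) = M.w i (hi j))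
    (f : MvPolynomial τ 𝕜) :
    M.psi j (M.single i f) = M.single i (M.d (lab (M.w i) (lo j)) f) := by
  rw [psi_single, if_pos h]

theorem psi_swap {j : Fin (N - 1)} {i i' : J} (h : M.w i (lo j) ≠ M.w i (hi j))
    (hB : M.B (M.w i (lo j)) ∨ M.B (M.w i (hi j))) (hw : M.w i' = swapSeq j (M.w i))
    (f : MvPolynomial τ 𝕜) :
    M.psi j (M.single i f)
      = M.single i' (M.q (lab (M.w i) (hi j)) (lab (M.w i) (lo j)) * f) := by
  rw [psi_single, if_neg h, if_pos hB, M.target_eq hw]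

theorem psi_zero {j : Fin (N - 1)} {i : J} (h : M.w i (lo j) ≠ M.w i (hi j))
    (h₁ : ¬ M.B (M.w i (lo j))) (h₂ : ¬ M.B (M.w i (hi j))) (f : MvPolynomial τ 𝕜) :
    M.psi j (M.single i f) = 0 := by
  rw [psi_single, if_neg h, if_neg (by tauto)]

/-! #### Relations -/

theorem e_mul_e (i i' : J) : M.e i * M.e i' = if i = i' then M.e i else 0 := by
  refine LinearMap.ext fun f => ?_
  rw [Module.End.mul_apply, e_apply M i' f]
  split_ifs with h
  · subst h; rw [e_single_self, e_apply]
  · rw [M.e_single_of_ne (Ne.symm h)]; rfl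

theorem sum_e : ∑ i, M.e i = 1 := by
  refine LinearMap.ext fun f => ?_
  rw [LinearMap.sum_apply]
  simp only [e_apply, sum_single]; rfl

theorem diag_mul_diag (h h' : J → MvPolynomial τ 𝕜) :
    M.diag h * M.diag h' = M.diag (h * h') := by
  refine LinearMap.ext fun f => funext fun i => ?_
  simp [Module.End.mul_apply, mul_assoc]

theorem diag_comm (h h' : J → MvPolynomial τ 𝕜) : M.diag h * M.diag h' = M.diag h' * M.diag h := by
  rw [diag_mul_diag, diag_mul_diag, mul_comm]

theorem B_of_eq {i : J} {j : Fin (N - 1)} (h : M.w i (lo j) = M.w i (hi j)) :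
    M.B (M.w i (lo j)) := M.rep i _ _ (lo_ne_hi j) h

/-- The three ways in which a crossing can act. -/
theorem psi_cases (i : J) (j : Fin (N - 1)) :
    (M.w i (lo j) = M.w i (hi j) ∧ M.B (M.w i (lo j))) ∨
    (M.w i (lo j) ≠ M.w i (hi j) ∧ (M.B (M.w i (lo j)) ∨ M.B (M.w i (hi j))) ∧
      ∃ i', M.w i' = swapSeq j (M.w i)) ∨
    (M.w i (lo j) ≠ M.w i (hi j) ∧ ¬ M.B (M.w i (lo j)) ∧ ¬ M.B (M.w i (hi j))) := by
  by_cases h : M.w i (lo j) = M.w i (hi j)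
  · exact Or.inl ⟨h, M.B_of_eq h⟩
  · by_cases hB : M.B (M.w i (lo j)) ∨ M.B (M.w i (hi j))
    · exact Or.inr (Or.inl ⟨h, hB, M.ex i j hB⟩)
    · exact Or.inr (Or.inr ⟨h, by tauto, by tauto⟩)

theorem psi_mul_e {j : Fin (N - 1)} {i i' : J} (h : M.w i' = swapSeq j (M.w i)) :
    M.psi j * M.e i = M.e i' * M.psi j := by
  refine ext_single fun i₀ f => ?_
  rw [Module.End.mul_apply, Module.End.mul_apply]
  by_cases h₀ : i₀ = i
  · subst h₀
    rw [e_single_self]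
    rcases M.psi_cases i₀ j with ⟨h₁, -⟩ | ⟨h₁, hB, -⟩ | ⟨h₁, h₂, h₃⟩
    · rw [swapSeq_eq_self h₁] at h
      rw [M.psi_same h₁, M.w_inj h, e_single_self]
    · rw [M.psi_swap h₁ hB h, e_single_self]
    · rw [M.psi_zero h₁ h₂ h₃, map_zero]
  · rw [M.e_single_of_ne h₀, map_zero]
    symm
    rcases M.psi_cases i₀ j with ⟨h₁, -⟩ | ⟨h₁, hB, i₁, hi₁⟩ | ⟨h₁, h₂, h₃⟩
    · rw [M.psi_same h₁, M.e_single_of_ne]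
      rintro rfl
      rw [← swapSeq_eq_self h₁] at h
      apply h₀
      apply M.w_inj
      rw [← swapSeq_swapSeq j (M.w i), ← h, swapSeq_swapSeq]
    · rw [M.psi_swap h₁ hB hi₁, M.e_single_of_ne]
      rintro rfl
      apply h₀
      apply M.w_inj
      rw [← swapSeq_swapSeq j (M.w i), ← h, hi₁, swapSeq_swapSeq]
    · rw [M.psi_zero h₁ h₂ h₃, map_zero]

theorem lab_of_swap {i i' : J} {j : Fin (N - 1)} (h : M.w i' = swapSeq j (M.w i))
    (hne : M.w i (lo j) ≠ M.w i (hi j)) (p : Fin N) :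
    lab (M.w i') p = lab (M.w i) (Equiv.swap (lo j) (hi j) p) := by
  rw [h, lab_swapSeq hne]

theorem s_X_lab {i : J} {j : Fin (N - 1)} (h : M.w i (lo j) = M.w i (hi j)) {p : Fin N}
    (h₁ : p ≠ lo j) (h₂ : p ≠ hi j) :
    M.s (lab (M.w i) (lo j)) (M.X (lab (M.w i) p)) = M.X (lab (M.w i) p) := by
  rw [M.s_X (M.B_of_eq h), ← lab_hi h, Equiv.swap_apply_of_ne_of_ne]
  · exact fun H => h₁ (lab_injective _ H)
  · exact fun H => h₂ (lab_injective _ H)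

theorem psi_mul_x {j : Fin (N - 1)} {p : Fin N} (h₁ : p ≠ lo j) (h₂ : p ≠ hi j) :
    M.psi j * M.x p = M.x p * M.psi j := by
  refine ext_single fun i f => ?_
  rw [Module.End.mul_apply, Module.End.mul_apply, x_single]
  rcases M.psi_cases i j with ⟨h, hB⟩ | ⟨h, hB, i', hi'⟩ | ⟨h, h₃, h₄⟩
  · rw [M.psi_same h, M.psi_same h, x_single, M.d_mul_of_s_eq hB (M.s_X_lab h h₁ h₂)]
  · rw [M.psi_swap h hB hi', M.psi_swap h hB hi', x_single, M.lab_of_swap hi' h,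
      Equiv.swap_apply_of_ne_of_ne h₁ h₂]
    congr 1; ring
  · rw [M.psi_zero h h₃ h₄, M.psi_zero h h₃ h₄, map_zero]

/-- Multiplication by a polynomial that is invariant under all the exchanges of variables is
central. -/
theorem psi_mul_diag_const {g : MvPolynomial τ 𝕜} (hg : ∀ ℓ, M.B ℓ.1 → M.s ℓ g = g)
    (j : Fin (N - 1)) : M.psi j * M.diag (fun _ => g) = M.diag (fun _ => g) * M.psi j := by
  refine ext_single fun i f => ?_
  rw [Module.End.mul_apply, Module.End.mul_apply, diag_single]
  rcases M.psi_cases i j with ⟨h, hB⟩ | ⟨h, hB, i', hi'⟩ | ⟨h, h₃, h₄⟩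
  · rw [M.psi_same h, M.psi_same h, diag_single, M.d_mul_of_s_eq hB (hg _ hB)]
  · rw [M.psi_swap h hB hi', M.psi_swap h hB hi', diag_single]
    congr 1; ring
  · rw [M.psi_zero h h₃ h₄, M.psi_zero h h₃ h₄, map_zero]

theorem slide_left (j : Fin (N - 1)) (i : J) (f : MvPolynomial τ 𝕜) :
    M.x (lo j) (M.psi j (M.single i f)) - M.psi j (M.x (hi j) (M.single i f))
      = if M.w i (lo j) = M.w i (hi j) then M.single i f else 0 := by
  rw [x_single]
  rcases M.psi_cases i j with ⟨h, hB⟩ | ⟨h, hB, i', hi'⟩ | ⟨h, h₃, h₄⟩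
  · rw [M.psi_same h, M.psi_same h, x_single, if_pos h, lab_hi h, M.d_X_up_mul hB, ← map_sub]
    congr 1; ring
  · rw [M.psi_swap h hB hi', M.psi_swap h hB hi', x_single, if_neg h, M.lab_of_swap hi' h,
      Equiv.swap_apply_left, ← map_sub]
    convert map_zero (M.single i') using 2; ring
  · rw [M.psi_zero h h₃ h₄, M.psi_zero h h₃ h₄, map_zero, if_neg h, sub_zero]

theorem slide_right (j : Fin (N - 1)) (i : J) (f : MvPolynomial τ 𝕜) :
    M.psi j (M.x (lo j) (M.single i f)) - M.x (hi j) (M.psi j (M.single i f))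
      = if M.w i (lo j) = M.w i (hi j) then M.single i f else 0 := by
  rw [x_single]
  rcases M.psi_cases i j with ⟨h, hB⟩ | ⟨h, hB, i', hi'⟩ | ⟨h, h₃, h₄⟩
  · rw [M.psi_same h, M.psi_same h, x_single, if_pos h, lab_hi h, M.d_X_mul hB, ← map_sub]
    congr 1; ring
  · rw [M.psi_swap h hB hi', M.psi_swap h hB hi', x_single, if_neg h, M.lab_of_swap hi' h,
      Equiv.swap_apply_right, ← map_sub]
    convert map_zero (M.single i') using 2; ring
  · rw [M.psi_zero h h₃ h₄, M.psi_zero h h₃ h₄, map_zero, if_neg h, sub_zero]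

theorem psi_psi_same {j : Fin (N - 1)} {i : J} (h : M.w i (lo j) = M.w i (hi j))
    (f : MvPolynomial τ 𝕜) : M.psi j (M.psi j (M.single i f)) = 0 := by
  rw [M.psi_same h, M.psi_same h]
  rw [show M.d (lab (M.w i) (lo j)) (M.d (lab (M.w i) (lo j)) f) = 0 from
    demazure_demazure (M.v_up_ne (M.B_of_eq h)) f, map_zero]

theorem psi_psi_swap {j : Fin (N - 1)} {i : J} (h : M.w i (lo j) ≠ M.w i (hi j))
    (hB : M.B (M.w i (lo j)) ∨ M.B (M.w i (hi j))) (f : MvPolynomial τ 𝕜) :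
    M.psi j (M.psi j (M.single i f)) =
      M.single i (M.q (lab (M.w i) (lo j)) (lab (M.w i) (hi j))
        * M.q (lab (M.w i) (hi j)) (lab (M.w i) (lo j)) * f) := by
  obtain ⟨i', hi'⟩ := M.ex i j hB
  rw [M.psi_swap h hB hi', M.psi_swap (i := i') (i' := i)]
  · rw [M.lab_of_swap hi' h, M.lab_of_swap hi' h, Equiv.swap_apply_left, Equiv.swap_apply_right,
      mul_assoc]
  · rw [hi']; simpa using h.symm
  · rw [hi']; simpa using hB.symm
  · rw [hi', swapSeq_swapSeq]

theorem psi_psi_zero {j : Fin (N - 1)} {i : J} (h : M.w i (lo j) ≠ M.w i (hi j))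
    (h₁ : ¬ M.B (M.w i (lo j))) (h₂ : ¬ M.B (M.w i (hi j))) (f : MvPolynomial τ 𝕜) :
    M.psi j (M.psi j (M.single i f)) = 0 := by
  rw [M.psi_zero h h₁ h₂, map_zero]

section Far

variable {j l : Fin (N - 1)} (hjl : (j : ℕ) + 1 < l)

include hjl

theorem far_ne : lo j ≠ lo l ∧ lo j ≠ hi l ∧ hi j ≠ lo l ∧ hi j ≠ hi l := by
  simp only [lo, hi, ne_eq, Fin.ext_iff]
  omega

theorem swapSeq_comm (i : Fin N → C) : swapSeq j (swapSeq l i) = swapSeq l (swapSeq j i) := by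
  obtain ⟨h₁, h₂, h₃, h₄⟩ := far_ne hjl
  funext p
  simp only [swapSeq, Equiv.swap_apply_def]
  split_ifs <;> simp_all

/-- The distant letters are not renumbered by the exchange, so `q_swap` makes their crossing
polynomial invariant and the divided difference is linear over it. -/
theorem d_q_far {i : J} (h : M.w i (lo j) = M.w i (hi j)) (h' : M.w i (lo l) ≠ M.w i (hi l))
    (f : MvPolynomial τ 𝕜) :
    M.d (lab (M.w i) (lo j)) (M.q (lab (M.w i) (hi l)) (lab (M.w i) (lo l)) * f)
      = M.q (lab (M.w i) (hi l)) (lab (M.w i) (lo l)) * M.d (lab (M.w i) (lo j)) f := by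
  obtain ⟨h₁, h₂, h₃, h₄⟩ := far_ne hjl
  have inj := lab_injective (M.w i)
  apply M.d_mul_of_s_eq (M.B_of_eq h)
  rw [s, M.q_swap _ _ _ (M.B_of_eq h) h'.symm, ← lab_hi h,
    Equiv.swap_apply_of_ne_of_ne (inj.ne h₂.symm) (inj.ne h₄.symm),
    Equiv.swap_apply_of_ne_of_ne (inj.ne h₁.symm) (inj.ne h₃.symm)]

theorem d_q_far' {i : J} (h : M.w i (lo j) ≠ M.w i (hi j)) (h' : M.w i (lo l) = M.w i (hi l))
    (f : MvPolynomial τ 𝕜) :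
    M.d (lab (M.w i) (lo l)) (M.q (lab (M.w i) (hi j)) (lab (M.w i) (lo j)) * f)
      = M.q (lab (M.w i) (hi j)) (lab (M.w i) (lo j)) * M.d (lab (M.w i) (lo l)) f := by
  obtain ⟨h₁, h₂, h₃, h₄⟩ := far_ne hjl
  have inj := lab_injective (M.w i)
  apply M.d_mul_of_s_eq (M.B_of_eq h')
  rw [s, M.q_swap _ _ _ (M.B_of_eq h') h.symm, ← lab_hi h',
    Equiv.swap_apply_of_ne_of_ne (inj.ne h₃) (inj.ne h₄),
    Equiv.swap_apply_of_ne_of_ne (inj.ne h₁) (inj.ne h₂)]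

/-- Each crossing preserves the letters and labels at the positions of the other one. The nine cases
combine the three possible actions of `psi_cases` for `j` and for `l`. -/
theorem psi_psi_far : M.psi j * M.psi l = M.psi l * M.psi j := by
  obtain ⟨h₁, h₂, h₃, h₄⟩ := far_ne hjl
  refine ext_single fun i f => ?_
  rw [Module.End.mul_apply, Module.End.mul_apply]
  have inj := lab_injective (M.w i)
  have wl : ∀ {i'}, M.w i' = swapSeq l (M.w i) →
      M.w i' (lo j) = M.w i (lo j) ∧ M.w i' (hi j) = M.w i (hi j) := fun h => by
    rw [h, swapSeq_of_ne h₁ h₂, swapSeq_of_ne h₃ h₄]; exact ⟨rfl, rfl⟩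
  have wj : ∀ {i'}, M.w i' = swapSeq j (M.w i) →
      M.w i' (lo l) = M.w i (lo l) ∧ M.w i' (hi l) = M.w i (hi l) := fun h => by
    rw [h, swapSeq_of_ne h₁.symm h₃.symm, swapSeq_of_ne h₂.symm h₄.symm]; exact ⟨rfl, rfl⟩
  have ll : ∀ {i'}, M.w i' = swapSeq l (M.w i) → M.w i (lo l) ≠ M.w i (hi l) →
      lab (M.w i') (lo j) = lab (M.w i) (lo j) ∧ lab (M.w i') (hi j) = lab (M.w i) (hi j) :=
    fun h h' => by
      rw [M.lab_of_swap h h', M.lab_of_swap h h', Equiv.swap_apply_of_ne_of_ne h₁ h₂,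
        Equiv.swap_apply_of_ne_of_ne h₃ h₄]; exact ⟨rfl, rfl⟩
  have lj : ∀ {i'}, M.w i' = swapSeq j (M.w i) → M.w i (lo j) ≠ M.w i (hi j) →
      lab (M.w i') (lo l) = lab (M.w i) (lo l) ∧ lab (M.w i') (hi l) = lab (M.w i) (hi l) :=
    fun h h' => by
      rw [M.lab_of_swap h h', M.lab_of_swap h h', Equiv.swap_apply_of_ne_of_ne h₁.symm h₃.symm,
        Equiv.swap_apply_of_ne_of_ne h₂.symm h₄.symm]; exact ⟨rfl, rfl⟩
  rcases M.psi_cases i j with ⟨a₁, aB⟩ | ⟨a₁, aB, i₁, hi₁⟩ | ⟨a₁, a₂, a₃⟩ <;>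
  rcases M.psi_cases i l with ⟨b₁, bB⟩ | ⟨b₁, bB, i₂, hi₂⟩ | ⟨b₁, b₂, b₃⟩
  · rw [M.psi_same b₁, M.psi_same a₁, M.psi_same a₁, M.psi_same b₁]
    congr 1
    have ne : ∀ {p p'}, M.B (M.w i p) → M.B (M.w i p') → p ≠ p' →
        M.v (lab (M.w i) p) ≠ M.v (lab (M.w i) p') := fun hp hp' hne H =>
      hne (inj (M.v_inj _ _ hp hp' H))
    have aB' : M.B (M.w i (hi j)) := a₁ ▸ aB
    have bB' : M.B (M.w i (hi l)) := b₁ ▸ bB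
    rw [d, d, ← lab_hi a₁, ← lab_hi b₁]
    exact demazure_comm (ne aB aB' (lo_ne_hi j)) (ne bB bB' (lo_ne_hi l)) (ne aB bB h₁)
      (ne aB bB' h₂) (ne aB' bB h₃) (ne aB' bB' h₄) f
  · rw [M.psi_swap b₁ bB hi₂, M.psi_same a₁, M.psi_swap b₁ bB hi₂, M.psi_same (i := i₂),
      (ll hi₂ b₁).1, M.d_q_far hjl a₁ b₁]
    rw [(wl hi₂).1, (wl hi₂).2, a₁]
  · rw [M.psi_zero b₁ b₂ b₃, M.psi_same a₁, M.psi_zero b₁ b₂ b₃, map_zero]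
  · rw [M.psi_same b₁, M.psi_swap a₁ aB hi₁, M.psi_swap a₁ aB hi₁, M.psi_same (i := i₁),
      (lj hi₁ a₁).1, M.d_q_far' hjl a₁ b₁]
    rw [(wj hi₁).1, (wj hi₁).2, b₁]
  · have c₁ : M.w i₂ (lo j) ≠ M.w i₂ (hi j) := by rwa [(wl hi₂).1, (wl hi₂).2]
    have cB : M.B (M.w i₂ (lo j)) ∨ M.B (M.w i₂ (hi j)) := by rwa [(wl hi₂).1, (wl hi₂).2]
    obtain ⟨i₃, hi₃⟩ := M.ex i₂ j cB
    rw [M.psi_swap b₁ bB hi₂, M.psi_swap a₁ aB hi₁, M.psi_swap c₁ cB hi₃,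
      M.psi_swap (i := i₁) (i' := i₃), (ll hi₂ b₁).1, (ll hi₂ b₁).2, (lj hi₁ a₁).1,
      (lj hi₁ a₁).2]
    · congr 1; ring
    · rwa [(wj hi₁).1, (wj hi₁).2]
    · rwa [(wj hi₁).1, (wj hi₁).2]
    · rw [hi₃, hi₂, hi₁, swapSeq_comm hjl]
  · rw [M.psi_zero b₁ b₂ b₃, M.psi_swap a₁ aB hi₁, M.psi_zero (i := i₁), map_zero] <;>
    simpa [wj hi₁]
  · rw [M.psi_same b₁, M.psi_zero a₁ a₂ a₃, M.psi_zero a₁ a₂ a₃, map_zero]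
  · rw [M.psi_swap b₁ bB hi₂, M.psi_zero a₁ a₂ a₃, M.psi_zero (i := i₂), map_zero] <;>
    simpa [wl hi₂]
  · rw [M.psi_zero b₁ b₂ b₃, M.psi_zero a₁ a₂ a₃, map_zero, map_zero]

end Far

end PolyModel

end KLRSub

namespace KLRSub

namespace PolyModel

/-! #### The cubic relations -/

section Cubic

variable {𝕜 : Type*} [Field 𝕜] {C τ J : Type} [DecidableEq τ] [DecidableEq C] {N : ℕ}
  (M : PolyModel 𝕜 C τ J N) [DecidableEq J] [Fintype J]
  {k l : Fin (N - 1)} (hkl : (l : ℕ) = k + 1)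

include hkl

theorem near_eq : hi k = lo l ∧ lo k ≠ lo l ∧ lo k ≠ hi l ∧ lo l ≠ hi l := by
  simp only [lo, hi, ne_eq, Fin.ext_iff]
  omega

/-- The letters and labels after the exchange of the first two letters. -/
theorem after_left {i i' : J} (h : M.w i' = swapSeq k (M.w i))
    (hne : M.w i (lo k) ≠ M.w i (lo l)) :
    lab (M.w i') (lo k) = lab (M.w i) (lo l) ∧ lab (M.w i') (lo l) = lab (M.w i) (lo k) ∧
      lab (M.w i') (hi l) = lab (M.w i) (hi l) := by
  obtain ⟨h₁, h₂, h₃, h₄⟩ := near_eq hkl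
  rw [← h₁] at hne
  rw [M.lab_of_swap h hne, M.lab_of_swap h hne, M.lab_of_swap h hne, h₁, Equiv.swap_apply_left,
    Equiv.swap_apply_right, Equiv.swap_apply_of_ne_of_ne h₃.symm h₄.symm]
  exact ⟨rfl, rfl, rfl⟩

/-- The letters and labels after the exchange of the last two letters. -/
theorem after_right {i i' : J} (h : M.w i' = swapSeq l (M.w i))
    (hne : M.w i (lo l) ≠ M.w i (hi l)) :
    lab (M.w i') (lo k) = lab (M.w i) (lo k) ∧ lab (M.w i') (lo l) = lab (M.w i) (hi l) ∧
      lab (M.w i') (hi l) = lab (M.w i) (lo l) := by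
  obtain ⟨h₁, h₂, h₃, h₄⟩ := near_eq hkl
  rw [M.lab_of_swap h hne, M.lab_of_swap h hne, M.lab_of_swap h hne, Equiv.swap_apply_left,
    Equiv.swap_apply_right, Equiv.swap_apply_of_ne_of_ne h₂ h₃]
  exact ⟨rfl, rfl, rfl⟩

theorem psi_left {i i' : J} (h : M.w i' = swapSeq k (M.w i))
    (hne : M.w i (lo k) ≠ M.w i (lo l)) (hB : M.B (M.w i (lo k)) ∨ M.B (M.w i (lo l)))
    (f : MvPolynomial τ 𝕜) :
    M.psi k (M.single i f)
      = M.single i' (M.q (lab (M.w i) (lo l)) (lab (M.w i) (lo k)) * f) := by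
  obtain ⟨h₁, -⟩ := near_eq hkl
  rw [← h₁] at hne hB ⊢
  exact M.psi_swap hne hB h f

theorem cubic_same {i : J} (h₁ : M.w i (lo k) = M.w i (lo l)) (h₂ : M.w i (lo l) = M.w i (hi l))
    (f : MvPolynomial τ 𝕜) :
    M.psi k (M.psi l (M.psi k (M.single i f))) = M.psi l (M.psi k (M.psi l (M.single i f))) := by
  obtain ⟨e₁, e₂, e₃, e₄⟩ := near_eq hkl
  have h₁' : M.w i (lo k) = M.w i (hi k) := by rw [h₁, e₁]
  have hB := M.B_of_eq h₂
  rw [M.psi_same h₁', M.psi_same h₂, M.psi_same h₁', M.psi_same h₂, M.psi_same h₁', M.psi_same h₂]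
  congr 1
  have ne : ∀ {p p'}, M.B (M.w i p) → M.B (M.w i p') → p ≠ p' →
      M.v (lab (M.w i) p) ≠ M.v (lab (M.w i) p') := fun hp hp' hne H =>
    hne (lab_injective (M.w i) (M.v_inj _ _ hp hp' H))
  have hB₀ : M.B (M.w i (lo k)) := h₁ ▸ hB
  have hB₂ : M.B (M.w i (hi l)) := h₂ ▸ hB
  rw [d, d, ← lab_hi h₁', ← lab_hi h₂, e₁]
  exact demazure_braid (ne hB₀ hB e₂) (ne hB₀ hB₂ e₃) (ne hB hB₂ e₄) f

/-- The third letter crosses both members of the equal pair, and the product of the two crossing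
polynomials is invariant under exchanging the pair. It therefore passes through the divided
difference. -/
theorem cubic_left_pair {i : J} (h₁ : M.w i (lo k) = M.w i (lo l))
    (h₂ : M.w i (lo l) ≠ M.w i (hi l)) (f : MvPolynomial τ 𝕜) :
    M.psi k (M.psi l (M.psi k (M.single i f))) = M.psi l (M.psi k (M.psi l (M.single i f))) := by
  obtain ⟨e₁, e₂, e₃, e₄⟩ := near_eq hkl
  have h₁' : M.w i (lo k) = M.w i (hi k) := by rw [h₁, e₁]
  have hB₀ := M.B_of_eq h₁'
  have hB : M.B (M.w i (lo l)) := h₁ ▸ hB₀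
  obtain ⟨i₁, hi₁⟩ := M.ex i l (Or.inl hB)
  obtain ⟨a₁, a₂, a₃⟩ := M.after_right hkl hi₁ h₂
  have c₁ : M.w i₁ (lo k) = M.w i (lo k) := congrArg Prod.fst a₁
  have c₂ : M.w i₁ (lo l) = M.w i (hi l) := congrArg Prod.fst a₂
  have c₃ : M.w i₁ (hi l) = M.w i (lo l) := congrArg Prod.fst a₃
  have n₁ : M.w i₁ (lo k) ≠ M.w i₁ (lo l) := by rwa [c₁, c₂, h₁]
  have B₁ : M.B (M.w i₁ (lo k)) := by rwa [c₁]
  obtain ⟨i₂, hi₂⟩ := M.ex i₁ k (Or.inl B₁)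
  obtain ⟨b₁, b₂, b₃⟩ := M.after_left hkl hi₂ n₁
  have h₃ : M.w i₂ (lo l) = M.w i₂ (hi l) := by
    rw [show M.w i₂ (lo l) = M.w i₁ (lo k) from congrArg Prod.fst b₂,
      show M.w i₂ (hi l) = M.w i₁ (hi l) from congrArg Prod.fst b₃, c₁, c₃, h₁]
  rw [M.psi_same h₁', M.psi_swap h₂ (Or.inl hB) hi₁, M.psi_left hkl hi₂ n₁ (Or.inl B₁),
    M.psi_swap h₂ (Or.inl hB) hi₁, M.psi_left hkl hi₂ n₁ (Or.inl B₁), M.psi_same h₃, b₂, a₁, a₂,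
    ← mul_assoc, ← mul_assoc, M.d_mul_of_s_eq hB₀]
  rw [map_mul, s, M.q_swap _ _ _ hB₀ (by rw [lab_fst, lab_fst, h₁]; exact h₂.symm),
    M.q_swap _ _ _ hB₀ h₂.symm, ← lab_hi h₁', e₁, Equiv.swap_apply_left, Equiv.swap_apply_right,
    Equiv.swap_apply_of_ne_of_ne ((lab_injective _).ne e₃.symm) ((lab_injective _).ne e₄.symm),
    mul_comm]

theorem cubic_right_pair {i : J} (h₁ : M.w i (lo k) ≠ M.w i (lo l))
    (h₂ : M.w i (lo l) = M.w i (hi l)) (f : MvPolynomial τ 𝕜) :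
    M.psi k (M.psi l (M.psi k (M.single i f))) = M.psi l (M.psi k (M.psi l (M.single i f))) := by
  obtain ⟨e₁, e₂, e₃, e₄⟩ := near_eq hkl
  have hB := M.B_of_eq h₂
  obtain ⟨i₁, hi₁⟩ := M.ex i k (Or.inr (by rwa [e₁]))
  obtain ⟨a₁, a₂, a₃⟩ := M.after_left hkl hi₁ h₁
  have c₁ : M.w i₁ (lo k) = M.w i (lo l) := congrArg Prod.fst a₁
  have c₂ : M.w i₁ (lo l) = M.w i (lo k) := congrArg Prod.fst a₂
  have c₃ : M.w i₁ (hi l) = M.w i (hi l) := congrArg Prod.fst a₃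
  have n₁ : M.w i₁ (lo l) ≠ M.w i₁ (hi l) := by rwa [c₂, c₃, ← h₂]
  have B₁ : M.B (M.w i₁ (hi l)) := by rwa [c₃, ← h₂]
  obtain ⟨i₂, hi₂⟩ := M.ex i₁ l (Or.inr B₁)
  obtain ⟨b₁, b₂, b₃⟩ := M.after_right hkl hi₂ n₁
  have h₃ : M.w i₂ (lo k) = M.w i₂ (hi k) := by
    rw [e₁, show M.w i₂ (lo k) = M.w i₁ (lo k) from congrArg Prod.fst b₁,
      show M.w i₂ (lo l) = M.w i₁ (hi l) from congrArg Prod.fst b₂, c₁, c₃, h₂]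
  rw [M.psi_same h₂, M.psi_left hkl hi₁ h₁ (Or.inr hB), M.psi_swap n₁ (Or.inr B₁) hi₂,
    M.psi_left hkl hi₁ h₁ (Or.inr hB), M.psi_swap n₁ (Or.inr B₁) hi₂, M.psi_same h₃, b₁, a₁, a₂,
    a₃, ← mul_assoc, ← mul_assoc, M.d_mul_of_s_eq hB]
  rw [map_mul, s, M.q_swap _ _ _ hB (by rw [lab_fst, lab_fst, ← h₂]; exact h₁.symm),
    M.q_swap _ _ _ hB h₁.symm, ← lab_hi h₂, Equiv.swap_apply_left, Equiv.swap_apply_right,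
    Equiv.swap_apply_of_ne_of_ne ((lab_injective _).ne e₂) ((lab_injective _).ne e₃),
    mul_comm]

/-- This is the only case in which the two sides can differ. The middle letter escapes to the left
or to the right, the outer letters become neighbours and cross by a divided difference, and the
middle letter returns. Since the outer letters become neighbours, their ranks are consecutive. -/
theorem cubic_outer_pair {i : J} (h₁ : M.w i (lo k) ≠ M.w i (lo l))
    (h₂ : M.w i (lo k) = M.w i (hi l)) (f : MvPolynomial τ 𝕜) :
    lab (M.w i) (hi l) = up (lab (M.w i) (lo k)) ∧
    M.psi k (M.psi l (M.psi k (M.single i f))) - M.psi l (M.psi k (M.psi l (M.single i f)))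
      = M.single i (
        M.q (lab (M.w i) (lo k)) (lab (M.w i) (lo l)) * M.d (lab (M.w i) (lo k))
          (M.q (lab (M.w i) (lo l)) (lab (M.w i) (lo k)) * f)
        - M.q (lab (M.w i) (lo l)) (lab (M.w i) (hi l)) * M.d (lab (M.w i) (lo k))
          (M.q (lab (M.w i) (hi l)) (lab (M.w i) (lo l)) * f)) := by
  obtain ⟨e₁, e₂, e₃, e₄⟩ := near_eq hkl
  have hB₀ : M.B (M.w i (lo k)) := M.rep _ _ _ e₃ h₂
  have hB₂ : M.B (M.w i (hi l)) := h₂ ▸ hB₀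
  have h₃ : M.w i (lo l) ≠ M.w i (hi l) := by rw [← h₂]; exact h₁.symm
  obtain ⟨i₁, hi₁⟩ := M.ex i k (Or.inl hB₀)
  obtain ⟨a₁, a₂, a₃⟩ := M.after_left hkl hi₁ h₁
  have c₁ : M.w i₁ (lo k) = M.w i (lo l) := congrArg Prod.fst a₁
  have c₂ : M.w i₁ (lo l) = M.w i (lo k) := congrArg Prod.fst a₂
  have c₃ : M.w i₁ (hi l) = M.w i (hi l) := congrArg Prod.fst a₃
  obtain ⟨i₂, hi₂⟩ := M.ex i l (Or.inr hB₂)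
  obtain ⟨b₁, b₂, b₃⟩ := M.after_right hkl hi₂ h₃
  have d₁ : M.w i₂ (lo k) = M.w i (lo k) := congrArg Prod.fst b₁
  have d₂ : M.w i₂ (lo l) = M.w i (hi l) := congrArg Prod.fst b₂
  have d₃ : M.w i₂ (hi l) = M.w i (lo l) := congrArg Prod.fst b₃
  have s₁ : M.w i₁ (lo l) = M.w i₁ (hi l) := by rw [c₂, c₃, h₂]
  have s₂ : M.w i₂ (lo k) = M.w i₂ (hi k) := by rw [e₁, d₁, d₂, h₂]
  refine ⟨by rw [← a₃, lab_hi s₁, a₂], ?_⟩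
  rw [M.psi_left hkl hi₁ h₁ (Or.inl hB₀), M.psi_same s₁,
    M.psi_left hkl (i := i₁) (i' := i) (by rw [hi₁, swapSeq_swapSeq]) (by rw [c₁, c₂]; exact h₁.symm)
      (by rw [c₁, c₂]; exact Or.inr hB₀), a₁, a₂,
    M.psi_swap h₃ (Or.inr hB₂) hi₂, M.psi_same s₂,
    M.psi_swap (i := i₂) (i' := i) (by rw [d₂, d₃]; exact h₃.symm) (by rw [d₂]; exact Or.inl hB₂)
      (by rw [hi₂, swapSeq_swapSeq]), b₁, b₂, b₃, map_sub]

/-- All three pairs have to cross in either triple product, and with at most one active colour some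
pair has both letters inactive. That crossing acts by zero. -/
theorem cubic_distinct {i : J} (h₁ : M.w i (lo k) ≠ M.w i (lo l))
    (h₂ : M.w i (lo k) ≠ M.w i (hi l)) (h₃ : M.w i (lo l) ≠ M.w i (hi l))
    (hB : ∀ a b, M.B a → M.B b → a = b) (f : MvPolynomial τ 𝕜) :
    M.psi k (M.psi l (M.psi k (M.single i f))) = 0 ∧
      M.psi l (M.psi k (M.psi l (M.single i f))) = 0 := by
  obtain ⟨e₁, e₂, e₃, e₄⟩ := near_eq hkl
  have hk : ∀ {i'}, M.w i' (lo k) ≠ M.w i' (lo l) → ¬ M.B (M.w i' (lo k)) →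
      ¬ M.B (M.w i' (lo l)) → ∀ f, M.psi k (M.single i' f) = 0 := fun {i'} a b c f => by
    rw [← e₁] at a c
    exact M.psi_zero a b c f
  constructor
  · by_cases B : M.B (M.w i (lo k)) ∨ M.B (M.w i (lo l))
    · obtain ⟨i₁, hi₁⟩ := M.ex i k (by rwa [e₁])
      obtain ⟨a₁, a₂, a₃⟩ := M.after_left hkl hi₁ h₁
      have c₁ : M.w i₁ (lo k) = M.w i (lo l) := congrArg Prod.fst a₁
      have c₂ : M.w i₁ (lo l) = M.w i (lo k) := congrArg Prod.fst a₂
      have c₃ : M.w i₁ (hi l) = M.w i (hi l) := congrArg Prod.fst a₃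
      have n₁ : M.w i₁ (lo l) ≠ M.w i₁ (hi l) := by rwa [c₂, c₃]
      rw [M.psi_left hkl hi₁ h₁ B]
      by_cases B' : M.B (M.w i₁ (lo l)) ∨ M.B (M.w i₁ (hi l))
      · obtain ⟨i₂, hi₂⟩ := M.ex i₁ l B'
        obtain ⟨b₁, b₂, b₃⟩ := M.after_right hkl hi₂ n₁
        have d₁ : M.w i₂ (lo k) = M.w i (lo l) := (congrArg Prod.fst b₁).trans c₁
        have d₂ : M.w i₂ (lo l) = M.w i (hi l) := (congrArg Prod.fst b₂).trans c₃
        rw [M.psi_swap n₁ B' hi₂]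
        rw [c₂, c₃] at B'
        apply hk
        · rwa [d₁, d₂]
        · rw [d₁]; intro H
          rcases B' with B' | B'
          · exact h₁ (hB _ _ B' H)
          · exact h₃ (hB _ _ H B')
        · rw [d₂]; intro H
          rcases B with B | B
          · exact h₂ (hB _ _ B H)
          · exact h₃ (hB _ _ B H)
      · rw [M.psi_zero n₁ (by tauto) (by tauto), map_zero]
    · rw [hk h₁ (by tauto) (by tauto), map_zero, map_zero]
  · by_cases B : M.B (M.w i (lo l)) ∨ M.B (M.w i (hi l))
    · obtain ⟨i₁, hi₁⟩ := M.ex i l B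
      obtain ⟨a₁, a₂, a₃⟩ := M.after_right hkl hi₁ h₃
      have c₁ : M.w i₁ (lo k) = M.w i (lo k) := congrArg Prod.fst a₁
      have c₂ : M.w i₁ (lo l) = M.w i (hi l) := congrArg Prod.fst a₂
      have c₃ : M.w i₁ (hi l) = M.w i (lo l) := congrArg Prod.fst a₃
      have n₁ : M.w i₁ (lo k) ≠ M.w i₁ (lo l) := by rwa [c₁, c₂]
      rw [M.psi_swap h₃ B hi₁]
      by_cases B' : M.B (M.w i₁ (lo k)) ∨ M.B (M.w i₁ (lo l))
      · obtain ⟨i₂, hi₂⟩ := M.ex i₁ k (by rwa [e₁])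
        obtain ⟨b₁, b₂, b₃⟩ := M.after_left hkl hi₂ n₁
        have d₂ : M.w i₂ (lo l) = M.w i (lo k) := (congrArg Prod.fst b₂).trans c₁
        have d₃ : M.w i₂ (hi l) = M.w i (lo l) := (congrArg Prod.fst b₃).trans c₃
        rw [M.psi_left hkl hi₂ n₁ B']
        rw [c₁, c₂] at B'
        apply M.psi_zero
        · rwa [d₂, d₃]
        · rw [d₂]; intro H
          rcases B with B | B
          · exact h₁ (hB _ _ H B)
          · exact h₂ (hB _ _ H B)
        · rw [d₃]; intro H
          rcases B' with B' | B'
          · exact h₁ (hB _ _ B' H)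
          · exact h₃ (hB _ _ H B')
      · rw [hk n₁ (by tauto) (by tauto), map_zero]
    · rw [M.psi_zero h₃ (by tauto) (by tauto), map_zero, map_zero]

end Cubic

end PolyModel

end KLRSub

namespace KLRSub

/-! ### Spanning sets of algebras of crossing diagrams -/

section Spanning

variable {𝕜 : Type*} [Field 𝕜] {A : Type*} [Ring A] [Algebra 𝕜 A]

/-- The product `ψ a * ψ (a + 1) * ⋯ * ψ (a + n - 1)`. -/
def chain (ψ : ℕ → A) : ℕ → ℕ → A
  | _, 0 => 1
  | a, n + 1 => ψ a * chain ψ (a + 1) n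

variable (P : Subalgebra 𝕜 A) (ψ : ℕ → A)

/-- The subalgebra generated by `P` and the crossings of the first `r` strands. -/
def level (r : ℕ) : Subalgebra 𝕜 A := Algebra.adjoin 𝕜 (P ∪ {u | ∃ j, j + 1 < r ∧ u = ψ j})

theorem le_level (r : ℕ) : P ≤ level P ψ r := fun _ hp =>
  Algebra.subset_adjoin (Or.inl hp)

theorem psi_mem_level {r j : ℕ} (h : j + 1 < r) : ψ j ∈ level P ψ r :=
  Algebra.subset_adjoin (Or.inr ⟨j, h, rfl⟩)

theorem level_zero : level P ψ 0 = P := by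
  refine le_antisymm (Algebra.adjoin_le ?_) (le_level P ψ 0)
  rintro u (hu | ⟨j, h, -⟩)
  · exact hu
  · omega

theorem chain_add (a n m : ℕ) : chain ψ a (n + m) = chain ψ a n * chain ψ (a + n) m := by
  induction n generalizing a with
  | zero => simp [chain]
  | succ n ih =>
    rw [show n + 1 + m = (n + m) + 1 by omega, chain, chain, ih, mul_assoc,
      show a + (n + 1) = a + 1 + n by omega]

/-- The sums of products of a chain, which moves strand `r` to a position `≥ a`, and an element
of `level r`. -/
def chainSpan (r a : ℕ) : AddSubmonoid A :=
  AddSubmonoid.closure {u | ∃ b n, a ≤ b ∧ b + n = r ∧ ∃ v ∈ level P ψ r, u = chain ψ b n * v}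

variable {P ψ}

theorem chain_mul_mem {r a b n : ℕ} (h : a ≤ b) (hr : b + n = r) {v : A} (hv : v ∈ level P ψ r) :
    chain ψ b n * v ∈ chainSpan P ψ r a :=
  AddSubmonoid.subset_closure ⟨b, n, h, hr, v, hv, rfl⟩

theorem chain_mem {r a b n : ℕ} (h : a ≤ b) (hr : b + n = r) :
    chain ψ b n ∈ chainSpan P ψ r a := by
  simpa using chain_mul_mem (P := P) h hr (one_mem (level P ψ r))

theorem chainSpan_mono {r a a' : ℕ} (h : a ≤ a') : chainSpan P ψ r a' ≤ chainSpan P ψ r a := by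
  refine AddSubmonoid.closure_mono ?_
  rintro u ⟨b, n, hb, hr, v, hv, rfl⟩
  exact ⟨b, n, h.trans hb, hr, v, hv, rfl⟩

theorem chainSpan_induction {r a : ℕ} {p : A → Prop} {u : A} (hu : u ∈ chainSpan P ψ r a)
    (hg : ∀ b n, a ≤ b → b + n = r → ∀ v ∈ level P ψ r, p (chain ψ b n * v)) (h₀ : p 0)
    (ha : ∀ x y, p x → p y → p (x + y)) : p u := by
  induction hu using AddSubmonoid.closure_induction with
  | mem x hx =>
    obtain ⟨b, n, hb, hr, v, hv, rfl⟩ := hx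
    exact hg b n hb hr v hv
  | zero => exact h₀
  | add x y _ _ hx hy => exact ha x y hx hy

theorem chainSpan_mul {r a : ℕ} {u v : A} (hu : u ∈ chainSpan P ψ r a) (hv : v ∈ level P ψ r) :
    u * v ∈ chainSpan P ψ r a := by
  refine chainSpan_induction (p := fun x => x * v ∈ chainSpan P ψ r a) hu
    (fun b n hb hr v' hv' => ?_) (by rw [zero_mul]; exact zero_mem _)
    (fun x y hx hy => by rw [add_mul]; exact add_mem hx hy)
  rw [mul_assoc]
  exact chain_mul_mem hb hr (mul_mem hv' hv)

/-- It suffices to check left multiplication on chains. -/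
theorem mul_chainSpan {r a a' : ℕ} {y u : A} (hu : u ∈ chainSpan P ψ r a)
    (h : ∀ b n, a ≤ b → b + n = r → y * chain ψ b n ∈ chainSpan P ψ r a') :
    y * u ∈ chainSpan P ψ r a' := by
  refine chainSpan_induction (p := fun x => y * x ∈ chainSpan P ψ r a') hu
    (fun b n hb hr v hv => ?_) (by rw [mul_zero]; exact zero_mem _)
    (fun x y hx hy => by rw [mul_add]; exact add_mem hx hy)
  rw [← mul_assoc]
  exact chainSpan_mul (h b n hb hr) hv

variable (hP : ∀ p ∈ P, ∀ j, ∃ p' ∈ P, ∃ p'' ∈ P, p * ψ j = ψ j * p' + p'')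
  (hsq : ∀ j, ψ j * ψ j ∈ P)
  (hbr : ∀ j, ψ j * ψ (j + 1) * ψ j - ψ (j + 1) * ψ j * ψ (j + 1) ∈ P)
  (hfar : ∀ j l, j + 1 < l → ψ j * ψ l = ψ l * ψ j)

include hfar in
theorem psi_mul_chain {j a n : ℕ} (h : j + 1 < a) : ψ j * chain ψ a n = chain ψ a n * ψ j := by
  induction n generalizing a with
  | zero => simp [chain]
  | succ n ih => rw [chain, ← mul_assoc, hfar j a h, mul_assoc, ih (by omega), mul_assoc]

include hfar in
theorem psi_mul_chain_of_lt {j a n : ℕ} (h : a + n < j) :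
    ψ j * chain ψ a n = chain ψ a n * ψ j := by
  induction n generalizing a with
  | zero => simp [chain]
  | succ n ih =>
    rw [chain, ← mul_assoc, ← hfar a j (by omega), mul_assoc, ih (by omega), mul_assoc]

include hfar in
theorem psi_mul_chainSpan {r a j : ℕ} (h : j + 1 < a) {u : A} (hu : u ∈ chainSpan P ψ r a) :
    ψ j * u ∈ chainSpan P ψ r a := by
  refine mul_chainSpan hu fun b n hb hr => ?_
  rw [psi_mul_chain hfar (by omega)]
  exact chain_mul_mem hb hr (psi_mem_level P ψ (by omega))

include hfar in
theorem psi_mul_chainSpan_succ {r a : ℕ} {u : A} (hu : u ∈ chainSpan P ψ r (a + 1)) :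
    ψ a * u ∈ chainSpan P ψ r a := by
  refine mul_chainSpan hu fun b n hb hr => ?_
  rcases hb.eq_or_lt with rfl | hb'
  · exact chain_mem (n := n + 1) le_rfl (by omega)
  · rw [psi_mul_chain hfar hb']
    exact chain_mul_mem (by omega) hr (psi_mem_level P ψ (by omega))

include hfar in
theorem chain_mul_chainSpan {r a b n : ℕ} (h : b + n < a) {u : A}
    (hu : u ∈ chainSpan P ψ r a) : chain ψ b n * u ∈ chainSpan P ψ r a := by
  induction n generalizing b with
  | zero => simpa [chain] using hu
  | succ n ih =>
    rw [chain, mul_assoc]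
    exact psi_mul_chainSpan hfar (by omega) (ih (by omega))

include hP hfar in
-- Commuting a diagonal element past the first crossing leaves a correction in which that crossing
-- is missing. What follows is a chain starting further to the right, so the correction stays in the
-- span.
theorem mem_mul_chain {r b n : ℕ} (hr : b + n = r) {p : A} (hp : p ∈ P) :
    p * chain ψ b n ∈ chainSpan P ψ r b := by
  induction n generalizing b p with
  | zero =>
    have := chain_mul_mem (ψ := ψ) (le_refl b) hr (le_level P ψ r hp)
    simpa [chain] using this
  | succ n ih =>
    obtain ⟨p', hp', p'', hp'', h⟩ := hP p hp b
    rw [chain, ← mul_assoc, h, add_mul, mul_assoc]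
    exact add_mem (psi_mul_chainSpan_succ hfar (ih (by omega) hp'))
      (chainSpan_mono (Nat.le_succ b) (ih (by omega) hp''))

include hP hsq hbr hfar in
-- Four positions of `j` relative to the chain: far to the left it passes through, at `b - 1` it
-- prolongs the chain, at `b` it forms a diagonal square, and further to the right a braid move
-- sends it through as `ψ (j - 1)`, with a diagonal correction.
theorem psi_mul_chain_mem {r b n j : ℕ} (hr : b + n = r) (hj : j < r) :
    ψ j * chain ψ b n ∈ chainSpan P ψ r 0 := by
  rcases Nat.lt_or_ge (j + 1) b with h | h
  · rw [psi_mul_chain hfar h]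
    exact chain_mul_mem (Nat.zero_le b) hr (psi_mem_level P ψ (by omega))
  rcases h.eq_or_lt with h | h
  · subst h
    exact chain_mem (n := n + 1) (Nat.zero_le _) (by omega)
  rcases (Nat.lt_succ_iff.1 h).eq_or_lt with h' | h'
  · subst h'
    obtain ⟨m, rfl⟩ : ∃ m, n = m + 1 := ⟨n - 1, by omega⟩
    rw [chain, ← mul_assoc]
    exact chainSpan_mono (Nat.zero_le _) (mem_mul_chain hP hfar (by omega) (hsq b))
  -- The chain is split around the two crossings `b + t` and `b + t + 1 = j`, where the braid move
  -- takes place.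
  · obtain ⟨t, rfl⟩ : ∃ t, j = b + t + 1 := ⟨j - b - 1, by omega⟩
    obtain ⟨m, rfl⟩ : ∃ m, n = t + (m + 1 + 1) := ⟨n - t - 2, by omega⟩
    have h₁ : chain ψ b (t + (m + 1 + 1))
        = chain ψ b t * (ψ (b + t) * (ψ (b + t + 1) * chain ψ (b + t + 1 + 1) m)) := by
      rw [chain_add, chain, chain]
    set c := chain ψ (b + t + 1 + 1) m with hc
    have h₂ : ψ (b + t) * c = c * ψ (b + t) := psi_mul_chain hfar (by omega)
    have h₃ : ψ (b + t + 1) * chain ψ b (t + (m + 1 + 1))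
        = chain ψ b (t + (m + 1 + 1)) * ψ (b + t)
          - chain ψ b t * ((ψ (b + t) * ψ (b + t + 1) * ψ (b + t)
            - ψ (b + t + 1) * ψ (b + t) * ψ (b + t + 1)) * c) := by
      rw [h₁, ← mul_assoc, psi_mul_chain_of_lt hfar (Nat.lt_succ_self _)]
      simp only [mul_assoc, sub_mul, mul_sub, ← h₂]
      abel
    rw [h₃, sub_eq_add_neg, ← mul_neg, ← neg_mul]
    refine add_mem (chain_mul_mem (Nat.zero_le b) hr (psi_mem_level P ψ (by omega)))
      (chainSpan_mono (Nat.zero_le (b + t + 1 + 1)) (chain_mul_chainSpan hfar (by omega)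
        (mem_mul_chain hP hfar (by omega) (neg_mem (hbr (b + t))))))

include hP hsq hbr hfar in
-- The span contains `1` and is stable under left multiplication by the generators of the next
-- level, hence contains the whole level.
theorem level_succ_le {r : ℕ} {u : A} (hu : u ∈ level P ψ (r + 1)) : u ∈ chainSpan P ψ r 0 := by
  have key : ∀ m ∈ chainSpan P ψ r 0, u * m ∈ chainSpan P ψ r 0 := by
    induction hu using Algebra.adjoin_induction with
    | mem x hx =>
      intro m hm
      refine mul_chainSpan hm fun b n _ hr => ?_
      rcases hx with hx | ⟨j, hj, rfl⟩
      · exact chainSpan_mono (Nat.zero_le b) (mem_mul_chain hP hfar hr hx)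
      · exact psi_mul_chain_mem hP hsq hbr hfar hr (by omega)
    | algebraMap c =>
      intro m hm
      rw [Algebra.commutes]
      exact chainSpan_mul hm (Subalgebra.algebraMap_mem _ c)
    | add x y _ _ hx hy => intro m hm; rw [add_mul]; exact add_mem (hx m hm) (hy m hm)
    | mul x y _ _ hx hy => intro m hm; rw [mul_assoc]; exact hx _ (hy m hm)
  have h₁ := chain_mem (P := P) (ψ := ψ) (n := 0) (Nat.zero_le r) (Nat.add_zero r)
  simpa using key 1 h₁

include hP hsq hbr hfar in
/-- Every diagram is a sum of products of a chain moving the last strand and a diagram on the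
other strands. -/
theorem exists_eq_sum_chain {r : ℕ} {u : A} (hu : u ∈ level P ψ (r + 1)) :
    ∃ v : ℕ → A, (∀ a, v a ∈ level P ψ r) ∧
      u = ∑ a ∈ Finset.range (r + 1), chain ψ a (r - a) * v a := by
  refine chainSpan_induction (p := fun x => ∃ v : ℕ → A, (∀ a, v a ∈ level P ψ r) ∧
      x = ∑ a ∈ Finset.range (r + 1), chain ψ a (r - a) * v a)
    (level_succ_le hP hsq hbr hfar hu) (fun b n _ hr v hv => ?_)
    ⟨0, fun _ => zero_mem _, by simp⟩ ?_
  · refine ⟨fun a => if a = b then v else 0, fun a => ?_, ?_⟩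
    · dsimp only; split_ifs; exacts [hv, zero_mem _]
    · dsimp only
      rw [Finset.sum_eq_single b]
      · rw [if_pos rfl, show r - b = n by omega]
      · intro a _ h; rw [if_neg h, mul_zero]
      · intro h; exact absurd (Finset.mem_range.2 (by omega)) h
  · rintro x y ⟨v, hv, rfl⟩ ⟨v', hv', rfl⟩
    exact ⟨v + v', fun a => add_mem (hv a) (hv' a), by
      simp [mul_add, Finset.sum_add_distrib]⟩

end Spanning

end KLRSub

namespace KLRSub

/-! ### Faithfulness of polynomial representations -/

section Twist

variable {𝕜 : Type*} [Field 𝕜] {R : Type*} [CommRing R] [Algebra 𝕜 R]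

/-- The iterated twisted commutator: `twist z q k T` is obtained from `T` by applying
`T ↦ z y * T - T * z q` for `y = q, q - 1, …, q - k + 1`. -/
noncomputable def twist (z : ℕ → R) (q : ℕ) : ℕ → Module.End 𝕜 R → Module.End 𝕜 R
  | 0, T => T
  | k + 1, T => LinearMap.mulLeft 𝕜 (z (q - k)) * twist z q k T
      - twist z q k T * LinearMap.mulLeft 𝕜 (z q)

variable (z : ℕ → R) (q : ℕ)

theorem twist_succ_apply (k : ℕ) (T : Module.End 𝕜 R) (f : R) :
    twist z q (k + 1) T f = z (q - k) * twist z q k T f - twist z q k T (z q * f) := rfl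

theorem twist_sum {ι : Type*} (s : Finset ι) (k : ℕ) (T : ι → Module.End 𝕜 R) :
    twist z q k (∑ a ∈ s, T a) = ∑ a ∈ s, twist z q k (T a) := by
  induction k with
  | zero => rfl
  | succ k ih =>
    simp only [twist, ih, Finset.mul_sum, Finset.sum_mul, Finset.sum_sub_distrib]

/-- Applied with `T` the action of a chain and `g` that of its coefficient: the coefficient commutes
with the dot on the last strand, so the twists see only the chain. -/
theorem twist_mul_right (k : ℕ) (T g : Module.End 𝕜 R) (hg : ∀ f, g (z q * f) = z q * g f) :
    twist z q k (T * g) = twist z q k T * g := by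
  induction k with
  | zero => rfl
  | succ k ih =>
    have : g * LinearMap.mulLeft 𝕜 (z q) = LinearMap.mulLeft 𝕜 (z q) * g :=
      LinearMap.ext hg
    rw [twist, twist, ih, sub_mul, mul_assoc, mul_assoc, mul_assoc, this]

theorem twist_mul_left (k : ℕ) (T g : Module.End 𝕜 R)
    (hg : ∀ t < k, ∀ f, g (z (q - t) * f) = z (q - t) * g f) :
    twist z q k (g * T) = g * twist z q k T := by
  induction k with
  | zero => rfl
  | succ k ih =>
    have : g * LinearMap.mulLeft 𝕜 (z (q - k)) = LinearMap.mulLeft 𝕜 (z (q - k)) * g :=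
      LinearMap.ext (hg k (Nat.lt_succ_self k))
    rw [twist, twist, ih fun t ht => hg t (by omega), mul_sub, ← mul_assoc, ← mul_assoc,
      ← mul_assoc, this]

theorem twist_eq_zero_of_le {k k' : ℕ} (h : k ≤ k') {T : Module.End 𝕜 R}
    (hT : twist z q k T = 0) : twist z q k' T = 0 := by
  induction h with
  | refl => exact hT
  | step _ ih => simp [twist, ih]

theorem twist_apply_eq_zero {U : Set R} (hU : ∀ f ∈ U, z q * f ∈ U) (k : ℕ)
    {T : Module.End 𝕜 R} (hT : ∀ f ∈ U, T f = 0) : ∀ f ∈ U, twist z q k T f = 0 := by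
  induction k with
  | zero => exact hT
  | succ k ih =>
    intro f hf
    rw [twist_succ_apply, ih f hf, ih _ (hU f hf)]
    simp

end Twist

/-! ### Strand-fixing operators, abstract diagram algebras and leading terms of chains -/

namespace PolyModel

variable {𝕜 : Type*} [Field 𝕜] {C τ J : Type} [DecidableEq τ] [DecidableEq C] {N : ℕ}
  (M : PolyModel 𝕜 C τ J N) [DecidableEq J] [Fintype J]

/-- An operator that preserves the strand in position `p`, and commutes with its dot. -/
def FixesStrand (p : Fin N) (T : Module.End 𝕜 M.Space) : Prop :=
  ∀ i f, (∀ i', lab (M.w i') p ≠ lab (M.w i) p → T (M.single i f) i' = 0) ∧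
    T (M.single i (M.X (lab (M.w i) p) * f)) = M.X (lab (M.w i) p) • T (M.single i f)

variable {M} in
-- After decomposing the intermediate vector into components, only those with the same label at `p`
-- contribute, and on them both operators are linear over the same variable.
theorem FixesStrand.mul {p : Fin N} {T T' : Module.End 𝕜 M.Space} (h : FixesStrand M p T)
    (h' : FixesStrand M p T') : FixesStrand M p (T * T') := by
  have key : ∀ i f, T (T' (M.single i f))
      = ∑ i₁, T (M.single i₁ (T' (M.single i f) i₁)) := fun i f => by
    rw [← map_sum, M.sum_single]
  intro i f
  refine ⟨fun i' hi' => ?_, ?_⟩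
  · rw [Module.End.mul_apply, key, Finset.sum_apply]
    refine Finset.sum_eq_zero fun i₁ _ => ?_
    by_cases h₁ : lab (M.w i₁) p = lab (M.w i) p
    · exact (h _ _).1 i' (by rwa [h₁])
    · rw [(h' i f).1 i₁ h₁, map_zero, map_zero]; rfl
  · rw [Module.End.mul_apply, Module.End.mul_apply, (h' i f).2, key]
    conv_lhs => rw [← M.sum_single (M.X (lab (M.w i) p) • T' (M.single i f))]
    rw [map_sum, Finset.smul_sum]
    refine Finset.sum_congr rfl fun i₁ _ => ?_
    by_cases h₁ : lab (M.w i₁) p = lab (M.w i) p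
    · rw [Pi.smul_apply, smul_eq_mul, ← h₁, (h _ _).2]
    · rw [Pi.smul_apply, (h' i f).1 i₁ h₁, smul_zero, map_zero, map_zero, smul_zero]

theorem fixesStrand_diag (p : Fin N) (h : J → MvPolynomial τ 𝕜) :
    FixesStrand M p (M.diag h) := by
  intro i f
  rw [diag_single, diag_single]
  refine ⟨fun i' hi' => M.single_of_ne (fun H => hi' (by rw [H])) _, ?_⟩
  funext i'
  rw [Pi.smul_apply, smul_eq_mul, M.single_apply, M.single_apply]
  split_ifs
  · ring
  · simp

theorem fixesStrand_psi {p : Fin N} {j : Fin (N - 1)} (h₁ : p ≠ lo j) (h₂ : p ≠ hi j) :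
    FixesStrand M p (M.psi j) := by
  have hs : ∀ (a : MvPolynomial τ 𝕜) (i f), M.single i (a * f) = a • M.single i f := by
    intro a i f
    funext i'
    rw [Pi.smul_apply, smul_eq_mul, M.single_apply, M.single_apply]
    split_ifs
    · rfl
    · simp
  intro i f
  rcases M.psi_cases i j with ⟨h, hB⟩ | ⟨h, hB, i₁, hi₁⟩ | ⟨h, h₃, h₄⟩
  · rw [M.psi_same h, M.psi_same h, M.d_mul_of_s_eq hB (M.s_X_lab h h₁ h₂), hs]
    exact ⟨fun i' hi' => M.single_of_ne (fun H => hi' (by rw [H])) _, rfl⟩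
  · rw [M.psi_swap h hB hi₁, M.psi_swap h hB hi₁, mul_left_comm, hs (M.X _)]
    refine ⟨fun i' hi' => M.single_of_ne (fun H => hi' ?_) _, rfl⟩
    rw [H, M.lab_of_swap hi₁ h, Equiv.swap_apply_of_ne_of_ne h₁ h₂]
  · rw [M.psi_zero h h₃ h₄, M.psi_zero h h₃ h₄, smul_zero]
    exact ⟨fun _ _ => rfl, rfl⟩

/-- An algebra of diagrams acting on the polynomial representation, with its idempotents, its
subalgebra `P` of diagonal elements and its crossings. -/
structure DiagramAlgebra (A : Type*) [Ring A] [Algebra 𝕜 A] where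
  ρ : A →ₐ[𝕜] Module.End 𝕜 M.Space
  e : J → A
  P : Subalgebra 𝕜 A
  ψ : ℕ → A
  ρ_e : ∀ i, ρ (e i) = M.e i
  ρ_ψ : ∀ j : Fin (N - 1), ρ (ψ j) = M.psi j
  ψ_zero : ∀ j, N ≤ j + 1 → ψ j = 0
  e_mem : ∀ i, e i ∈ P
  e_mul_self : ∀ i, e i * e i = e i
  sum_e : ∑ i, e i = 1
  diag : ∀ p ∈ P, ∃ h, ρ p = M.diag h
  e_mul_ψ : ∀ (j : Fin (N - 1)) (i i' : J), M.w i' = swapSeq j (M.w i) → e i' * ψ j = ψ j * e i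
  e_mul_ψ_zero : ∀ (j : Fin (N - 1)) (i : J), M.w i (lo j) ≠ M.w i (hi j) →
    ¬ M.B (M.w i (lo j)) → ¬ M.B (M.w i (hi j)) → e i * ψ j = 0
  mul_ψ : ∀ p ∈ P, ∀ j, ∃ p' ∈ P, ∃ p'' ∈ P, p * ψ j = ψ j * p' + p''
  sq : ∀ j, ψ j * ψ j ∈ P
  braid : ∀ j, ψ j * ψ (j + 1) * ψ j - ψ (j + 1) * ψ j * ψ (j + 1) ∈ P
  far : ∀ j l, j + 1 < l → ψ j * ψ l = ψ l * ψ j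
  top_le : ⊤ ≤ Algebra.adjoin 𝕜 ((P : Set A) ∪ {u | ∃ j, u = ψ j})

namespace DiagramAlgebra

variable {M} {A : Type*} [Ring A] [Algebra 𝕜 A] (𝓐 : M.DiagramAlgebra A)

theorem level_top : level 𝓐.P 𝓐.ψ N = ⊤ := by
  refine top_le_iff.1 (𝓐.top_le.trans (Algebra.adjoin_le ?_))
  rintro u (hu | ⟨j, rfl⟩)
  · exact le_level _ _ _ hu
  · by_cases h : j + 1 < N
    · exact psi_mem_level _ _ h
    · rw [𝓐.ψ_zero j (by omega)]; exact zero_mem _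

/-- The crossings allowed in `level p` involve only positions strictly below `p`. -/
theorem fixesStrand_of_mem_level (p : Fin N) {u : A} (hu : u ∈ level 𝓐.P 𝓐.ψ p) :
    FixesStrand M p (𝓐.ρ u) := by
  induction hu using Algebra.adjoin_induction with
  | mem x hx =>
    rcases hx with hx | ⟨j, hj, rfl⟩
    · obtain ⟨h, hh⟩ := 𝓐.diag x hx
      rw [hh]
      exact M.fixesStrand_diag p h
    · have hj' : j < N - 1 := by have := p.2; omega
      rw [show 𝓐.ρ (𝓐.ψ j) = M.psi ⟨j, hj'⟩ from 𝓐.ρ_ψ ⟨j, hj'⟩]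
      apply M.fixesStrand_psi <;> simp only [lo, hi, ne_eq, Fin.ext_iff] <;> omega
  | algebraMap c =>
    obtain ⟨h, hh⟩ := 𝓐.diag _ (Subalgebra.algebraMap_mem 𝓐.P c)
    rw [hh]
    exact M.fixesStrand_diag p h
  | add x y _ _ hx hy =>
    intro i f
    rw [map_add, LinearMap.add_apply, LinearMap.add_apply, smul_add, (hx i f).2, (hy i f).2]
    exact ⟨fun i' hi' => by
      rw [Pi.add_apply, (hx i f).1 i' hi', (hy i f).1 i' hi', add_zero], rfl⟩
  | mul x y _ _ hx hy => rw [map_mul]; exact hx.mul hy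

/-- A chain moving the strand in position `r` to position `a`: either it does not exist, or it acts
by an operator with invertible leading term. -/
theorem chain_cases (r : Fin N) (n : ℕ) (a : Fin N) (ha : (a : ℕ) + n = r) (i' : J) :
    𝓐.e i' * chain 𝓐.ψ a n = 0 ∨
    ∃ i, 𝓐.e i' * chain 𝓐.ψ a n = chain 𝓐.ψ a n * 𝓐.e i ∧ M.w i r = M.w i' a ∧
      rank (M.w i') a ≤ rank (M.w i) r ∧
      ∃ T : Module.End 𝕜 (MvPolynomial τ 𝕜),
        (∀ f, 𝓐.ρ (chain 𝓐.ψ a n) (M.single i f) = M.single i' (T f)) ∧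
        ∃ (κ : MvPolynomial τ 𝕜) (σ : MvPolynomial τ 𝕜 →ₐ[𝕜] MvPolynomial τ 𝕜), κ ≠ 0 ∧
          Function.Injective σ ∧ σ (M.X (lab (M.w i) r)) = M.X (lab (M.w i') a) ∧
          ∀ f, twist (fun t => M.X (M.w i r, t)) (rank (M.w i) r)
            (rank (M.w i) r - rank (M.w i') a) T f = κ * σ f := by
  induction n generalizing a i' with
  | zero =>
    obtain rfl : a = r := Fin.ext ha
    refine Or.inr ⟨i', by simp [chain], rfl, le_rfl, 1, fun f => by simp [chain], 1,
      AlgHom.id 𝕜 _, one_ne_zero, Function.injective_id, rfl, fun f => ?_⟩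
    rw [Nat.sub_self, one_mul]; rfl
  | succ n ih =>
    have haN : (a : ℕ) < N - 1 := by have := r.2; omega
    set j : Fin (N - 1) := ⟨a, haN⟩ with hj
    have hlo : lo j = a := rfl
    have hhi : ((hi j : Fin N) : ℕ) + n = r := by simp only [hi, hj]; omega
    have hψ : 𝓐.ρ (𝓐.ψ a) = M.psi j := 𝓐.ρ_ψ j
    have hch : chain 𝓐.ψ a (n + 1) = 𝓐.ψ a * chain 𝓐.ψ (hi j) n := rfl
    rw [hch]
    rcases M.psi_cases i' j with ⟨h, hB⟩ | ⟨h, hB, i₁, hi₁⟩ | ⟨h, h₁, h₂⟩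
    · have he : 𝓐.e i' * 𝓐.ψ a = 𝓐.ψ a * 𝓐.e i' :=
        𝓐.e_mul_ψ j i' i' (swapSeq_eq_self h).symm
      rw [← mul_assoc, he, mul_assoc]
      rcases ih (hi j) hhi i' with H | ⟨i, hi₁, hi₂, hi₃, T, hT, κ, σ, hκ, hσ, hX, hD⟩
      · left; rw [H, mul_zero]
      right
      have hup := lab_hi h
      have hrk : rank (M.w i') (hi j) = rank (M.w i') a + 1 := congrArg Prod.snd hup
      refine ⟨i, by rw [hi₁, mul_assoc], by rw [hi₂, ← h, hlo], by omega,
        M.d (lab (M.w i') (lo j)) * T, fun f => ?_,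
        M.s (lab (M.w i') (lo j)) κ, (M.s (lab (M.w i') (lo j))).comp σ, ?_, ?_, ?_, ?_⟩
      · rw [map_mul, Module.End.mul_apply, hT, hψ, M.psi_same h, Module.End.mul_apply]
      · exact (map_ne_zero_iff _ (swapVar_injective _ _)).2 hκ
      · exact (swapVar_injective _ _).comp hσ
      · rw [AlgHom.comp_apply, hX, hup, M.s_X hB, Equiv.swap_apply_right, hlo]
      · intro f
        -- Passing a letter of its own colour lowers the final rank of the strand by one, so this
        -- chain takes one twist more than the shorter one.
        have hk : rank (M.w i) r - rank (M.w i') a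
            = (rank (M.w i) r - rank (M.w i') (hi j)) + 1 := by omega
        have hw : M.w i r = M.w i' (lo j) := by rw [hi₂, ← h]
        have hup' : M.X (M.w i r, rank (M.w i) r - (rank (M.w i) r - rank (M.w i') (hi j)))
            = M.X (up (lab (M.w i') (lo j))) := by
          rw [← hup, hi₂]; congr 1; simp only [lab, Prod.mk.injEq, true_and]; omega
        rw [hk, twist_succ_apply, twist_mul_left, Module.End.mul_apply, Module.End.mul_apply, hD,
          hD, hup']
        · rw [map_mul σ, show σ (M.X (M.w i r, rank (M.w i) r)) = M.X (up (lab (M.w i') (lo j)))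
            from by rw [← hup]; exact hX, mul_left_comm, M.d_X_up_mul_sub hB, map_mul]
          rfl
        -- The dots used by the earlier twists have rank larger than both exchanged letters, so they
        -- commute with the divided difference. The extra twist then turns it into the exchange of
        -- variables.
        · intro t ht f
          apply M.d_mul_of_s_eq hB
          rw [M.s_X hB, Equiv.swap_apply_of_ne_of_ne]
          · intro H
            have H' : rank (M.w i) r - t = rank (M.w i') a := congrArg Prod.snd H
            omega
          · intro H
            have H' : rank (M.w i) r - t = rank (M.w i') a + 1 := congrArg Prod.snd H
            omega
    -- Passing a letter of another colour only multiplies the leading coefficient by a nonzero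
    -- crossing polynomial; the number of twists is unchanged.
    · have he : 𝓐.e i' * 𝓐.ψ a = 𝓐.ψ a * 𝓐.e i₁ :=
        𝓐.e_mul_ψ j i₁ i' (by rw [hi₁, swapSeq_swapSeq])
      rw [← mul_assoc, he, mul_assoc]
      have hl := M.lab_of_swap hi₁ h (hi j)
      rw [Equiv.swap_apply_right] at hl
      have hw₁ : M.w i₁ (hi j) = M.w i' a := congrArg Prod.fst hl
      have hr₁ : rank (M.w i₁) (hi j) = rank (M.w i') a := congrArg Prod.snd hl
      rcases ih (hi j) hhi i₁ with H | ⟨i, hi₁', hi₂, hi₃, T, hT, κ, σ, hκ, hσ, hX, hD⟩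
      · left; rw [H, mul_zero]
      right
      have hne : M.w i₁ (lo j) ≠ M.w i₁ (hi j) := by rw [hi₁]; simpa using h.symm
      have hB' : M.B (M.w i₁ (lo j)) ∨ M.B (M.w i₁ (hi j)) := by rw [hi₁]; simpa using hB.symm
      set g := M.q (lab (M.w i₁) (hi j)) (lab (M.w i₁) (lo j)) with hg
      refine ⟨i, by rw [hi₁', mul_assoc], by rw [hi₂, hw₁], by omega,
        LinearMap.mulLeft 𝕜 g * T, fun f => ?_, g * κ, σ, ?_, hσ, ?_, fun f => ?_⟩
      · rw [map_mul, Module.End.mul_apply, hT, hψ,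
          M.psi_swap (i' := i') hne hB' (by rw [hi₁, swapSeq_swapSeq])]
        rfl
      · exact mul_ne_zero (M.q_ne _ _ hne.symm) hκ
      · rw [hX, hl, hlo]
      · rw [← hr₁, twist_mul_left, Module.End.mul_apply, hD, LinearMap.mulLeft_apply, mul_assoc]
        intro t _ f
        simp only [LinearMap.mulLeft_apply]
        ring
    · left
      rw [← mul_assoc, show 𝓐.e i' * 𝓐.ψ a = 0 from 𝓐.e_mul_ψ_zero j i' h h₁ h₂, zero_mul]

variable (U : Set (MvPolynomial τ 𝕜)) (hU : ∀ f ∈ U, ∀ ℓ, M.X ℓ * f ∈ U)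
  (hPU : ∀ p ∈ 𝓐.P, ∀ i, (∀ f ∈ U, 𝓐.ρ p (M.single i f) = 0) → p * 𝓐.e i = 0)

include hU hPU in
-- Induction on the number of strands. An element of the next level is a sum of chains times
-- coefficients, and leading terms of chains ending at different positions are separated by the
-- number of twists needed to kill them. So each coefficient acts by zero on `U` and falls under the
-- induction hypothesis. Test polynomials enter only at the source `i`, so `U` need only be closed
-- under multiplication by dots.
theorem mul_e_eq_zero (r : ℕ) (hr : r ≤ N) {u : A} (hu : u ∈ level 𝓐.P 𝓐.ψ r) (i : J)
    (h : ∀ f ∈ U, 𝓐.ρ u (M.single i f) = 0) : u * 𝓐.e i = 0 := by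
  induction r generalizing u i with
  | zero => exact hPU u (by rwa [level_zero] at hu) i h
  | succ r ih =>
    set p : Fin N := ⟨r, hr⟩ with hp
    obtain ⟨v, hv, hsum⟩ := exists_eq_sum_chain 𝓐.mul_ψ 𝓐.sq 𝓐.braid 𝓐.far hu
    suffices H : ∀ i', 𝓐.e i' * u * 𝓐.e i = 0 by
      rw [← one_mul u, ← 𝓐.sum_e, Finset.sum_mul, Finset.sum_mul]
      exact Finset.sum_eq_zero fun i' _ => H i'
    intro i'
    set c := M.w i p with hc
    set q := rank (M.w i) p with hq
    set z : ℕ → MvPolynomial τ 𝕜 := fun t => M.X (c, t) with hz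
    -- For each landing position `a`, the matrix entry from `i` to `i'` factors as `T ∘ g`: `T`
    -- comes from the chain and `g` from the coefficient, cut down to `y` by idempotents. Unless `g
    -- = 0`, the moved strand keeps its label, so the chain is killed by one twist more than its
    -- leading term needs.
    have data : ∀ a : Fin N, (a : ℕ) ≤ r → ∃ (T g : Module.End 𝕜 (MvPolynomial τ 𝕜)) (y : A),
        y ∈ level 𝓐.P 𝓐.ψ r ∧ y * 𝓐.e i = y ∧
        𝓐.e i' * (chain 𝓐.ψ a (r - a) * v a) * 𝓐.e i = chain 𝓐.ψ a (r - a) * y ∧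
        (∀ f, g f = 0 → 𝓐.ρ y (M.single i f) = 0) ∧
        (∀ f, 𝓐.ρ (chain 𝓐.ψ a (r - a) * y) (M.single i f) i' = T (g f)) ∧
        (∀ f, g (z q * f) = z q * g f) ∧
        (g = 0 ∨ (M.w i' a = c ∧ rank (M.w i') a ≤ q ∧
          ∃ (κ : MvPolynomial τ 𝕜) (σ : MvPolynomial τ 𝕜 →ₐ[𝕜] MvPolynomial τ 𝕜), κ ≠ 0 ∧
            Function.Injective σ ∧ (∀ f, twist z q (q - rank (M.w i') a) T f = κ * σ f) ∧
            twist z q (q - rank (M.w i') a + 1) T = 0)) := by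
      intro a ha
      rcases 𝓐.chain_cases p (r - a) a (by simp only [hp]; omega) i' with
        H | ⟨i₁, h₁, h₂, h₃, T, hT, κ, σ, hκ, hσ, hX, hD⟩
      · refine ⟨0, 0, 0, zero_mem _, zero_mul _, ?_, by simp, by simp, by simp, Or.inl rfl⟩
        rw [← mul_assoc, H]; simp
      have hfix := 𝓐.fixesStrand_of_mem_level p (u := v a) (hv a)
      have hρ : ∀ f, 𝓐.ρ (𝓐.e i₁ * v a * 𝓐.e i) (M.single i f)
          = M.single i₁ (𝓐.ρ (v a) (M.single i f) i₁) := fun f => by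
        rw [map_mul, map_mul, Module.End.mul_apply, Module.End.mul_apply, 𝓐.ρ_e, 𝓐.ρ_e,
          e_single_self, e_apply]
      refine ⟨T, LinearMap.proj i₁ ∘ₗ 𝓐.ρ (v a) ∘ₗ M.single i, 𝓐.e i₁ * v a * 𝓐.e i,
        mul_mem (mul_mem (le_level _ _ _ (𝓐.e_mem _)) (hv a)) (le_level _ _ _ (𝓐.e_mem _)),
        by rw [mul_assoc, 𝓐.e_mul_self], by rw [← mul_assoc, h₁]; simp only [mul_assoc],
        fun f hf => ?_, fun f => ?_, fun f => ?_, ?_⟩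
      · rw [hρ, show 𝓐.ρ (v a) (M.single i f) i₁ = 0 from hf, map_zero]
      · rw [map_mul, Module.End.mul_apply, hρ, hT, single_self]; rfl
      · have := congrFun (hfix i f).2 i₁
        exact this
      · by_cases hl : lab (M.w i₁) p = lab (M.w i) p
        · have e₁ : M.w i₁ p = c := congrArg Prod.fst hl
          have e₂ : rank (M.w i₁) p = q := congrArg Prod.snd hl
          rw [e₁] at h₂
          rw [e₂] at h₃
          rw [e₁, e₂] at hD
          rw [hl] at hX
          refine Or.inr ⟨h₂.symm, h₃, κ, σ, hκ, hσ, hD, ?_⟩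
          refine LinearMap.ext fun f => ?_
          rw [twist_succ_apply, hD, hD, map_mul, show σ (z q) = M.X (lab (M.w i') a) from hX,
            show z (q - (q - rank (M.w i') a)) = M.X (lab (M.w i') a) from by
              simp only [hz]; congr 1; rw [lab, ← h₂]
              exact Prod.ext rfl (by dsimp only; omega), LinearMap.zero_apply]
          ring
        · left
          exact LinearMap.ext fun f => (hfix i f).1 i₁ hl
    -- The same data for all natural `a`, with zeros beyond `r`, so that they can be chosen as
    -- functions and summed over a range.
    have data' : ∀ a : ℕ, ∃ (T g : Module.End 𝕜 (MvPolynomial τ 𝕜)) (y : A), a ≤ r →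
        y ∈ level 𝓐.P 𝓐.ψ r ∧ y * 𝓐.e i = y ∧
        𝓐.e i' * (chain 𝓐.ψ a (r - a) * v a) * 𝓐.e i = chain 𝓐.ψ a (r - a) * y ∧
        (∀ f, g f = 0 → 𝓐.ρ y (M.single i f) = 0) ∧
        (∀ f, 𝓐.ρ (chain 𝓐.ψ a (r - a) * y) (M.single i f) i' = T (g f)) ∧
        (∀ f, g (z q * f) = z q * g f) ∧
        (g = 0 ∨ (∃ b : Fin N, (b : ℕ) = a ∧ M.w i' b = c ∧ rank (M.w i') b ≤ q ∧
          ∃ (κ : MvPolynomial τ 𝕜) (σ : MvPolynomial τ 𝕜 →ₐ[𝕜] MvPolynomial τ 𝕜), κ ≠ 0 ∧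
            Function.Injective σ ∧ (∀ f, twist z q (q - rank (M.w i') b) T f = κ * σ f) ∧
            twist z q (q - rank (M.w i') b + 1) T = 0)) := by
      intro a
      by_cases ha : a ≤ r
      · obtain ⟨T, g, y, h₁, h₂, h₃, h₄, h₅, h₆, h₇⟩ := data ⟨a, by omega⟩ ha
        exact ⟨T, g, y, fun _ => ⟨h₁, h₂, h₃, h₄, h₅, h₆, h₇.imp id fun h => ⟨_, rfl, h⟩⟩⟩
      · exact ⟨0, 0, 0, fun h => absurd h ha⟩
    choose T g y hdata using data'
    have hF : ∀ f ∈ U, (∑ a ∈ Finset.range (r + 1), T a * g a) f = 0 := by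
      intro f hf
      have h₀ : 𝓐.ρ (𝓐.e i' * u * 𝓐.e i) (M.single i f) i' = 0 := by
        rw [map_mul, map_mul, Module.End.mul_apply, Module.End.mul_apply, 𝓐.ρ_e, 𝓐.ρ_e,
          e_single_self, h f hf, map_zero]; rfl
      rw [hsum, Finset.mul_sum, Finset.sum_mul, map_sum, LinearMap.sum_apply,
        Finset.sum_apply] at h₀
      rw [LinearMap.sum_apply, ← h₀]
      refine Finset.sum_congr rfl fun a ha => ?_
      obtain ⟨-, -, h₃, -, h₅, -⟩ := hdata a (by have := Finset.mem_range.1 ha; omega)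
      rw [h₃, h₅]; rfl
    -- Triangular elimination from left to right, with exactly as many twists as the leading term at
    -- `a` requires.
    have hg : ∀ a ≤ r, ∀ f ∈ U, g a f = 0 := by
      intro a
      induction a using Nat.strong_induction_on with
      | _ a iha =>
        intro ha f hf
        obtain ⟨-, -, -, -, -, h₆, h₇⟩ := hdata a ha
        rcases h₇ with h₇ | ⟨b, hb, hbc, hbq, κ, σ, hκ, hσ, hD, -⟩
        · rw [h₇]; rfl
        set k := q - rank (M.w i') b with hk
        have h₀ := twist_apply_eq_zero z q (fun f hf => hU f hf _) k hF f hf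
        rw [twist_sum, LinearMap.sum_apply, Finset.sum_eq_single a] at h₀
        · rw [twist_mul_right _ _ _ _ _ h₆, Module.End.mul_apply, hD, mul_eq_zero] at h₀
          exact (map_eq_zero_iff _ hσ).1 (h₀.resolve_left hκ)
        · intro a' ha' hne
          have ha'' : a' ≤ r := by have := Finset.mem_range.1 ha'; omega
          obtain ⟨-, -, -, -, -, h₆', h₇'⟩ := hdata a' ha''
          rw [twist_mul_right _ _ _ _ _ h₆', Module.End.mul_apply]
          -- Terms with `a' < a` vanish by induction. For `a' > a` the landing rank is larger, so
          -- the term dies after at most as many twists as have been applied.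
          rcases lt_or_gt_of_ne hne with hlt | hgt
          · rw [iha a' hlt ha'' f hf, map_zero]
          · rcases h₇' with h₇' | ⟨b', hb', hbc', hbq', -, -, -, -, -, hD'⟩
            · rw [h₇', LinearMap.zero_apply, map_zero]
            · have hlt : rank (M.w i') b < rank (M.w i') b' :=
                rank_lt_rank (Fin.lt_def.2 (by omega)) (hbc.trans hbc'.symm)
              rw [twist_eq_zero_of_le z q (by omega) hD', LinearMap.zero_apply]
        · intro hn; exact absurd (Finset.mem_range.2 (by omega)) hn
    rw [hsum, Finset.mul_sum, Finset.sum_mul]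
    refine Finset.sum_eq_zero fun a ha => ?_
    have ha' : a ≤ r := by have := Finset.mem_range.1 ha; omega
    obtain ⟨h₁, h₂, h₃, h₄, -⟩ := hdata a ha'
    rw [h₃, ← h₂, ih (by omega) h₁ i fun f hf => h₄ f (hg a ha' f hf), mul_zero]

include hU hPU in
/-- The polynomial representation is faithful. -/
theorem eq_zero_of_forall {u : A} (h : ∀ i, ∀ f ∈ U, 𝓐.ρ u (M.single i f) = 0) : u = 0 := by
  rw [← mul_one u, ← 𝓐.sum_e, Finset.mul_sum]
  refine Finset.sum_eq_zero fun i _ => ?_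
  exact 𝓐.mul_e_eq_zero U hU hPU N le_rfl (by rw [level_top]; trivial) i (h i)

end DiagramAlgebra

end PolyModel

end KLRSub

namespace KLRSub

/-! ### Commutative subalgebras acting by polynomials -/

section Diagonal

open MvPolynomial

variable {𝕜 : Type*} [Field 𝕜] {C τ J : Type} [DecidableEq τ] [DecidableEq C] {N : ℕ}
  (M : PolyModel 𝕜 C τ J N) [DecidableEq J] [Fintype J] {A : Type*} [Ring A] [Algebra 𝕜 A]

open scoped IsMulCommutative in
/-- If the active generators of a commutative subalgebra act on a component by algebraically
independent elements, and the others by scalars, then the action of the component is faithful. -/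
theorem mul_idem_eq_zero_of_algebraicIndependent (ρ : A →ₐ[𝕜] Module.End 𝕜 M.Space) {ι κ : Type*}
    (e : J → A) (g : ι → A)
    (comm : ∀ x ∈ Set.range e ∪ Set.range g, ∀ y ∈ Set.range e ∪ Set.range g, x * y = y * x)
    (ee : ∀ i i', e i' * e i = if i' = i then e i else 0) (i : J) (a : κ → ι)
    (hg : ∀ t, (∃ k, a k = t) ∨ ∃ c : 𝕜, g t * e i = c • e i) (ξ : κ → MvPolynomial τ 𝕜)
    (hξ : AlgebraicIndependent 𝕜 ξ)
    (hρ : ∀ k f, ρ (g (a k)) (M.single i f) = M.single i (ξ k * f))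
    (hρe : ρ (e i) = M.e i) {δ : MvPolynomial τ 𝕜} (hδ : δ ≠ 0) {p : A}
    (hp : p ∈ Algebra.adjoin 𝕜 (Set.range e ∪ Set.range g)) (h : ρ p (M.single i δ) = 0) :
    p * e i = 0 := by
  set P := Algebra.adjoin 𝕜 (Set.range e ∪ Set.range g) with hP
  have : IsMulCommutative P := Algebra.isMulCommutative_adjoin 𝕜 comm
  let G : κ → P := fun k => ⟨g (a k), Algebra.subset_adjoin (Or.inr ⟨a k, rfl⟩)⟩
  let Φ : MvPolynomial κ 𝕜 →ₐ[𝕜] P := aeval G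
  have hei : e i ∈ P := Algebra.subset_adjoin (Or.inl ⟨i, rfl⟩)
  have hcomm : ∀ x ∈ P, ∀ y ∈ P, x * y = y * x := fun x hx y hy =>
    congrArg Subtype.val (mul_comm (⟨x, hx⟩ : P) ⟨y, hy⟩)
  -- After multiplication by `e i`, inactive generators become scalars and other idempotents vanish,
  -- so `p` may be replaced by a polynomial in the active generators.
  have key : ∀ p ∈ P, ∃ F, p * e i = (Φ F : A) * e i := by
    intro p hp
    induction hp using Algebra.adjoin_induction with
    | mem x hx =>
      rcases hx with ⟨i', rfl⟩ | ⟨t, rfl⟩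
      · rw [ee]
        split_ifs
        · exact ⟨1, by simp⟩
        · exact ⟨0, by simp⟩
      · rcases hg t with ⟨k, rfl⟩ | ⟨c, hc⟩
        · exact ⟨X k, by simp [Φ, G]⟩
        · refine ⟨MvPolynomial.C c, ?_⟩
          rw [hc, ← MvPolynomial.algebraMap_eq, AlgHom.commutes]
          exact Algebra.smul_def c (e i)
    | algebraMap c =>
      refine ⟨MvPolynomial.C c, ?_⟩
      rw [← MvPolynomial.algebraMap_eq, AlgHom.commutes]
      rfl
    | add x y _ _ hx hy =>
      obtain ⟨F, hF⟩ := hx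
      obtain ⟨F', hF'⟩ := hy
      exact ⟨F + F', by rw [add_mul, hF, hF', map_add, ← add_mul]; rfl⟩
    | mul x y hx' hy' hx hy =>
      obtain ⟨F, hF⟩ := hx
      obtain ⟨F', hF'⟩ := hy
      refine ⟨F' * F, ?_⟩
      rw [mul_assoc, hF', ← mul_assoc, hcomm x hx' _ (Φ F').2, mul_assoc, hF, ← mul_assoc, map_mul]
      rfl
  have hΦ : ∀ F f, ρ (Φ F : A) (M.single i f) = M.single i (aeval ξ F * f) := by
    intro F
    induction F using MvPolynomial.induction_on with
    | C c =>
      intro f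
      have : ((Φ (MvPolynomial.C c) : P) : A) = algebraMap 𝕜 A c := by
        rw [← MvPolynomial.algebraMap_eq, AlgHom.commutes]; rfl
      rw [this, AlgHom.commutes, ← MvPolynomial.algebraMap_eq, AlgHom.commutes,
        Module.algebraMap_end_apply, ← map_smul, Algebra.smul_def]
    | add F F' hF hF' =>
      intro f
      have : ((Φ (F + F') : P) : A) = (Φ F : A) + (Φ F' : A) := by rw [map_add]; rfl
      rw [this, map_add ρ, LinearMap.add_apply, hF, hF', map_add, add_mul, map_add]
    | mul_X F k hF =>
      intro f
      have : ((Φ (F * X k) : P) : A) = (Φ F : A) * g (a k) := by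
        rw [map_mul]; simp [Φ, G]
      rw [this, map_mul ρ, Module.End.mul_apply, hρ, hF, map_mul (aeval ξ), aeval_X, mul_assoc]
  obtain ⟨F, hF⟩ := key p hp
  have h₀ : ρ (p * e i) (M.single i δ) = 0 := by
    rw [map_mul, Module.End.mul_apply, hρe, M.e_single_self, h]
  rw [hF, map_mul, Module.End.mul_apply, hρe, M.e_single_self, hΦ] at h₀
  -- A single nonzero test polynomial suffices: the polynomial ring is a domain, and algebraic
  -- independence then forces `F = 0`.
  have h₁ : aeval ξ F * δ = 0 := by
    have := congrFun h₀ i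
    rwa [M.single_self] at this
  have h₂ : F = 0 := (map_eq_zero_iff _ hξ).1 ((mul_eq_zero.1 h₁).resolve_right hδ)
  rw [hF, h₂, map_zero, ZeroMemClass.coe_zero, zero_mul]

/-- Commuting past a crossing is a twisted derivation, so the exchange rule passes from generators
to sums and products. -/
theorem mul_mem_of_mem_adjoin {S : Set A} {ψ : ℕ → A}
    (h : ∀ x ∈ S, ∀ j, ∃ p' ∈ Algebra.adjoin 𝕜 S, ∃ p'' ∈ Algebra.adjoin 𝕜 S,
      x * ψ j = ψ j * p' + p'') :
    ∀ p ∈ Algebra.adjoin 𝕜 S, ∀ j, ∃ p' ∈ Algebra.adjoin 𝕜 S, ∃ p'' ∈ Algebra.adjoin 𝕜 S,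
      p * ψ j = ψ j * p' + p'' := by
  intro p hp j
  induction hp using Algebra.adjoin_induction with
  | mem x hx => exact h x hx j
  | algebraMap c =>
    exact ⟨algebraMap 𝕜 A c, Subalgebra.algebraMap_mem _ c, 0, zero_mem _, by
      rw [add_zero, Algebra.commutes]⟩
  | add x y _ _ hx hy =>
    obtain ⟨p₁, h₁, p₂, h₂, e₁⟩ := hx
    obtain ⟨p₃, h₃, p₄, h₄, e₂⟩ := hy
    exact ⟨p₁ + p₃, add_mem h₁ h₃, p₂ + p₄, add_mem h₂ h₄, by
      rw [add_mul, e₁, e₂, mul_add]; abel⟩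
  | mul x y hx' _ hx hy =>
    obtain ⟨p₁, h₁, p₂, h₂, e₁⟩ := hx
    obtain ⟨p₃, h₃, p₄, h₄, e₂⟩ := hy
    exact ⟨p₁ * p₃, mul_mem h₁ h₃, p₂ * p₃ + x * p₄, add_mem (mul_mem h₂ h₃) (mul_mem hx' h₄), by
      rw [mul_assoc, e₂, mul_add, ← mul_assoc, e₁, add_mul, mul_assoc]; abel⟩

theorem mem_of_mul_idem_mem {J : Type*} [Fintype J] {e : J → A} (he : ∑ i, e i = 1)
    {P : Subalgebra 𝕜 A} {u : A} (h : ∀ i, u * e i ∈ P) : u ∈ P := by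
  rw [← mul_one u, ← he, Finset.mul_sum]
  exact sum_mem fun i _ => h i

theorem eq_of_mul_idem_eq {J : Type*} [Fintype J] {e : J → A} (he : ∑ i, e i = 1)
    {u v : A} (h : ∀ i, u * e i = v * e i) : u = v := by
  rw [← mul_one u, ← mul_one v, ← he, Finset.mul_sum, Finset.mul_sum]
  exact Finset.sum_congr rfl fun i _ => h i

theorem exists_diag_of_mem_adjoin (ρ : A →ₐ[𝕜] Module.End 𝕜 M.Space) {S : Set A}
    (h : ∀ x ∈ S, ∃ h, ρ x = M.diag h) : ∀ p ∈ Algebra.adjoin 𝕜 S, ∃ h, ρ p = M.diag h := by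
  intro p hp
  induction hp using Algebra.adjoin_induction with
  | mem x hx => exact h x hx
  | algebraMap c =>
    refine ⟨fun _ => algebraMap 𝕜 _ c, ?_⟩
    rw [AlgHom.commutes]
    refine LinearMap.ext fun f => funext fun i => ?_
    rw [Module.algebraMap_end_apply, Pi.smul_apply, Algebra.smul_def]; rfl
  | add x y _ _ hx hy =>
    obtain ⟨a, ha⟩ := hx
    obtain ⟨b, hb⟩ := hy
    refine ⟨a + b, ?_⟩
    rw [map_add, ha, hb]
    refine LinearMap.ext fun f => funext fun i => ?_
    simp [add_mul]
  | mul x y _ _ hx hy =>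
    obtain ⟨a, ha⟩ := hx
    obtain ⟨b, hb⟩ := hy
    exact ⟨a * b, by rw [map_mul, ha, hb, M.diag_mul_diag]⟩

end Diagonal

/-! ### The relations of the extended datum of type `A₁` -/

section TypeA

variable {𝕜 : Type*} [Field 𝕜] {D : CartanDatum (Fin 1)} (Q : ScalarParams 𝕜 D)

theorem ext_form_self_div (a : Fin 1) : 2 * -(D.form a a / 2) / D.form a a = -1 := by
  have h₁ := D.form_self_pos a
  obtain ⟨b, hb⟩ := (D.form_self_even a).two_dvd
  rw [hb]
  rw [Int.mul_ediv_cancel_left _ (by norm_num)]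
  rw [show 2 * -b = -1 * (2 * b) by ring]
  exact Int.mul_ediv_cancel _ (by omega)

theorem ext_c_of_ne (a b : Fin 1 ⊕ Fin 1) (h : a ≠ b) : D.ext.c a b = -1 := by
  rcases a with a | a <;> rcases b with b | b <;> obtain rfl := Subsingleton.elim a b
  · exact absurd rfl h
  · simpa [CartanDatum.c, CartanDatum.ext, extForm] using ext_form_self_div a
  · simpa [CartanDatum.c, CartanDatum.ext, extForm] using ext_form_self_div a
  · exact absurd rfl h

theorem ext_c_self (a : Fin 1 ⊕ Fin 1) : D.ext.c a a = 2 := by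
  have h := D.ext.form_self_pos a
  rw [CartanDatum.c]
  exact Int.mul_ediv_cancel _ (by omega)

theorem ext_form_ne_zero (a b : Fin 1 ⊕ Fin 1) : D.ext.form a b ≠ 0 := by
  by_cases h : a = b
  · rw [h]; exact (D.ext.form_self_pos b).ne'
  · intro h'
    have := ext_c_of_ne (D := D) a b h
    rw [CartanDatum.c, h'] at this
    simp at this

variable {A : Type*} [Ring A] [Algebra 𝕜 A]

/-- The sign of an ordered pair of distinct colours. -/
def colourSign : Fin 1 ⊕ Fin 1 → ℤ
  | Sum.inl _ => 1
  | Sum.inr _ => -1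

/-- The scalars of `Q` could enter only through two different elements of `I`, and there is just
one. Only the signs between solid and dashed strands remain. -/
theorem bar_t (a b : Fin 1 ⊕ Fin 1) (h : a ≠ b) : (Q.bar.t a b : 𝕜) = colourSign a := by
  rcases a with a | a <;> rcases b with b | b <;> obtain rfl := Subsingleton.elim a b
  · exact absurd rfl h
  · simp [ScalarParams.bar, barT, colourSign]
  · simp [ScalarParams.bar, barT, colourSign]
  · exact absurd rfl h

theorem quadRHS_bar (a b : Fin 1 ⊕ Fin 1) (X Y : A) :
    quadRHS Q.bar a b X Y = if a = b then 0 else (colourSign a : 𝕜) • X + (colourSign b : 𝕜) • Y := by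
  rw [quadRHS]
  split_ifs with h h'
  · rfl
  · exact absurd h' (ext_form_ne_zero a b)
  · rw [bar_t Q a b h, bar_t Q b a (Ne.symm h), ext_c_of_ne a b h, ext_c_of_ne b a (Ne.symm h)]
    simp [ScalarParams.bar]

theorem cubicRHS_bar (a b a' : Fin 1 ⊕ Fin 1) (X Y Z : A) :
    cubicRHS Q.bar a b a' X Y Z = if a = a' ∧ a ≠ b then (colourSign a : 𝕜) • 1 else 0 := by
  rw [cubicRHS]
  by_cases h : a = b
  · subst h
    rw [if_neg, if_neg]
    · simp
    · rw [ext_c_self]; norm_num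
  · rw [ext_c_of_ne a b h]
    by_cases h' : a = a'
    · rw [if_pos ⟨h', by norm_num⟩, if_pos ⟨h', h⟩, bar_t Q a b h]
      simp [ScalarParams.bar]
    · rw [if_neg (fun H => h' H.1), if_neg (fun H => h' H.1)]

end TypeA

end KLRSub

namespace KLRSub

/-! ### The polynomial representation of the ambient algebra -/

section KLRModel

/-- The variables: solid and dashed strands, numbered separately. -/
abbrev Var : Type := (Fin 1 ⊕ Fin 1) × ℕ

variable (𝕜 : Type*) [Field 𝕜]

/-- The polynomial by which a crossing acts, for the labels of the left and the right strand of
the result. -/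
noncomputable def klrQ (a b : Var) : MvPolynomial Var 𝕜 :=
  if a.1.isLeft = true ∧ b.1.isLeft = false then MvPolynomial.X a - MvPolynomial.X b else 1

/-- The polynomial representation of the Khovanov–Lauda–Rouquier algebra. -/
noncomputable def klrModel (n : ℕ) :
    PolyModel 𝕜 (Fin 1 ⊕ Fin 1) Var (Fin n → Fin 1 ⊕ Fin 1) n where
  w := id
  w_inj := Function.injective_id
  B := fun _ => True
  v := id
  v_inj := fun _ _ _ _ h => h
  rep := fun _ _ _ _ _ => trivial
  ex := fun i j _ => ⟨swapSeq j i, rfl⟩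
  q := klrQ 𝕜
  q_ne := fun a b h => by
    rw [klrQ]
    split_ifs
    · exact X_sub_X_ne_zero fun H => h (by rw [H])
    · exact one_ne_zero
  q_swap := fun ℓ a b _ h => by
    have hs : ∀ c, (Equiv.swap ℓ (up ℓ) c).1 = c.1 := fun c => by
      rw [Equiv.swap_apply_def]
      split_ifs with h₁ h₂
      · rw [h₁]; rfl
      · rw [h₂]; rfl
      · rfl
    simp only [klrQ, hs]
    split_ifs <;> simp

variable {𝕜} {D : CartanDatum (Fin 1)} (Q : ScalarParams 𝕜 D) (n : ℕ)

theorem klrModel_X (ℓ : Var) : (klrModel 𝕜 n).X ℓ = MvPolynomial.X ℓ :=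
  (klrModel 𝕜 n).X_eq trivial

theorem colour_eq_of_ne {a b c : Fin 1 ⊕ Fin 1} (h₁ : a ≠ b) (h₂ : b ≠ c) : a = c := by
  rcases a with a | a <;> rcases b with b | b <;> rcases c with c | c <;>
    simp_all [Subsingleton.elim a b, Subsingleton.elim b c]

theorem klrQ_mul_klrQ {a b : Var} (h : a.1 ≠ b.1) :
    klrQ 𝕜 a b * klrQ 𝕜 b a
      = (colourSign a.1 : 𝕜) • MvPolynomial.X a + (colourSign b.1 : 𝕜) • MvPolynomial.X b := by
  obtain ⟨a | a, r⟩ := a <;> obtain ⟨b | b, t⟩ := b <;> obtain rfl := Subsingleton.elim a b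
  · exact absurd rfl h
  · simp [klrQ, colourSign, sub_eq_add_neg]
  · simp [klrQ, colourSign, sub_eq_add_neg, add_comm]
  · exact absurd rfl h

/-- In either colour pattern the dot of the middle strand commutes with the divided difference of
the outer pair. Moving the outer dot past it leaves `f` when the outer strands are solid and `-f`
when they are dashed. -/
theorem klr_cubic {a b : Var} (h : a.1 ≠ b.1) (f : MvPolynomial Var 𝕜) :
    klrQ 𝕜 a b * (klrModel 𝕜 n).d a (klrQ 𝕜 b a * f)
      - klrQ 𝕜 b (up a) * (klrModel 𝕜 n).d a (klrQ 𝕜 (up a) b * f)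
      = (colourSign a.1 : 𝕜) • f := by
  have h₁ := (klrModel 𝕜 n).d_X_mul (ℓ := a) trivial f
  have h₂ := (klrModel 𝕜 n).d_X_up_mul (ℓ := a) trivial f
  have h₃ : (klrModel 𝕜 n).d a (MvPolynomial.X b * f)
      = MvPolynomial.X b * (klrModel 𝕜 n).d a f := by
    rw [← klrModel_X n b]
    apply (klrModel 𝕜 n).d_mul_of_s_eq trivial
    rw [(klrModel 𝕜 n).s_X trivial, Equiv.swap_apply_of_ne_of_ne]
    · exact fun H => h (by rw [H])
    · exact fun H => h (by rw [H]; rfl)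
  simp only [klrModel_X] at h₁ h₂
  obtain ⟨a | a, r⟩ := a <;> obtain ⟨b | b, t⟩ := b <;> obtain rfl := Subsingleton.elim a b
  · exact absurd rfl h
  · simp only [klrQ, up, colourSign] at h₁ h₂ h₃ ⊢
    simp only [Sum.isLeft_inl, Sum.isLeft_inr, and_self, if_true, Bool.false_eq_true, false_and,
      if_false, one_mul, sub_mul, map_sub, h₂, h₃]
    simp
  · simp only [klrQ, up, colourSign] at h₁ h₂ h₃ ⊢
    simp only [Sum.isLeft_inl, Sum.isLeft_inr, and_self, if_true, Bool.false_eq_true, false_and,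
      if_false, one_mul, sub_mul, map_sub, h₁, h₃]
    simp
  · exact absurd rfl h

/-- The action of the generators. -/
noncomputable def klrGen : KLRGen (Fin 1 ⊕ Fin 1) n → Module.End 𝕜 (klrModel 𝕜 n).Space
  | .e i => (klrModel 𝕜 n).e i
  | .x j => (klrModel 𝕜 n).x j
  | .psi k => (klrModel 𝕜 n).psi k

@[simp] theorem lift_klr_e (i) :
    FreeAlgebra.lift 𝕜 (klrGen (𝕜 := 𝕜) n) (Free.e 𝕜 (Fin 1 ⊕ Fin 1) n i)
      = (klrModel 𝕜 n).e i := FreeAlgebra.lift_ι_apply _ _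

@[simp] theorem lift_klr_x (i) :
    FreeAlgebra.lift 𝕜 (klrGen (𝕜 := 𝕜) n) (Free.x 𝕜 (Fin 1 ⊕ Fin 1) n i)
      = (klrModel 𝕜 n).x i := FreeAlgebra.lift_ι_apply _ _

@[simp] theorem lift_klr_psi (i) :
    FreeAlgebra.lift 𝕜 (klrGen (𝕜 := 𝕜) n) (Free.psi 𝕜 (Fin 1 ⊕ Fin 1) n i)
      = (klrModel 𝕜 n).psi i := FreeAlgebra.lift_ι_apply _ _

open PolyModel in
theorem klr_rel {a b : FreeAlgebra 𝕜 (KLRGen (Fin 1 ⊕ Fin 1) n)} (h : KLRRel n Q.bar a b) :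
    FreeAlgebra.lift 𝕜 (klrGen (𝕜 := 𝕜) n) a = FreeAlgebra.lift 𝕜 (klrGen (𝕜 := 𝕜) n) b := by
  set M := klrModel 𝕜 n with hM
  -- A relation ending in `e i` needs to be verified only on the component of `i`.
  have mul_e : ∀ {T T' : Module.End 𝕜 M.Space} (i), (∀ f, T (M.single i f) = T' (M.single i f)) →
      T * M.e i = T' * M.e i := fun i hT => LinearMap.ext fun f => by
    rw [Module.End.mul_apply, Module.End.mul_apply, M.e_apply, hT]
  induction h with
  | sum_e =>
    simp only [map_sum, map_one, lift_klr_e]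
    exact M.sum_e
  | e_e i j =>
    rw [apply_ite (FreeAlgebra.lift 𝕜 (klrGen (𝕜 := 𝕜) n))]
    simp only [map_mul, map_zero, lift_klr_e]
    exact M.e_mul_e i j
  | x_e j i =>
    simp only [map_mul, lift_klr_e, lift_klr_x]
    exact M.diag_comm _ _
  | psi_e k i =>
    simp only [map_mul, lift_klr_e, lift_klr_psi]
    exact M.psi_mul_e (i := i) (i' := swapSeq k i) rfl
  | x_x j l =>
    simp only [map_mul, lift_klr_x]
    exact M.diag_comm _ _
  | psi_x k l h₁ h₂ =>
    simp only [map_mul, lift_klr_x, lift_klr_psi]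
    exact M.psi_mul_x h₁ h₂
  | psi_psi j k h =>
    simp only [map_mul, lift_klr_psi]
    exact M.psi_psi_far h
  | slide₁ k i =>
    have : (if i (lo k) = i (hi k) then (Q.bar.r (i (lo k)) : 𝕜) • Free.e 𝕜 (Fin 1 ⊕ Fin 1) n i
        else 0) = (if i (lo k) = i (hi k) then 1 else 0) * Free.e 𝕜 (Fin 1 ⊕ Fin 1) n i := by
      split_ifs <;> simp [ScalarParams.bar]
    rw [this, ← sub_mul, map_mul, map_mul, lift_klr_e]
    apply mul_e
    intro f
    have := M.slide_left k i f
    rw [show M.w i = i from rfl] at this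
    rw [apply_ite (FreeAlgebra.lift 𝕜 (klrGen (𝕜 := 𝕜) n))]
    simp only [map_sub, map_mul, lift_klr_x, lift_klr_psi, LinearMap.sub_apply,
      Module.End.mul_apply, map_one, map_zero]
    rw [this]
    split_ifs <;> rfl
  | slide₂ k i =>
    have : (if i (lo k) = i (hi k) then (Q.bar.r (i (lo k)) : 𝕜) • Free.e 𝕜 (Fin 1 ⊕ Fin 1) n i
        else 0) = (if i (lo k) = i (hi k) then 1 else 0) * Free.e 𝕜 (Fin 1 ⊕ Fin 1) n i := by
      split_ifs <;> simp [ScalarParams.bar]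
    rw [this, ← sub_mul, map_mul, map_mul, lift_klr_e]
    apply mul_e
    intro f
    have := M.slide_right k i f
    rw [show M.w i = i from rfl] at this
    rw [apply_ite (FreeAlgebra.lift 𝕜 (klrGen (𝕜 := 𝕜) n))]
    simp only [map_sub, map_mul, lift_klr_x, lift_klr_psi, LinearMap.sub_apply,
      Module.End.mul_apply, map_one, map_zero]
    rw [this]
    split_ifs <;> rfl
  | quad k i =>
    rw [quadRHS_bar, map_mul, map_mul, map_mul, lift_klr_e, lift_klr_psi]
    apply mul_e
    intro f
    rw [Module.End.mul_apply, apply_ite (FreeAlgebra.lift 𝕜 (klrGen (𝕜 := 𝕜) n))]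
    split_ifs with h
    · rw [M.psi_psi_same h, map_zero]; rfl
    · rw [M.psi_psi_swap h (Or.inl trivial)]
      change M.single i (klrQ 𝕜 (lab i (lo k)) (lab i (hi k))
        * klrQ 𝕜 (lab i (hi k)) (lab i (lo k)) * f) = _
      rw [klrQ_mul_klrQ h]
      rw [map_add (FreeAlgebra.lift 𝕜 (klrGen (𝕜 := 𝕜) n)), map_smul, map_smul, lift_klr_x,
        lift_klr_x, LinearMap.add_apply, LinearMap.smul_apply, LinearMap.smul_apply, M.x_single,
        M.x_single, ← map_smul, ← map_smul, ← map_add]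
      congr 1
      rw [hM, klrModel_X, klrModel_X, add_mul, smul_mul_assoc, smul_mul_assoc]
      rfl
  | cubic k l h i =>
    rw [cubicRHS_bar, map_mul, map_mul, lift_klr_e]
    apply mul_e
    intro f
    rw [apply_ite (FreeAlgebra.lift 𝕜 (klrGen (𝕜 := 𝕜) n))]
    simp only [map_sub, map_mul, lift_klr_psi, LinearMap.sub_apply, Module.End.mul_apply]
    by_cases h₁ : i (lo k) = i (lo l)
    · rw [if_neg (by simp [h₁])]
      by_cases h₂ : i (lo l) = i (hi l)
      · rw [M.cubic_same h h₁ h₂, sub_self, map_zero]; rfl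
      · rw [M.cubic_left_pair h h₁ h₂, sub_self, map_zero]; rfl
    · by_cases h₂ : i (lo l) = i (hi l)
      · rw [M.cubic_right_pair h h₁ h₂, sub_self, if_neg, map_zero]
        · rfl
        · rw [← h₂]; tauto
      -- With two colours available, a triple whose neighbours differ must have equal outer letters.
      · have h₃ := colour_eq_of_ne h₁ h₂
        obtain ⟨hu, hc⟩ := M.cubic_outer_pair h h₁ h₃ f
        rw [hc, if_pos ⟨h₃, h₁⟩, map_smul, map_one, LinearMap.smul_apply, Module.End.one_apply,
          ← map_smul]
        congr 1
        rw [hu]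
        exact klr_cubic n h₁ f

/-- The polynomial representation. -/
noncomputable def klrRep : KLR n Q.bar →ₐ[𝕜] Module.End 𝕜 (klrModel 𝕜 n).Space :=
  RingQuot.liftAlgHom 𝕜 ⟨FreeAlgebra.lift 𝕜 (klrGen n), fun _ _ h => klr_rel Q n h⟩

theorem klrRep_mk (a : FreeAlgebra 𝕜 (KLRGen (Fin 1 ⊕ Fin 1) n)) :
    klrRep Q n (KLR.mk n Q.bar a) = FreeAlgebra.lift 𝕜 (klrGen n) a :=
  RingQuot.liftAlgHom_mkAlgHom_apply ..

@[simp] theorem klrRep_e (i : Fin n → Fin 1 ⊕ Fin 1) :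
    klrRep Q n (KLR.e n Q.bar i) = (klrModel 𝕜 n).e i := by
  rw [KLR.e, klrRep_mk, lift_klr_e]

theorem klrRep_x (j : Fin n) : klrRep Q n (KLR.x n Q.bar j) = (klrModel 𝕜 n).x j := by
  rw [KLR.x, dif_pos j.2, klrRep_mk, lift_klr_x]

theorem klrRep_psi (j : Fin (n - 1)) : klrRep Q n (KLR.psi n Q.bar j) = (klrModel 𝕜 n).psi j := by
  rw [KLR.psi, dif_pos j.2, klrRep_mk, lift_klr_psi]

end KLRModel

end KLRSub

namespace KLRSub

/-! ### Diagram algebras from generators and relations -/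

section Builder

variable {𝕜 : Type*} [Field 𝕜] {C τ J : Type} [DecidableEq τ] [DecidableEq C] {N : ℕ}
  {M : PolyModel 𝕜 C τ J N} [DecidableEq J] [Fintype J] {A : Type*} [Ring A] [Algebra 𝕜 A]

open PolyModel

/-- The diagonal generators: idempotents, dots and central elements. -/
def diagGens {ι : Type*} (e : J → A) (x : Fin N → A) (E : ι → A) : Set A :=
  Set.range e ∪ Set.range (Sum.elim x E)

theorem diagGens_comm {ι : Type*} {e : J → A} {x : Fin N → A} {E : ι → A}
    (ee : ∀ i i', e i' * e i = if i' = i then e i else 0) (xe : ∀ j i, x j * e i = e i * x j)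
    (xx : ∀ j l, x j * x l = x l * x j) (central : ∀ k y, E k * y = y * E k) :
    ∀ y ∈ diagGens e x E, ∀ z ∈ diagGens e x E, y * z = z * y := by
  rintro y (⟨i, rfl⟩ | ⟨j | k, rfl⟩) z (⟨i', rfl⟩ | ⟨j' | k', rfl⟩)
  · rw [ee, ee]
    by_cases h : i = i'
    · subst h; rfl
    · rw [if_neg h, if_neg (Ne.symm h)]
  · exact (xe _ _).symm
  · exact (central _ _).symm
  · exact xe _ _
  · exact xx _ _
  · exact (central _ _).symm
  all_goals exact central _ _

/-- A diagram algebra from generators satisfying the local relations. -/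
def DiagramAlgebra.ofRelations {ι : Type*} (ρ : A →ₐ[𝕜] Module.End 𝕜 M.Space) (e : J → A)
    (x : Fin N → A) (E : ι → A) (ψ : ℕ → A)
    (ρ_e : ∀ i, ρ (e i) = M.e i) (ρ_ψ : ∀ j : Fin (N - 1), ρ (ψ j) = M.psi j)
    (ρ_x : ∀ j, ∃ h, ρ (x j) = M.diag h) (ρ_E : ∀ k, ∃ h, ρ (E k) = M.diag h)
    (ψ_zero : ∀ j, N ≤ j + 1 → ψ j = 0)
    (ee : ∀ i i', e i' * e i = if i' = i then e i else 0) (sum_e : ∑ i, e i = 1)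
    (central : ∀ k y, E k * y = y * E k)
    (ψ_e : ∀ (j : Fin (N - 1)) (i i' : J), M.w i' = swapSeq j (M.w i) → ψ j * e i = e i' * ψ j)
    (e_ψ : ∀ (j : Fin (N - 1)) (i : J), M.w i (lo j) ≠ M.w i (hi j) →
      ¬ M.B (M.w i (lo j)) → ¬ M.B (M.w i (hi j)) → e i * ψ j = 0)
    (ψ_x : ∀ (j : Fin (N - 1)) (p : Fin N), p ≠ lo j → p ≠ hi j → ψ j * x p = x p * ψ j)
    (slide₁ : ∀ (j : Fin (N - 1)) (i : J),
      (x (lo j) * ψ j - ψ j * x (hi j)) * e i ∈ Algebra.adjoin 𝕜 (diagGens e x E))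
    (slide₂ : ∀ (j : Fin (N - 1)) (i : J),
      (x (hi j) * ψ j - ψ j * x (lo j)) * e i ∈ Algebra.adjoin 𝕜 (diagGens e x E))
    (quad : ∀ (j : Fin (N - 1)) (i : J), ψ j * ψ j * e i ∈ Algebra.adjoin 𝕜 (diagGens e x E))
    (cubic : ∀ j l : Fin (N - 1), (l : ℕ) = j + 1 → ∀ i, (ψ j * ψ l * ψ j - ψ l * ψ j * ψ l) * e i ∈
      Algebra.adjoin 𝕜 (diagGens e x E))
    (far : ∀ j l : Fin (N - 1), (j : ℕ) + 1 < l → ψ j * ψ l = ψ l * ψ j)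
    (top_le : ⊤ ≤ Algebra.adjoin 𝕜 (diagGens e x E ∪ {u | ∃ j, u = ψ j})) :
    M.DiagramAlgebra A where
  ρ := ρ
  e := e
  P := Algebra.adjoin 𝕜 (diagGens e x E)
  ψ := ψ
  ρ_e := ρ_e
  ρ_ψ := ρ_ψ
  ψ_zero := ψ_zero
  e_mem := fun i => Algebra.subset_adjoin (Or.inl ⟨i, rfl⟩)
  e_mul_self := fun i => by rw [ee, if_pos rfl]
  sum_e := sum_e
  diag := exists_diag_of_mem_adjoin M ρ (by
    rintro y (⟨i, rfl⟩ | ⟨j | k, rfl⟩)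
    · exact ⟨_, ρ_e i⟩
    · exact ρ_x j
    · exact ρ_E k)
  e_mul_ψ := fun j i i' h => (ψ_e j i i' h).symm
  e_mul_ψ_zero := e_ψ
  mul_ψ := mul_mem_of_mem_adjoin (by
    have h₀ : (0 : A) ∈ Algebra.adjoin 𝕜 (diagGens e x E) := zero_mem _
    have hx : ∀ p, x p ∈ Algebra.adjoin 𝕜 (diagGens e x E) := fun p =>
      Algebra.subset_adjoin (Or.inr ⟨Sum.inl p, rfl⟩)
    intro y hy j
    by_cases hj : j < N - 1
    swap
    · exact ⟨0, h₀, 0, h₀, by rw [ψ_zero j (by omega)]; simp⟩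
    have hj' : j = ((⟨j, hj⟩ : Fin (N - 1)) : ℕ) := rfl
    rw [hj']
    generalize (⟨j, hj⟩ : Fin (N - 1)) = j
    rcases hy with ⟨i, rfl⟩ | ⟨p | k, rfl⟩
    · rcases M.psi_cases i j with ⟨h, -⟩ | ⟨h, hB, i', hi'⟩ | ⟨h, h₁, h₂⟩
      · exact ⟨e i, Algebra.subset_adjoin (Or.inl ⟨i, rfl⟩), 0, h₀, by
          rw [ψ_e j i i (swapSeq_eq_self h).symm, add_zero]⟩
      · exact ⟨e i', Algebra.subset_adjoin (Or.inl ⟨i', rfl⟩), 0, h₀, by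
          rw [ψ_e j i' i (by rw [hi', swapSeq_swapSeq]), add_zero]⟩
      · exact ⟨0, h₀, 0, h₀, by rw [e_ψ j i h h₁ h₂]; simp⟩
    · simp only [Sum.elim_inl]
      by_cases h₁ : p = lo j
      · subst h₁
        -- The correction term is the twisted commutator itself, diagonal because it is so after
        -- multiplication by each idempotent.
        exact ⟨x (hi j), hx _, _, mem_of_mul_idem_mem sum_e (slide₁ j), by abel⟩
      by_cases h₂ : p = hi j
      · subst h₂
        exact ⟨x (lo j), hx _, _, mem_of_mul_idem_mem sum_e (slide₂ j), by abel⟩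
      exact ⟨x p, hx _, 0, h₀, by rw [ψ_x j p h₁ h₂, add_zero]⟩
    · exact ⟨E k, Algebra.subset_adjoin (Or.inr ⟨Sum.inr k, rfl⟩), 0, h₀, by
        rw [Sum.elim_inr, central, add_zero]⟩)
  sq := fun j => by
    by_cases hj : j < N - 1
    · exact mem_of_mul_idem_mem sum_e (quad ⟨j, hj⟩)
    · rw [ψ_zero j (by omega), zero_mul]; exact zero_mem _
  braid := fun j => by
    by_cases hj : j + 1 < N - 1
    · exact mem_of_mul_idem_mem sum_e (cubic ⟨j, by omega⟩ ⟨j + 1, hj⟩ rfl)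
    · rw [ψ_zero (j + 1) (by omega)]; simp
  far := fun j l h => by
    by_cases hl : l < N - 1
    · exact far ⟨j, by omega⟩ ⟨l, hl⟩ h
    · rw [ψ_zero l (by omega)]; simp
  top_le := top_le.trans (Algebra.adjoin_mono
    (Set.union_subset_union_left _ Algebra.subset_adjoin))

end Builder

/-! ### The ambient algebra acts faithfully -/

section KLRFaithful

variable {𝕜 : Type*} [Field 𝕜] {D : CartanDatum (Fin 1)} (Q : ScalarParams 𝕜 D) (n : ℕ)

theorem klr_mk_eq {a b : FreeAlgebra 𝕜 (KLRGen (Fin 1 ⊕ Fin 1) n)} (h : KLRRel n Q.bar a b) :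
    KLR.mk n Q.bar a = KLR.mk n Q.bar b := RingQuot.mkAlgHom_rel 𝕜 h

theorem klr_x_eq (j : Fin n) :
    KLR.x n Q.bar j = KLR.mk n Q.bar (Free.x 𝕜 (Fin 1 ⊕ Fin 1) n j) := by
  rw [KLR.x, dif_pos j.2]

theorem klr_psi_eq (j : Fin (n - 1)) :
    KLR.psi n Q.bar j = KLR.mk n Q.bar (Free.psi 𝕜 (Fin 1 ⊕ Fin 1) n j) := by
  rw [KLR.psi, dif_pos j.2]

theorem klr_e_mul_e (i i' : Fin n → Fin 1 ⊕ Fin 1) :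
    KLR.e n Q.bar i * KLR.e n Q.bar i' = if i = i' then KLR.e n Q.bar i else 0 := by
  have := klr_mk_eq Q n (.e_e i i')
  rw [map_mul, apply_ite (KLR.mk n Q.bar), map_zero] at this
  exact this

/-- The diagonal generators of the ambient algebra. -/
noncomputable def klrDiagGens : Set (KLR n Q.bar) :=
  diagGens (KLR.e n Q.bar) (fun j : Fin n => KLR.x n Q.bar j) (Empty.elim : Empty → KLR n Q.bar)

theorem klr_x_mem (j : Fin n) : KLR.x n Q.bar j ∈ Algebra.adjoin 𝕜 (klrDiagGens Q n) :=
  Algebra.subset_adjoin (Or.inr ⟨Sum.inl j, rfl⟩)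

theorem klr_e_mem (i) : KLR.e n Q.bar i ∈ Algebra.adjoin 𝕜 (klrDiagGens Q n) :=
  Algebra.subset_adjoin (Or.inl ⟨i, rfl⟩)

theorem mk_slide_mem (P : Prop) [Decidable P] (c : 𝕜) (i : Fin n → Fin 1 ⊕ Fin 1) :
    KLR.mk n Q.bar (if P then c • Free.e 𝕜 (Fin 1 ⊕ Fin 1) n i else 0)
      ∈ Algebra.adjoin 𝕜 (klrDiagGens Q n) := by
  split_ifs
  · rw [map_smul]
    exact Subalgebra.smul_mem _ (klr_e_mem Q n i) c
  · rw [map_zero]; exact zero_mem _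

/-- The ambient algebra as a diagram algebra. -/
noncomputable def klrDiagram : (klrModel 𝕜 n).DiagramAlgebra (KLR n Q.bar) :=
  DiagramAlgebra.ofRelations (klrRep Q n) (KLR.e n Q.bar)
    (fun j : Fin n => KLR.x n Q.bar j) (Empty.elim : Empty → KLR n Q.bar) (KLR.psi n Q.bar)
    (klrRep_e Q n) (klrRep_psi Q n) (fun j => ⟨_, klrRep_x Q n j⟩) (fun k => k.elim)
    (fun j h => by rw [KLR.psi, dif_neg (by omega)])
    (fun i i' => by
      rw [klr_e_mul_e]
      by_cases h : i' = i
      · rw [h]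
      · rw [if_neg h, if_neg h])
    (by
      have := klr_mk_eq Q n .sum_e
      rwa [map_sum, map_one] at this)
    (fun k => k.elim)
    (fun j i i' h => by
      have := klr_mk_eq Q n (.psi_e j i)
      rw [map_mul, map_mul] at this
      rw [klr_psi_eq, show i' = swapSeq j i from h]
      exact this)
    (fun j i _ h => absurd trivial h)
    (fun j p h₁ h₂ => by
      have := klr_mk_eq Q n (.psi_x j p h₁ h₂)
      rwa [map_mul, map_mul, ← klr_psi_eq, ← klr_x_eq] at this)
    (fun j i => by
      have := klr_mk_eq Q n (.slide₁ j i)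
      rw [map_sub, map_mul, map_mul, map_mul, map_mul, ← sub_mul, ← klr_psi_eq, ← klr_x_eq,
        ← klr_x_eq] at this
      exact this ▸ mk_slide_mem Q n _ _ i)
    (fun j i => by
      have := klr_mk_eq Q n (.slide₂ j i)
      rw [map_sub, map_mul, map_mul, map_mul, map_mul, ← sub_mul, ← klr_psi_eq, ← klr_x_eq,
        ← klr_x_eq] at this
      have h := neg_mem (this ▸ mk_slide_mem Q n _ _ i)
      rwa [← neg_mul, neg_sub] at h)
    (fun j i => by
      have := klr_mk_eq Q n (.quad j i)
      rw [quadRHS_bar, map_mul, map_mul, map_mul, ← klr_psi_eq] at this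
      refine this ▸ mul_mem ?_ (klr_e_mem Q n i)
      split_ifs
      · rw [map_zero]; exact zero_mem _
      · rw [map_add, map_smul, map_smul, ← klr_x_eq, ← klr_x_eq]
        exact add_mem (Subalgebra.smul_mem _ (klr_x_mem Q n _) _)
          (Subalgebra.smul_mem _ (klr_x_mem Q n _) _))
    (fun j l h i => by
      have := klr_mk_eq Q n (.cubic j l h i)
      rw [cubicRHS_bar, map_mul, map_mul, map_sub, map_mul, map_mul, map_mul, map_mul,
        ← klr_psi_eq, ← klr_psi_eq] at this
      refine this ▸ mul_mem ?_ (klr_e_mem Q n i)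
      split_ifs
      · rw [map_smul, map_one]; exact Subalgebra.smul_mem _ (one_mem _) _
      · rw [map_zero]; exact zero_mem _)
    (fun j l h => by
      have := klr_mk_eq Q n (.psi_psi j l h)
      rwa [map_mul, map_mul, ← klr_psi_eq, ← klr_psi_eq] at this)
    (by
      rintro u -
      obtain ⟨a, rfl⟩ : ∃ a, KLR.mk n Q.bar a = u := RingQuot.mkAlgHom_surjective 𝕜 _ u
      induction a using FreeAlgebra.induction with
      | grade0 r => rw [AlgHom.commutes]; exact Subalgebra.algebraMap_mem _ r
      | grade1 g =>
        refine Algebra.subset_adjoin ?_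
        cases g with
        | e i => exact Or.inl (Or.inl ⟨i, rfl⟩)
        | x j => exact Or.inl (Or.inr ⟨Sum.inl j, klr_x_eq Q n j⟩)
        | psi k => exact Or.inr ⟨k, (klr_psi_eq Q n k).symm⟩
      | mul a b ha hb => rw [map_mul]; exact mul_mem ha hb
      | add a b ha hb => rw [map_add]; exact add_mem ha hb)

/-- An element of the ambient algebra that acts by zero on all polynomials is zero. -/
theorem klr_eq_zero {u : KLR n Q.bar} (h : ∀ i f, klrRep Q n u ((klrModel 𝕜 n).single i f) = 0) :
    u = 0 := by
  refine (klrDiagram Q n).eq_zero_of_forall Set.univ (fun _ _ _ => trivial) ?_ fun i f _ => h i f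
  intro p hp i hpi
  have hee := fun i i' : Fin n → Fin 1 ⊕ Fin 1 => klr_e_mul_e Q n i' i
  -- Every dot is active and acts by the variable of a label. Different positions have different
  -- labels, so these variables are independent, and the constant `1` serves as test polynomial.
  refine mul_idem_eq_zero_of_algebraicIndependent (klrModel 𝕜 n) (klrRep Q n)
    (KLR.e n Q.bar) (Sum.elim (fun j : Fin n => KLR.x n Q.bar j) (Empty.elim : Empty → KLR n Q.bar))
    (diagGens_comm (fun i i' => ?_) (fun j i => ?_) (fun j l => ?_) (fun k => k.elim))
    (fun i i' => ?_) i (Sum.inl : Fin n → Fin n ⊕ Empty) ?_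
    (fun j => (MvPolynomial.X (lab i j) : MvPolynomial Var 𝕜)) ?_ ?_ (klrRep_e Q n i) one_ne_zero
    hp (hpi 1 trivial)
  · rw [hee]; by_cases h : i' = i
    · rw [h]
    · rw [if_neg h, if_neg h]
  · have := klr_mk_eq Q n (.x_e j i)
    rwa [map_mul, map_mul, ← klr_x_eq] at this
  · have := klr_mk_eq Q n (.x_x j l)
    rwa [map_mul, map_mul, ← klr_x_eq, ← klr_x_eq] at this
  · rw [hee]; by_cases h : i' = i
    · rw [h]
    · rw [if_neg h, if_neg h]
  · rintro (j | k)
    · exact Or.inl ⟨j, rfl⟩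
    · exact k.elim
  · exact (MvPolynomial.algebraicIndependent_X Var 𝕜).comp _ (lab_injective i)
  · intro j f
    rw [Sum.elim_inl, klrRep_x, (klrModel 𝕜 n).x_single, klrModel_X]
    rfl

end KLRFaithful

end KLRSub

namespace KLRSub

/-! ### Elementary symmetric functions of a sequence -/

section ElemSymm

open MvPolynomial

/-- The `d`-th elementary symmetric function of `f 0, …, f (w - 1)`. -/
def seqEsymm {R : Type*} [Semiring R] (f : ℕ → R) (w d : ℕ) : R :=
  (((List.range w).sublistsLen d).map fun T => (T.map f).prod).sum

variable {R : Type*} [CommRing R]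

theorem seqEsymm_eq_esymm (f : ℕ → R) (w d : ℕ) :
    seqEsymm f w d = (((List.range w).map f : List R) : Multiset R).esymm d := by
  rw [← Multiset.map_coe, Multiset.esymm, Multiset.powersetCard_map, Multiset.powersetCard_coe,
    seqEsymm]
  simp only [Multiset.map_coe, Multiset.sum_coe, List.map_map]
  congr 1

theorem seqEsymm_zero (f : ℕ → R) (w : ℕ) : seqEsymm f w 0 = 1 := by
  simp [seqEsymm]

theorem seqEsymm_of_lt (f : ℕ → R) {w d : ℕ} (h : w < d) : seqEsymm f w d = 0 := by
  rw [seqEsymm, List.sublistsLen_of_length_lt (by simpa using h)]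
  simp

theorem seqEsymm_eq_aeval {𝕜 : Type*} [CommRing 𝕜] [Algebra 𝕜 R] (f : ℕ → R) (w d : ℕ) :
    seqEsymm f w d = aeval (fun t : Fin w => f t) (esymm (Fin w) 𝕜 d) := by
  rw [aeval_esymm_eq_multiset_esymm, seqEsymm_eq_esymm]
  congr 1
  rw [Fin.univ_val_map, List.ofFn_eq_map, ← List.map_coe_finRange_eq_range, List.map_map]
  rfl

theorem prod_sub_eq_sum_seqEsymm (f : ℕ → R) (w : ℕ) (y : R) :
    ∏ t ∈ Finset.range w, (y - f t)
      = ∑ d ∈ Finset.range (w + 1), (-1) ^ d * (y ^ (w - d) * seqEsymm f w d) := by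
  have h := congrArg (Polynomial.eval y)
    (Multiset.prod_X_sub_X_eq_sum_esymm (((List.range w).map f : List R) : Multiset R))
  rw [Multiset.map_coe, Multiset.prod_coe, List.map_map, Multiset.coe_card, List.length_map,
    List.length_range, list_prod_map_range, Polynomial.eval_prod, Polynomial.eval_finsetSum] at h
  simp only [Function.comp_apply, Polynomial.eval_sub, Polynomial.eval_X, Polynomial.eval_C] at h
  rw [h]
  refine Finset.sum_congr rfl fun d _ => ?_
  rw [seqEsymm_eq_esymm]
  simp
  ring

variable {𝕜 : Type*} [Field 𝕜] {τ : Type*}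

theorem map_seqEsymm {S : Type*} [CommRing S] (φ : R →+* S) (f : ℕ → R) (w d : ℕ) :
    φ (seqEsymm f w d) = seqEsymm (fun t => φ (f t)) w d := by
  rw [seqEsymm, seqEsymm, map_list_sum, List.map_map]
  congr 1
  refine List.map_congr_left fun T _ => ?_
  rw [Function.comp_apply, map_list_prod, List.map_map]
  rfl

/-- An elementary symmetric function is symmetric. -/
theorem seqEsymm_comp_perm (f : ℕ → R) (w d : ℕ) (σ : Equiv.Perm (Fin w)) (g : ℕ → R)
    (hg : ∀ t : Fin w, g t = f (σ t)) : seqEsymm g w d = seqEsymm f w d := by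
  rw [seqEsymm_eq_aeval (𝕜 := ℤ), seqEsymm_eq_aeval (𝕜 := ℤ) f]
  conv_rhs => rw [← rename_esymm _ _ d σ, aeval_rename]
  congr 1
  congr 1
  funext t
  exact hg t

theorem swapVar_seqEsymm [DecidableEq τ] {z : ℕ → τ} (hz : Function.Injective z) {w t : ℕ}
    (h : t + 1 < w) (d : ℕ) :
    swapVar 𝕜 (z t) (z (t + 1)) (seqEsymm (fun u => X (z u)) w d)
      = seqEsymm (fun u => X (z u)) w d := by
  have := map_seqEsymm (swapVar 𝕜 (z t) (z (t + 1))).toRingHom (fun u => X (z u)) w d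
  refine Eq.trans this ?_
  refine seqEsymm_comp_perm _ w d (Equiv.swap ⟨t, by omega⟩ ⟨t + 1, h⟩) _ fun u => ?_
  have : ((Equiv.swap (⟨t, by omega⟩ : Fin w) ⟨t + 1, h⟩ u : Fin w) : ℕ)
      = Equiv.swap t (t + 1) (u : ℕ) := by
    simp only [Equiv.swap_apply_def, Fin.ext_iff]
    split_ifs <;> rfl
  rw [this]
  exact (swapVar_X _ _ _).trans (by rw [hz.swap_apply])

theorem swapVar_seqEsymm_of_ne [DecidableEq τ] {z : ℕ → τ} {u v : τ} (w d : ℕ)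
    (hu : ∀ t < w, z t ≠ u) (hv : ∀ t < w, z t ≠ v) :
    swapVar 𝕜 u v (seqEsymm (fun u => X (z u)) w d) = seqEsymm (fun u => X (z u)) w d := by
  have := map_seqEsymm (swapVar 𝕜 u v).toRingHom (fun u => X (z u)) w d
  refine Eq.trans this ?_
  rw [seqEsymm_eq_aeval (𝕜 := 𝕜), seqEsymm_eq_aeval (𝕜 := 𝕜)]
  congr 2
  funext t
  exact (swapVar_X _ _ _).trans
    (by rw [Equiv.swap_apply_of_ne_of_ne (hu t t.2) (hv t t.2)])

/-! #### Algebraic independence -/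

/-- The injectivity half of the fundamental theorem of symmetric polynomials. A general coefficient
ring is allowed so that the variables outside a block can serve as coefficients. -/
theorem algebraicIndependent_esymm (S : Type*) [CommRing S] (w : ℕ) :
    AlgebraicIndependent S fun d : Fin w => esymm (Fin w) S (d + 1) := by
  have h := esymmAlgHom_fin_injective (n := w) S (m := w) le_rfl
  rw [algebraicIndependent_iff_injective_aeval]
  intro a b hab
  apply h
  apply Subtype.ext
  simpa [esymmAlgHom_apply] using hab

/-- Replacing the variables of a block by their elementary symmetric functions gives an
algebraically independent family. -/
theorem algebraicIndependent_block_esymm {ι : Type*} {w : ℕ} (c : Fin w → ι)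
    (hc : Function.Injective c) (f : ι → MvPolynomial ι 𝕜)
    (h₁ : ∀ d, f (c d) = rename c (esymm (Fin w) 𝕜 (d + 1)))
    (h₂ : ∀ i, (∀ d, c d ≠ i) → f i = X i) : AlgebraicIndependent 𝕜 f := by
  classical
  let ρ : Type _ := {i : ι // ∀ d, c d ≠ i}
  have hx := MvPolynomial.algebraicIndependent_X ρ 𝕜
  have hy := algebraicIndependent_esymm (MvPolynomial ρ 𝕜) w
  -- Transitivity: the outside variables are independent over the field, and the symmetric functions
  -- are independent over the polynomial ring in the outside variables.
  have h := hx.sumElim_comp hy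
  let g : Fin w ⊕ ρ → ι := Sum.elim c Subtype.val
  have hg : Function.Bijective g := by
    constructor
    · rintro (a | a) (b | b) hab
      · exact congrArg _ (hc hab)
      · exact absurd hab (b.2 a)
      · exact absurd hab.symm (a.2 b)
      · exact congrArg _ (Subtype.ext hab)
    · intro i
      by_cases hi : ∀ d, c d ≠ i
      · exact ⟨Sum.inr ⟨i, hi⟩, rfl⟩
      · push Not at hi
        obtain ⟨d, hd⟩ := hi
        exact ⟨Sum.inl d, hd⟩
  have h' := h.map' (f := (rename g).comp (sumAlgEquiv 𝕜 (Fin w) ρ).symm.toAlgHom)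
    ((rename_injective g hg.1).comp (sumAlgEquiv 𝕜 (Fin w) ρ).symm.injective)
  rw [← algebraicIndependent_equiv (Equiv.ofBijective g hg)]
  convert h' using 1
  funext x
  rcases x with d | i
  · change f (c d) = rename g ((sumAlgEquiv 𝕜 (Fin w) ρ).symm (esymm (Fin w) _ (d + 1)))
    have : (sumAlgEquiv 𝕜 (Fin w) ρ).symm (esymm (Fin w) _ (d + 1))
        = rename Sum.inl (esymm (Fin w) 𝕜 (d + 1)) := by
      rw [AlgEquiv.symm_apply_eq]
      simp [esymm, map_sum, map_prod]
    rw [this, rename_rename, h₁]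
    rfl
  · change f i = rename g ((sumAlgEquiv 𝕜 (Fin w) ρ).symm (C (X i)))
    have : (sumAlgEquiv 𝕜 (Fin w) ρ).symm (C (X i)) = X (Sum.inr i) := by
      rw [AlgEquiv.symm_apply_eq]
      simp
    rw [this, rename_X, h₂ _ i.2]
    rfl

/-- The variables of finitely many blocks may be replaced by their elementary symmetric functions
at the same time. -/
theorem algebraicIndependent_blocks_esymm {β : Type*} {m : ℕ} (s : Fin m → ℕ) :
    AlgebraicIndependent 𝕜 (Sum.elim (fun b => X (Sum.inl b)) (fun p : (k : Fin m) × Fin (s k) =>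
      rename (fun t => Sum.inr ⟨p.1, t⟩) (esymm (Fin (s p.1)) 𝕜 (p.2 + 1))) :
        β ⊕ ((k : Fin m) × Fin (s k)) → MvPolynomial (β ⊕ ((k : Fin m) × Fin (s k))) 𝕜) := by
  classical
  let ι := β ⊕ ((k : Fin m) × Fin (s k))
  let f : Finset (Fin m) → ι → MvPolynomial ι 𝕜 := fun T =>
    Sum.elim (fun b => X (Sum.inl b)) (fun p => if p.1 ∈ T then
      rename (fun t => Sum.inr ⟨p.1, t⟩) (esymm (Fin (s p.1)) 𝕜 (p.2 + 1)) else X (Sum.inr p))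
  have key : ∀ T, AlgebraicIndependent 𝕜 (f T) := by
    intro T
    induction T using Finset.induction_on with
    | empty =>
      convert MvPolynomial.algebraicIndependent_X ι 𝕜 using 1
      funext x
      rcases x with b | p
      · rfl
      · simp [f]
    | insert k T hk ih =>
      have hf : AlgebraicIndependent 𝕜 (f {k}) := by
        refine algebraicIndependent_block_esymm (fun t : Fin (s k) => (Sum.inr ⟨k, t⟩ : ι))
          (fun a b h => by simpa using h) _ (fun d => by simp [f]) ?_
        rintro (b | ⟨k', t⟩) hi
        · rfl
        · have : k' ≠ k := by
            rintro rfl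
            exact hi t rfl
          simp [f, this]
      -- Substituting one independent family into another: the family that replaces only block `k`
      -- is evaluated at the family for `T`, where block `k` still consists of variables.
      convert ih.aeval_of_algebraicIndependent hf using 1
      funext x
      rcases x with b | ⟨k', t⟩
      · simp [f]
      · by_cases h : k' = k
        · subst h
          simp only [f, Sum.elim_inr, Finset.mem_insert_self, Finset.mem_singleton, if_true,
            aeval_rename]
          rw [rename_eq_aeval]
          congr 2
          funext t
          simp [hk]
        · simp [f, h]
  convert key Finset.univ using 1
  funext x
  rcases x with b | p
  · rfl
  · simp [f]

end ElemSymm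

end KLRSub

namespace KLRSub

/-! ### The polynomial representation of the redotted Webster algebra -/

section WModel

open PolyModel
open scoped Classical

/-- At most one of the exchanged entries is thick, so the order of the thick entries survives. -/
theorem isShuffle_swapSeq {A : Type} {m ℓ : ℕ} {ν : Fin ℓ → A} {i : Fin (m + ℓ) → A ⊕ Fin m}
    (hsh : IsShuffle ν i) (j : Fin (m + ℓ - 1))
    (h : (i (lo j)).isLeft = true ∨ (i (hi j)).isLeft = true) : IsShuffle ν (swapSeq j i) := by
  obtain ⟨π, hπ, hmono⟩ := hsh
  refine ⟨(Equiv.swap (lo j) (hi j)).trans π, fun p => hπ _, fun k k' hk => ?_⟩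
  have h₁ := hmono hk
  simp only [Equiv.symm_trans_apply, Equiv.symm_swap]
  have hr : ∀ p k, π.symm (Sum.inr k) = p → (i p).isLeft = false := by
    rintro p k rfl
    rw [hπ, Equiv.apply_symm_apply]
    rfl
  rw [swap_lt_swap_iff]
  · exact h₁
  · rintro ⟨a, b⟩
    rw [hr _ _ a, hr _ _ b] at h
    simp at h
  · rintro ⟨a, b⟩
    have h₁' : π.symm (Sum.inr k) < π.symm (Sum.inr k') := h₁
    rw [a, b, Fin.lt_def] at h₁'
    simp only [lo, hi] at h₁'
    omega

variable (𝕜 : Type*) [Field 𝕜] {m : ℕ} (s : Fin m → ℕ) (n : ℕ)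

/-- The number of dashed strands in the thick strands before the `k`-th one. -/
def dashedBefore (k : Fin m) : ℕ := ∑ k' ∈ Finset.univ.filter (· < k), s k'

/-- The variables of the dashed strands of the `k`-th thick strand. -/
def dashedVar (k : Fin m) (t : ℕ) : Var := (Sum.inr 0, dashedBefore s k + t)

theorem dashedVar_injective (k : Fin m) : Function.Injective (dashedVar s k) := fun a b h => by
  have := congrArg Prod.snd h
  simpa [dashedVar] using this

theorem dashedBefore_add_le {k k' : Fin m} (h : k < k') :
    dashedBefore s k + s k ≤ dashedBefore s k' := by
  have : Finset.univ.filter (· < k') ⊇ insert k (Finset.univ.filter (· < k)) := by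
    intro x hx
    simp only [Finset.mem_insert, Finset.mem_filter, Finset.mem_univ, true_and] at hx ⊢
    rcases hx with rfl | hx
    · exact h
    · exact hx.trans h
  have h' := Finset.sum_le_sum_of_subset (f := s) this
  rw [Finset.sum_insert (by simp)] at h'
  rw [dashedBefore, dashedBefore]
  omega

theorem dashedVar_ne {k k' : Fin m} (h : k ≠ k') {t t' : ℕ} (ht : t < s k) (ht' : t' < s k') :
    dashedVar s k t ≠ dashedVar s k' t' := by
  intro H
  have H' : dashedBefore s k + t = dashedBefore s k' + t' := congrArg Prod.snd H
  rcases lt_or_gt_of_ne h with h | h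
  · have := dashedBefore_add_le s h; omega
  · have := dashedBefore_add_le s h; omega

/-- The variable of a black strand; the variables of the red strands play no role. -/
def wVar (ℓ : (Fin 1 ⊕ Fin m) × ℕ) : Var := (Sum.map id (fun _ => 0) ℓ.1, ℓ.2)

/-- The polynomial by which a crossing acts, for the labels of the left and the right strand of
the result. -/
noncomputable def wQ (a b : (Fin 1 ⊕ Fin m) × ℕ) : MvPolynomial Var 𝕜 :=
  match a.1, b.1 with
  | Sum.inl _, Sum.inr k =>
      ∏ t ∈ Finset.range (s k), (MvPolynomial.X (wVar a) - MvPolynomial.X (dashedVar s k t))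
  | _, _ => 1

theorem wVar_ne_dashedVar {a : (Fin 1 ⊕ Fin m) × ℕ} (ha : a.1.isLeft = true) (k : Fin m) (t : ℕ) :
    dashedVar s k t ≠ wVar a := by
  obtain ⟨a | a, r⟩ := a
  · simp [wVar, dashedVar]
  · simp at ha

theorem wVar_inj {a b : (Fin 1 ⊕ Fin m) × ℕ} (ha : a.1.isLeft = true) (hb : b.1.isLeft = true)
    (h : wVar a = wVar b) : a = b := by
  obtain ⟨a | a, r⟩ := a <;> obtain ⟨b | b, t⟩ := b
  · obtain rfl := Subsingleton.elim a b
    simpa [wVar] using h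
  all_goals simp at ha hb

theorem swapVar_wVar_dashed {ℓ : (Fin 1 ⊕ Fin m) × ℕ} (h : ℓ.1.isLeft = true) (k : Fin m) (t : ℕ) :
    swapVar 𝕜 (wVar ℓ) (wVar (up ℓ)) (MvPolynomial.X (dashedVar s k t))
      = MvPolynomial.X (dashedVar s k t) := by
  rw [swapVar_X, Equiv.swap_apply_of_ne_of_ne (wVar_ne_dashedVar s h k t)
    (wVar_ne_dashedVar s (a := up ℓ) h k t)]

theorem swap_up_fst {C : Type} [DecidableEq C] (ℓ a : C × ℕ) :
    (Equiv.swap ℓ (up ℓ) a).1 = a.1 := by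
  rw [Equiv.swap_apply_def]
  split_ifs with h₁ h₂
  · rw [h₁]; rfl
  · rw [h₂]; rfl
  · rfl

theorem swap_wVar {ℓ a : (Fin 1 ⊕ Fin m) × ℕ} (h : ℓ.1.isLeft = true) (ha : a.1.isLeft = true) :
    Equiv.swap (wVar ℓ) (wVar (up ℓ)) (wVar a) = wVar (Equiv.swap ℓ (up ℓ) a) := by
  by_cases h₁ : a = ℓ
  · rw [h₁, Equiv.swap_apply_left, Equiv.swap_apply_left]
  by_cases h₂ : a = up ℓ
  · rw [h₂, Equiv.swap_apply_right, Equiv.swap_apply_right]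
  rw [Equiv.swap_apply_of_ne_of_ne h₁ h₂, Equiv.swap_apply_of_ne_of_ne]
  · exact fun H => h₁ (wVar_inj ha h H)
  · exact fun H => h₂ (wVar_inj ha (show (up ℓ).1.isLeft = true from h) H)

theorem eq_of_isLeft {a b : Fin 1 ⊕ Fin m} (ha : a.isLeft = true) (hb : b.isLeft = true) :
    a = b := by
  rcases a with a | a <;> rcases b with b | b
  · rw [Subsingleton.elim a b]
  all_goals simp at ha hb

theorem isLeft_of_repeated (i : WSeq m n) {p p' : Fin (m + n)} (h : p ≠ p') (heq : i.1 p = i.1 p') :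
    (i.1 p).isLeft = true := by
  obtain ⟨π, hπ, -⟩ := i.2
  rw [hπ, hπ] at heq
  rw [hπ]
  rcases hp : π p with a | k
  · rfl
  · rcases hp' : π p' with a' | k'
    · rw [hp, hp'] at heq; simp at heq
    · rw [hp, hp'] at heq
      simp only [Sum.map_inr, id_eq, Sum.inr.injEq] at heq
      subst heq
      exact absurd (π.injective (hp.trans hp'.symm)) h

/-- The polynomial representation of the redotted Webster algebra. -/
noncomputable def wModel : PolyModel 𝕜 (Fin 1 ⊕ Fin m) Var (WSeq m n) (m + n) where
  w := Subtype.val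
  w_inj := Subtype.val_injective
  B := fun c => c.isLeft = true
  v := wVar
  v_inj := fun _ _ => wVar_inj
  rep := fun i _ _ h he => isLeft_of_repeated n i h he
  ex := fun i j h => ⟨⟨swapSeq j i.1, isShuffle_swapSeq i.2 j h⟩, rfl⟩
  q := wQ 𝕜 s
  q_ne := fun a b _ => by
    obtain ⟨a | a, r⟩ := a <;> obtain ⟨b | b, t⟩ := b <;> simp only [wQ]
    any_goals exact one_ne_zero
    exact Finset.prod_ne_zero_iff.2 fun t _ =>
      X_sub_X_ne_zero fun H => wVar_ne_dashedVar s (a := (Sum.inl a, r)) rfl b t H.symm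
  q_swap := fun ℓ a b h _ => by
    have ha := swap_up_fst ℓ a
    have hb := swap_up_fst ℓ b
    simp only [wQ, ha, hb]
    split
    · rename_i k h₁ h₂
      rw [map_prod]
      refine Finset.prod_congr rfl fun t _ => ?_
      rw [map_sub, swapVar_wVar_dashed 𝕜 s h, swapVar_X, swap_wVar h (by rw [h₁]; rfl)]
    · rw [map_one]

variable {𝕜} {n}

/-- The central elements: elementary symmetric functions of the dashed strands of a thick strand. -/
noncomputable def wE (k : Fin m) (d : ℕ) : Module.End 𝕜 (wModel 𝕜 s n).Space :=
  (wModel 𝕜 s n).diag fun _ => seqEsymm (fun t => MvPolynomial.X (dashedVar s k t)) (s k) d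

@[simp] theorem wE_single (k : Fin m) (d : ℕ) (i : WSeq m n) (f : MvPolynomial Var 𝕜) :
    wE s k d ((wModel 𝕜 s n).single i f) = (wModel 𝕜 s n).single i
      (seqEsymm (fun t => MvPolynomial.X (dashedVar s k t)) (s k) d * f) := by
  rw [wE, diag_single]

/-- The action of the generators. -/
noncomputable def wGen : WGen m n → Module.End 𝕜 (wModel 𝕜 s n).Space
  | .e i => (wModel 𝕜 s n).e i
  | .x j => (wModel 𝕜 s n).x j
  | .E k d => wE s k d
  | .psi k => (wModel 𝕜 s n).psi k

@[simp] theorem lift_w_e (i) : FreeAlgebra.lift 𝕜 (wGen (𝕜 := 𝕜) (n := n) s) (WFree.e 𝕜 m n i)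
    = (wModel 𝕜 s n).e i := FreeAlgebra.lift_ι_apply _ _

@[simp] theorem lift_w_x (i) : FreeAlgebra.lift 𝕜 (wGen (𝕜 := 𝕜) (n := n) s) (WFree.x 𝕜 m n i)
    = (wModel 𝕜 s n).x i := FreeAlgebra.lift_ι_apply _ _

@[simp] theorem lift_w_E (k d) : FreeAlgebra.lift 𝕜 (wGen (𝕜 := 𝕜) (n := n) s) (WFree.E 𝕜 m n k d)
    = wE s k d := FreeAlgebra.lift_ι_apply _ _

@[simp] theorem lift_w_psi (i) : FreeAlgebra.lift 𝕜 (wGen (𝕜 := 𝕜) (n := n) s) (WFree.psi 𝕜 m n i)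
    = (wModel 𝕜 s n).psi i := FreeAlgebra.lift_ι_apply _ _

theorem wModel_s_wE {ℓ : (Fin 1 ⊕ Fin m) × ℕ} (h : ℓ.1.isLeft = true) (k : Fin m) (w d : ℕ) :
    (wModel 𝕜 s n).s ℓ (seqEsymm (fun t => MvPolynomial.X (dashedVar s k t)) w d)
      = seqEsymm (fun t => MvPolynomial.X (dashedVar s k t)) w d :=
  swapVar_seqEsymm_of_ne w d (fun t _ => wVar_ne_dashedVar s h k t)
    (fun t _ => wVar_ne_dashedVar s (a := up ℓ) h k t)

theorem wModel_x_pow_single (p : Fin (m + n)) (a : ℕ) (i : WSeq m n) (f : MvPolynomial Var 𝕜) :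
    ((wModel 𝕜 s n).x p ^ a) ((wModel 𝕜 s n).single i f)
      = (wModel 𝕜 s n).single i ((wModel 𝕜 s n).X (lab i.1 p) ^ a * f) := by
  induction a with
  | zero => simp
  | succ a ih =>
    rw [pow_succ', Module.End.mul_apply, ih, x_single, pow_succ', mul_assoc]
    rfl

/-- The difference quotient of the polynomial of a crossing of a black and a red strand. -/
theorem w_cubic {ℓ : (Fin 1 ⊕ Fin m) × ℕ} (h : ℓ.1.isLeft = true) (k : Fin m)
    (f : MvPolynomial Var 𝕜) :
    (∏ t ∈ Finset.range (s k), ((wModel 𝕜 s n).X ℓ - MvPolynomial.X (dashedVar s k t)))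
        * (wModel 𝕜 s n).d ℓ f
      - (wModel 𝕜 s n).d ℓ ((∏ t ∈ Finset.range (s k),
          ((wModel 𝕜 s n).X (up ℓ) - MvPolynomial.X (dashedVar s k t))) * f)
      = ∑ c ∈ Finset.range (s k), ∑ a ∈ Finset.range (s k - c),
          (-1) ^ c * ((wModel 𝕜 s n).X ℓ ^ a
            * (seqEsymm (fun t => MvPolynomial.X (dashedVar s k t)) (s k) c
            * ((wModel 𝕜 s n).X (up ℓ) ^ (s k - 1 - c - a) * f))) := by
  set M := wModel 𝕜 s n with hM
  set E := fun c => seqEsymm (fun t => (MvPolynomial.X (dashedVar s k t) : MvPolynomial Var 𝕜)) (s k) c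
    with hE
  have hne : M.X ℓ - M.X (up ℓ) ≠ 0 := by
    rw [M.X_eq h, M.X_eq (show (up ℓ).1.isLeft = true from h)]
    exact X_sub_X_ne_zero (M.v_up_ne h)
  rw [sub_eq_iff_eq_add', ← sub_eq_iff_eq_add]
  symm
  rw [M.d_eq_iff h]
  have hd := (M.d_eq_iff h f _).1 rfl
  have hs : M.s ℓ (∏ t ∈ Finset.range (s k), (M.X (up ℓ) - MvPolynomial.X (dashedVar s k t)))
      = ∏ t ∈ Finset.range (s k), (M.X ℓ - MvPolynomial.X (dashedVar s k t)) := by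
    rw [map_prod]
    refine Finset.prod_congr rfl fun t _ => ?_
    rw [map_sub, M.s_X h, Equiv.swap_apply_right]
    congr 1
    exact swapVar_wVar_dashed 𝕜 s h k t
  have hP := prod_sub_eq_sum_seqEsymm
    (fun t => (MvPolynomial.X (dashedVar s k t) : MvPolynomial Var 𝕜)) (s k)
  -- For each `c` the inner sum is a geometric sum, telescoping to a difference of powers. The term
  -- with `c = s k` contains no power of the dot and cancels in the difference.
  have key : (M.X ℓ - M.X (up ℓ)) * ∑ c ∈ Finset.range (s k), ∑ a ∈ Finset.range (s k - c),
          (-1) ^ c * (M.X ℓ ^ a * (E c * (M.X (up ℓ) ^ (s k - 1 - c - a) * f)))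
      = ((∏ t ∈ Finset.range (s k), (M.X ℓ - MvPolynomial.X (dashedVar s k t)))
        - ∏ t ∈ Finset.range (s k), (M.X (up ℓ) - MvPolynomial.X (dashedVar s k t))) * f := by
    rw [hP, hP, ← Finset.sum_sub_distrib, Finset.sum_range_succ, Nat.sub_self, pow_zero, pow_zero,
      sub_self, add_zero, Finset.sum_mul, Finset.mul_sum]
    refine Finset.sum_congr rfl fun c hc => ?_
    have hg := (Commute.all (M.X ℓ) (M.X (up ℓ))).mul_geom_sum₂ (s k - c)
    have : ∑ a ∈ Finset.range (s k - c),
          (-1) ^ c * (M.X ℓ ^ a * (E c * (M.X (up ℓ) ^ (s k - 1 - c - a) * f)))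
        = (-1) ^ c * E c * f
          * ∑ a ∈ Finset.range (s k - c), M.X ℓ ^ a * M.X (up ℓ) ^ (s k - c - 1 - a) := by
      rw [Finset.mul_sum]
      refine Finset.sum_congr rfl fun a ha => ?_
      rw [show s k - 1 - c - a = s k - c - 1 - a by omega]
      ring
    rw [this]
    linear_combination (-1) ^ c * E c * f * hg
  rw [map_mul, hs]
  linear_combination key + (∏ t ∈ Finset.range (s k), (M.X ℓ - MvPolynomial.X (dashedVar s k t))) * hd

end WModel

end KLRSub

namespace KLRSub

/-! ### The defining relations of the Webster algebra on polynomials -/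

section WRep

open PolyModel
open scoped Classical

variable {𝕜 : Type*} [Field 𝕜] {m : ℕ} (s : Fin m → ℕ) {n : ℕ}

theorem w_eq_iff_isLeft (i : WSeq m n) (j : Fin (m + n - 1)) :
    i.1 (lo j) = i.1 (hi j) ↔ (i.1 (lo j)).isLeft = true ∧ (i.1 (hi j)).isLeft = true :=
  ⟨fun h => by
    have := isLeft_of_repeated n i (lo_ne_hi j) h
    exact ⟨this, h ▸ this⟩, fun h => eq_of_isLeft h.1 h.2⟩

theorem wModel_X_of_red {ℓ : (Fin 1 ⊕ Fin m) × ℕ} (h : ℓ.1.isLeft = false) :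
    (wModel 𝕜 s n).X ℓ = 0 := if_neg (by simp [wModel, h])

theorem wModel_X_of_black {ℓ : (Fin 1 ⊕ Fin m) × ℕ} (h : ℓ.1.isLeft = true) :
    (wModel 𝕜 s n).X ℓ = MvPolynomial.X (wVar ℓ) := if_pos h

theorem lift_neg_one_pow (d : ℕ) (x : FreeAlgebra 𝕜 (WGen m n)) (v : (wModel 𝕜 s n).Space) :
    FreeAlgebra.lift 𝕜 (wGen (𝕜 := 𝕜) (n := n) s) ((-1) ^ d * x) v
      = (-1 : MvPolynomial Var 𝕜) ^ d • FreeAlgebra.lift 𝕜 (wGen (𝕜 := 𝕜) (n := n) s) x v := by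
  rcases neg_one_pow_eq_or (FreeAlgebra 𝕜 (WGen m n)) d with h | h <;>
  rcases Nat.even_or_odd d with h' | h' <;> simp [h'.neg_one_pow]

theorem smul_single (a : MvPolynomial Var 𝕜) (i : WSeq m n) (f : MvPolynomial Var 𝕜) :
    a • (wModel 𝕜 s n).single i f = (wModel 𝕜 s n).single i (a * f) := by
  funext i'
  rw [Pi.smul_apply, smul_eq_mul, single_apply, single_apply]
  split_ifs
  · rfl
  · simp

/-- Vieta's formula: the alternating sum with coefficients `E_{k,d}` is the polynomial whose roots
are the dashed variables of the block, evaluated at the dot. -/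
theorem lift_wQuad (p : Fin (m + n)) (k : Fin m) (i : WSeq m n) (f : MvPolynomial Var 𝕜) :
    FreeAlgebra.lift 𝕜 (wGen (𝕜 := 𝕜) (n := n) s) (∑ d ∈ Finset.range (s k + 1),
      (-1) ^ d * (WFree.x 𝕜 m n p ^ (s k - d) * WFree.E 𝕜 m n k d)) ((wModel 𝕜 s n).single i f)
      = (wModel 𝕜 s n).single i ((∏ t ∈ Finset.range (s k),
          ((wModel 𝕜 s n).X (lab i.1 p) - MvPolynomial.X (dashedVar s k t))) * f) := by
  rw [prod_sub_eq_sum_seqEsymm, Finset.sum_mul, map_sum, map_sum, LinearMap.sum_apply]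
  refine Finset.sum_congr rfl fun d _ => ?_
  rw [lift_neg_one_pow, map_mul, map_pow, lift_w_x, lift_w_E, Module.End.mul_apply, wE_single,
    wModel_x_pow_single, smul_single]
  congr 1
  ring

theorem w_quad (j : Fin (m + n - 1)) (i : WSeq m n) (f : MvPolynomial Var 𝕜) :
    (wModel 𝕜 s n).psi j ((wModel 𝕜 s n).psi j ((wModel 𝕜 s n).single i f))
      = FreeAlgebra.lift 𝕜 (wGen (𝕜 := 𝕜) (n := n) s) (wQuad s (i.1 (lo j)) (i.1 (hi j)) j)
        ((wModel 𝕜 s n).single i f) := by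
  set M := wModel 𝕜 s n with hM
  by_cases h : i.1 (lo j) = i.1 (hi j)
  · rw [M.psi_psi_same h]
    obtain ⟨h₁, h₂⟩ := (w_eq_iff_isLeft i j).1 h
    obtain ⟨a, ha⟩ := Sum.isLeft_iff.1 h₁
    obtain ⟨b, hb⟩ := Sum.isLeft_iff.1 h₂
    simp [ha, hb, wQuad]
  · rcases ha : i.1 (lo j) with a | k <;> rcases hb : i.1 (hi j) with b | k'
    · exact absurd (by rw [ha, hb, Subsingleton.elim a b]) h
    · rw [M.psi_psi_swap h (Or.inl (by rw [show M.w i = i.1 from rfl, ha]; rfl)), wQuad, lift_wQuad]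
      congr 2
      have e₁ : M.q (lab (M.w i) (lo j)) (lab (M.w i) (hi j))
          = ∏ t ∈ Finset.range (s k'), (M.X (lab i.1 (lo j)) - MvPolynomial.X (dashedVar s k' t)) := by
        change wQ 𝕜 s (lab i.1 (lo j)) (lab i.1 (hi j)) = _
        rw [hM, wModel_X_of_black s (by rw [lab_fst, ha]; rfl)]
        simp only [wQ, lab_fst, ha, hb]
      have e₂ : M.q (lab (M.w i) (hi j)) (lab (M.w i) (lo j)) = 1 := by
        change wQ 𝕜 s (lab i.1 (hi j)) (lab i.1 (lo j)) = _
        simp only [wQ, lab_fst, ha, hb]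
      rw [e₁, e₂, mul_one]
    · rw [M.psi_psi_swap h (Or.inr (by rw [show M.w i = i.1 from rfl, hb]; rfl)), wQuad, lift_wQuad]
      congr 2
      have e₁ : M.q (lab (M.w i) (hi j)) (lab (M.w i) (lo j))
          = ∏ t ∈ Finset.range (s k), (M.X (lab i.1 (hi j)) - MvPolynomial.X (dashedVar s k t)) := by
        change wQ 𝕜 s (lab i.1 (hi j)) (lab i.1 (lo j)) = _
        rw [hM, wModel_X_of_black s (by rw [lab_fst, hb]; rfl)]
        simp only [wQ, lab_fst, ha, hb]
      have e₂ : M.q (lab (M.w i) (lo j)) (lab (M.w i) (hi j)) = 1 := by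
        change wQ 𝕜 s (lab i.1 (lo j)) (lab i.1 (hi j)) = _
        simp only [wQ, lab_fst, ha, hb]
      rw [e₁, e₂, one_mul]
    · rw [M.psi_psi_zero h]
      · simp [wQuad]
      · rw [show M.w i = i.1 from rfl, ha]; simp [hM, wModel]
      · rw [show M.w i = i.1 from rfl, hb]; simp [hM, wModel]

theorem wCubic_eq_zero {p q r : Fin 1 ⊕ Fin m} (j l : Fin (m + n - 1))
    (h : ¬ (p.isLeft = true ∧ q.isLeft = false ∧ r.isLeft = true)) :
    wCubic (𝕜 := 𝕜) s p q r j l = 0 := by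
  rcases p with p | p <;> rcases q with q | q <;> rcases r with r | r <;> simp_all [wCubic]

/-- Two entries coincide only if both are black, so the general cubic lemmas cover every pattern.
The two sides differ only for black, red, black, where the difference quotient of the crossing
polynomial, computed in `w_cubic`, appears. -/
theorem w_cubic_rel (j l : Fin (m + n - 1)) (h : (l : ℕ) = j + 1) (i : WSeq m n)
    (f : MvPolynomial Var 𝕜) :
    (wModel 𝕜 s n).psi j ((wModel 𝕜 s n).psi l ((wModel 𝕜 s n).psi j ((wModel 𝕜 s n).single i f)))
      - (wModel 𝕜 s n).psi l ((wModel 𝕜 s n).psi j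
        ((wModel 𝕜 s n).psi l ((wModel 𝕜 s n).single i f)))
      = FreeAlgebra.lift 𝕜 (wGen (𝕜 := 𝕜) (n := n) s)
        (wCubic s (i.1 (lo j)) (i.1 (lo l)) (i.1 (hi l)) j l) ((wModel 𝕜 s n).single i f) := by
  set M := wModel 𝕜 s n with hM
  obtain ⟨e₁, e₂, e₃, e₄⟩ := near_eq h
  have hred : ∀ p p', p ≠ p' → i.1 p = i.1 p' → (i.1 p).isLeft = true := fun p p' hp he =>
    isLeft_of_repeated n i hp he
  by_cases h₁ : i.1 (lo j) = i.1 (lo l)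
  · have hb := hred _ _ e₂ h₁
    rw [wCubic_eq_zero, map_zero, LinearMap.zero_apply]
    · by_cases h₂ : i.1 (lo l) = i.1 (hi l)
      · rw [M.cubic_same h h₁ h₂, sub_self]
      · rw [M.cubic_left_pair h h₁ h₂, sub_self]
    · rw [← h₁, hb]; simp
  by_cases h₂ : i.1 (lo l) = i.1 (hi l)
  · have hb := hred _ _ e₄ h₂
    rw [wCubic_eq_zero, map_zero, LinearMap.zero_apply]
    · rw [M.cubic_right_pair h h₁ h₂, sub_self]
    · rw [hb]; simp
  by_cases h₃ : i.1 (lo j) = i.1 (hi l)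
  · have hb := hred _ _ e₃ h₃
    have hb' : (i.1 (hi l)).isLeft = true := h₃ ▸ hb
    obtain ⟨hu, hc⟩ := M.cubic_outer_pair h h₁ h₃ f
    have hu' : lab i.1 (hi l) = up (lab i.1 (lo j)) := hu
    rw [hc]
    rcases hk : i.1 (lo l) with b | k
    · exact absurd (eq_of_isLeft hb (by rw [hk]; rfl)) h₁
    obtain ⟨a, ha⟩ := Sum.isLeft_iff.1 hb
    obtain ⟨b, hb⟩ := Sum.isLeft_iff.1 hb'
    rw [ha, hb, wCubic]
    change M.single i (wQ 𝕜 s (lab i.1 (lo j)) (lab i.1 (lo l)) * M.d (lab i.1 (lo j))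
      (wQ 𝕜 s (lab i.1 (lo l)) (lab i.1 (lo j)) * f) - wQ 𝕜 s (lab i.1 (lo l)) (lab i.1 (hi l))
      * M.d (lab i.1 (lo j)) (wQ 𝕜 s (lab i.1 (hi l)) (lab i.1 (lo l)) * f)) = _
    have q₁ : wQ 𝕜 s (lab i.1 (lo j)) (lab i.1 (lo l)) = ∏ t ∈ Finset.range (s k),
        (M.X (lab i.1 (lo j)) - MvPolynomial.X (dashedVar s k t)) := by
      rw [hM, wModel_X_of_black s (by rw [lab_fst, ha]; rfl)]
      simp only [wQ, lab_fst, ha, hk]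
    have q₂ : wQ 𝕜 s (lab i.1 (lo l)) (lab i.1 (lo j)) = 1 := by simp only [wQ, lab_fst, ha, hk]
    have q₃ : wQ 𝕜 s (lab i.1 (lo l)) (lab i.1 (hi l)) = 1 := by simp only [wQ, lab_fst, hb, hk]
    have q₄ : wQ 𝕜 s (lab i.1 (hi l)) (lab i.1 (lo l)) = ∏ t ∈ Finset.range (s k),
        (M.X (up (lab i.1 (lo j))) - MvPolynomial.X (dashedVar s k t)) := by
      rw [← hu', hM, wModel_X_of_black s (by rw [lab_fst, hb]; rfl)]
      simp only [wQ, lab_fst, hb, hk]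
    rw [q₁, q₂, q₃, q₄, one_mul, one_mul, w_cubic s (by rw [lab_fst, ha]; rfl), map_sum, map_sum,
      LinearMap.sum_apply]
    refine Finset.sum_congr rfl fun c _ => ?_
    rw [map_sum, map_sum, LinearMap.sum_apply]
    refine Finset.sum_congr rfl fun a _ => ?_
    rw [lift_neg_one_pow, map_mul (FreeAlgebra.lift 𝕜 (wGen s)),
      map_mul (FreeAlgebra.lift 𝕜 (wGen s)), map_pow (FreeAlgebra.lift 𝕜 (wGen s)),
      map_pow (FreeAlgebra.lift 𝕜 (wGen s)), lift_w_x, lift_w_E, lift_w_x,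
      Module.End.mul_apply, Module.End.mul_apply, wModel_x_pow_single, wE_single,
      wModel_x_pow_single, smul_single, hu']
  · obtain ⟨z₁, z₂⟩ := M.cubic_distinct h h₁ h₃ h₂ (fun a b => eq_of_isLeft) f
    rw [z₁, z₂, sub_self, wCubic_eq_zero, map_zero, LinearMap.zero_apply]
    rintro ⟨a, -, b⟩
    exact h₃ (eq_of_isLeft a b)

theorem w_rel {a b : FreeAlgebra 𝕜 (WGen m n)} (h : WRel s a b) :
    FreeAlgebra.lift 𝕜 (wGen (𝕜 := 𝕜) (n := n) s) a
      = FreeAlgebra.lift 𝕜 (wGen (𝕜 := 𝕜) (n := n) s) b := by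
  set M := wModel 𝕜 s n with hM
  have mul_e : ∀ {T T' : Module.End 𝕜 M.Space} (i), (∀ f, T (M.single i f) = T' (M.single i f)) →
      T * M.e i = T' * M.e i := fun i hT => LinearMap.ext fun f => by
    rw [Module.End.mul_apply, Module.End.mul_apply, M.e_apply, hT]
  -- Crossings exchange only black variables, while `E_{k,d}` acts by a polynomial in dashed ones.
  have central : ∀ k d, ∀ g : WGen m n, wE s k d * wGen (𝕜 := 𝕜) s g = wGen s g * wE s k d := by
    rintro k d (i | j | ⟨k', d'⟩ | j)
    · exact M.diag_comm _ _
    · exact M.diag_comm _ _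
    · exact M.diag_comm _ _
    · exact (M.psi_mul_diag_const (fun ℓ hℓ => wModel_s_wE s hℓ k _ d) j).symm
  induction h with
  | sum_e =>
    simp only [map_sum, map_one, lift_w_e]
    exact M.sum_e
  | e_e i j =>
    rw [apply_ite (FreeAlgebra.lift 𝕜 (wGen (𝕜 := 𝕜) (n := n) s))]
    simp only [map_mul, map_zero, lift_w_e]
    exact M.e_mul_e i j
  | x_e j i =>
    simp only [map_mul, lift_w_e, lift_w_x]
    exact M.diag_comm _ _
  | x_red j i h =>
    simp only [map_mul, lift_w_e, lift_w_x, map_zero]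
    rw [← zero_mul (M.e i)]
    apply mul_e
    intro f
    rw [x_single, wModel_X_of_red s h, zero_mul, map_zero]
    rfl
  | E_zero k =>
    rw [lift_w_E, map_one]
    refine ext_single fun i f => ?_
    rw [wE_single, seqEsymm_zero, one_mul]
    rfl
  | E_large k d h =>
    rw [lift_w_E, map_zero]
    refine ext_single fun i f => ?_
    rw [wE_single, seqEsymm_of_lt _ h, zero_mul, map_zero]
    rfl
  | E_comm k d g =>
    rw [map_mul, map_mul, lift_w_E, FreeAlgebra.lift_ι_apply]
    exact central k d g
  | psi_e j i i' h =>
    simp only [map_mul, lift_w_e, lift_w_psi]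
    exact M.psi_mul_e h
  | psi_red_red j i h₁ h₂ =>
    simp only [map_mul, lift_w_e, lift_w_psi, map_zero]
    rw [← zero_mul (M.e i)]
    apply mul_e
    intro f
    rw [M.psi_zero]
    · rfl
    · intro H
      have := (w_eq_iff_isLeft i j).1 H
      rw [h₁] at this
      simp at this
    · simp [hM, wModel, h₁]
    · simp [hM, wModel, h₂]
  | x_x j l =>
    simp only [map_mul, lift_w_x]
    exact M.diag_comm _ _
  | psi_x k l h₁ h₂ =>
    simp only [map_mul, lift_w_x, lift_w_psi]
    exact M.psi_mul_x h₁ h₂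
  | psi_psi j k h =>
    simp only [map_mul, lift_w_psi]
    exact M.psi_psi_far h
  | slide₁ k i =>
    have : (if (i.1 (lo k)).isLeft = true ∧ (i.1 (hi k)).isLeft = true then WFree.e 𝕜 m n i
        else 0) = (if (i.1 (lo k)).isLeft = true ∧ (i.1 (hi k)).isLeft = true then 1 else 0)
          * WFree.e 𝕜 m n i := by
      split_ifs <;> simp
    rw [this, ← sub_mul, map_mul, map_mul, lift_w_e]
    apply mul_e
    intro f
    have := M.slide_left k i f
    rw [apply_ite (FreeAlgebra.lift 𝕜 (wGen (𝕜 := 𝕜) s))]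
    simp only [map_sub, map_mul, lift_w_x, lift_w_psi, LinearMap.sub_apply,
      Module.End.mul_apply, map_one, map_zero]
    rw [this]
    simp only [show M.w i = i.1 from rfl, w_eq_iff_isLeft]
    split_ifs <;> rfl
  | slide₂ k i =>
    have : (if (i.1 (lo k)).isLeft = true ∧ (i.1 (hi k)).isLeft = true then WFree.e 𝕜 m n i
        else 0) = (if (i.1 (lo k)).isLeft = true ∧ (i.1 (hi k)).isLeft = true then 1 else 0)
          * WFree.e 𝕜 m n i := by
      split_ifs <;> simp
    rw [this, ← sub_mul, map_mul, map_mul, lift_w_e]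
    apply mul_e
    intro f
    have := M.slide_right k i f
    rw [apply_ite (FreeAlgebra.lift 𝕜 (wGen (𝕜 := 𝕜) s))]
    simp only [map_sub, map_mul, lift_w_x, lift_w_psi, LinearMap.sub_apply,
      Module.End.mul_apply, map_one, map_zero]
    rw [this]
    simp only [show M.w i = i.1 from rfl, w_eq_iff_isLeft]
    split_ifs <;> rfl
  | quad k i =>
    rw [map_mul, map_mul, map_mul, lift_w_e, lift_w_psi]
    apply mul_e
    intro f
    exact w_quad s k i f
  | cubic k l h i =>
    rw [map_mul, map_mul, lift_w_e]
    apply mul_e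
    intro f
    rw [← w_cubic_rel s k l h i f]
    simp only [map_sub, map_mul, lift_w_psi, LinearMap.sub_apply, Module.End.mul_apply]
    rfl

variable (𝕜 n) in
/-- The polynomial representation. -/
noncomputable def wRep : W 𝕜 s n →ₐ[𝕜] Module.End 𝕜 (wModel 𝕜 s n).Space :=
  RingQuot.liftAlgHom 𝕜 ⟨FreeAlgebra.lift 𝕜 (wGen s), fun _ _ h => w_rel s h⟩

theorem wRep_gen (g : WGen m n) : wRep 𝕜 s n (W.gen 𝕜 s n g) = wGen s g :=
  (RingQuot.liftAlgHom_mkAlgHom_apply ..).trans (FreeAlgebra.lift_ι_apply _ _)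

end WRep

end KLRSub

namespace KLRSub

/-! ### The redotted Webster algebra acts faithfully -/

section WFaithful

open PolyModel
open scoped Classical

variable {𝕜 : Type*} [Field 𝕜] {m : ℕ} (s : Fin m → ℕ) {n : ℕ}

/-- The polynomials in the image of the nilHecke idempotents of all thick strands. -/
def thickInvariants (𝕜 : Type*) [Field 𝕜] {m : ℕ} (s : Fin m → ℕ) : Set (MvPolynomial Var 𝕜) :=
  {h | ∀ k, nilOp 𝕜 (dashedVar s k) (s k) h = h}

theorem mul_mem_thickInvariants {g h : MvPolynomial Var 𝕜}
    (hg : ∀ k t, t + 1 < s k → swapVar 𝕜 (dashedVar s k t) (dashedVar s k (t + 1)) g = g)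
    (hh : h ∈ thickInvariants 𝕜 s) : g * h ∈ thickInvariants 𝕜 s := fun k => by
  rw [nilOp_mul (dashedVar_injective s k) _ (hg k), hh k]

theorem X_mul_mem_thickInvariants {h : MvPolynomial Var 𝕜} (hh : h ∈ thickInvariants 𝕜 s)
    (ℓ : (Fin 1 ⊕ Fin m) × ℕ) : (wModel 𝕜 s n).X ℓ * h ∈ thickInvariants 𝕜 s := by
  rcases hl : ℓ.1.isLeft with _ | _
  · intro k
    rw [wModel_X_of_red s hl, zero_mul, map_zero]
  · refine mul_mem_thickInvariants s (fun k t _ => ?_) hh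
    rw [wModel_X_of_black s hl, swapVar_X, Equiv.swap_apply_of_ne_of_ne]
    · exact (wVar_ne_dashedVar s hl k _).symm
    · exact (wVar_ne_dashedVar s hl k _).symm

/-- The product of the staircase monomials of all thick strands. -/
noncomputable def allStaircases (𝕜 : Type*) [Field 𝕜] {m : ℕ} (s : Fin m → ℕ) :
    MvPolynomial Var 𝕜 :=
  ∏ k, staircase 𝕜 (dashedVar s k) (s k)

theorem allStaircases_ne_zero : allStaircases 𝕜 s ≠ 0 := by
  refine Finset.prod_ne_zero_iff.2 fun k _ => ?_
  rw [staircase, list_prod_map_range]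
  exact Finset.prod_ne_zero_iff.2 fun t _ => pow_ne_zero _ (MvPolynomial.X_ne_zero _)

/-- The factors from other blocks avoid the variables of block `k`, so the idempotent is linear over
them, and it fixes its own staircase. The product is the nonzero test vector for faithfulness. -/
theorem allStaircases_mem : allStaircases 𝕜 s ∈ thickInvariants 𝕜 s := fun k => by
  rw [allStaircases, ← Finset.prod_erase_mul _ _ (Finset.mem_univ k),
    nilOp_mul (dashedVar_injective s k), nilOp_staircase (dashedVar_injective s k)]
  intro t ht
  rw [map_prod]
  refine Finset.prod_congr rfl fun k' hk' => ?_
  have hne := (Finset.mem_erase.1 hk').1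
  rw [staircase, list_prod_map_range, map_prod]
  refine Finset.prod_congr rfl fun t' ht' => ?_
  have ht'' := Finset.mem_range.1 ht'
  rw [map_pow, swapVar_X, Equiv.swap_apply_of_ne_of_ne]
  · exact dashedVar_ne s hne ht'' (by omega)
  · exact dashedVar_ne s hne ht'' ht

/-- Black labels and all dashed variables give pairwise different variables; inside each block the
variables may be replaced by their elementary symmetric functions. -/
theorem algebraicIndependent_w (i : WSeq m n) :
    AlgebraicIndependent 𝕜 (Sum.elim
      (fun j : {j : Fin (m + n) // (i.1 j).isLeft = true} =>
        (MvPolynomial.X (wVar (lab i.1 j.1)) : MvPolynomial Var 𝕜))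
      (fun p : (k : Fin m) × Fin (s k) =>
        seqEsymm (fun t => MvPolynomial.X (dashedVar s p.1 t)) (s p.1) (p.2 + 1))) := by
  let β := {j : Fin (m + n) // (i.1 j).isLeft = true}
  let θ : β ⊕ ((k : Fin m) × Fin (s k)) → Var :=
    Sum.elim (fun j => wVar (lab i.1 j.1)) (fun p => dashedVar s p.1 p.2)
  have hθ : Function.Injective θ := by
    rintro (a | ⟨k, t⟩) (b | ⟨k', t'⟩) h
    · exact congrArg _ (Subtype.ext (lab_injective i.1 (wVar_inj a.2 b.2 h)))
    · exact absurd h.symm (wVar_ne_dashedVar s a.2 k' t')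
    · exact absurd h (wVar_ne_dashedVar s b.2 k t)
    · by_cases hk : k = k'
      · subst hk
        have : (t : ℕ) = t' := dashedVar_injective s k h
        rw [Fin.ext this]
      · exact absurd h (dashedVar_ne s hk t.2 t'.2)
  have h := (algebraicIndependent_blocks_esymm (𝕜 := 𝕜) (β := β) s).map'
    (MvPolynomial.rename_injective (R := 𝕜) θ hθ)
  convert h using 1
  funext x
  rcases x with j | p
  · simp [θ]
  · simp only [Sum.elim_inr, Function.comp_apply, MvPolynomial.rename_rename]
    rw [seqEsymm_eq_aeval (𝕜 := 𝕜), MvPolynomial.rename_eq_aeval]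
    rfl

variable (𝕜 n) in
/-- The projection from the free algebra. -/
noncomputable def W.mk : FreeAlgebra 𝕜 (WGen m n) →ₐ[𝕜] W 𝕜 s n :=
  RingQuot.mkAlgHom 𝕜 (WRel (𝕜 := 𝕜) (n := n) s)

theorem W.mk_eq {a b : FreeAlgebra 𝕜 (WGen m n)} (h : WRel s a b) : W.mk 𝕜 s n a = W.mk 𝕜 s n b :=
  RingQuot.mkAlgHom_rel 𝕜 h

theorem W.mk_ι (g : WGen m n) : W.mk 𝕜 s n (FreeAlgebra.ι 𝕜 g) = W.gen 𝕜 s n g := rfl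

theorem w_e_mul_e (i i' : WSeq m n) :
    W.gen 𝕜 s n (.e i) * W.gen 𝕜 s n (.e i') = if i = i' then W.gen 𝕜 s n (.e i) else 0 := by
  have := W.mk_eq s (𝕜 := 𝕜) (.e_e i i')
  rw [map_mul, apply_ite (W.mk 𝕜 s n), map_zero] at this
  exact this

theorem w_e_mul_e' (i i' : WSeq m n) :
    W.gen 𝕜 s n (.e i') * W.gen 𝕜 s n (.e i) = if i' = i then W.gen 𝕜 s n (.e i) else 0 := by
  rw [w_e_mul_e]
  by_cases h : i' = i
  · rw [h]
  · rw [if_neg h, if_neg h]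

theorem w_sum_e : ∑ i : WSeq m n, W.gen 𝕜 s n (.e i) = 1 := by
  have := W.mk_eq s (𝕜 := 𝕜) (n := n) .sum_e
  rwa [map_sum, map_one] at this

theorem w_x_e (j : Fin (m + n)) (i : WSeq m n) :
    W.gen 𝕜 s n (.x j) * W.gen 𝕜 s n (.e i) = W.gen 𝕜 s n (.e i) * W.gen 𝕜 s n (.x j) := by
  have := W.mk_eq s (𝕜 := 𝕜) (.x_e j i)
  rwa [map_mul, map_mul] at this

theorem w_x_x (j l : Fin (m + n)) :
    W.gen 𝕜 s n (.x j) * W.gen 𝕜 s n (.x l) = W.gen 𝕜 s n (.x l) * W.gen 𝕜 s n (.x j) := by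
  have := W.mk_eq s (𝕜 := 𝕜) (.x_x j l)
  rwa [map_mul, map_mul] at this

theorem w_psi_e {j : Fin (m + n - 1)} {i i' : WSeq m n} (h : i'.1 = swapSeq j i.1) :
    W.gen 𝕜 s n (.psi j) * W.gen 𝕜 s n (.e i) = W.gen 𝕜 s n (.e i') * W.gen 𝕜 s n (.psi j) := by
  have := W.mk_eq s (𝕜 := 𝕜) (.psi_e j i i' h)
  rwa [map_mul, map_mul] at this

theorem w_psi_red_red {j : Fin (m + n - 1)} {i : WSeq m n}
    (h₁ : (i.1 (lo j)).isLeft = false) (h₂ : (i.1 (hi j)).isLeft = false) :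
    W.gen 𝕜 s n (.psi j) * W.gen 𝕜 s n (.e i) = 0 := by
  have := W.mk_eq s (𝕜 := 𝕜) (.psi_red_red j i h₁ h₂)
  rwa [map_mul, map_zero] at this

/-- The defining relation has the idempotent on the right. Inserting `1 = ∑ e(i')` on that side,
either `i'` also has two red entries there, or the crossing leads to a sequence with a black entry
there, which differs from `i`. -/
theorem w_e_psi_red_red {j : Fin (m + n - 1)} {i : WSeq m n}
    (h₁ : (i.1 (lo j)).isLeft = false) (h₂ : (i.1 (hi j)).isLeft = false) :
    W.gen 𝕜 s n (.e i) * W.gen 𝕜 s n (.psi j) = 0 := by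
  refine eq_of_mul_idem_eq (w_sum_e s) fun i' => ?_
  rw [zero_mul, mul_assoc]
  by_cases h : (i'.1 (lo j)).isLeft = false ∧ (i'.1 (hi j)).isLeft = false
  · rw [w_psi_red_red s h.1 h.2, mul_zero]
  have h' : (i'.1 (lo j)).isLeft = true ∨ (i'.1 (hi j)).isLeft = true := by
    by_contra H
    push Not at H
    exact h ⟨by simpa using H.1, by simpa using H.2⟩
  rw [w_psi_e s (i' := ⟨swapSeq j i'.1, isShuffle_swapSeq i'.2 j h'⟩) rfl, ← mul_assoc, w_e_mul_e,
    if_neg, zero_mul]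
  rintro rfl
  simp only [swapSeq_lo, swapSeq_hi] at h₁ h₂
  exact h ⟨h₂, h₁⟩

theorem w_E_comm (k : Fin m) (d : ℕ) (y : W 𝕜 s n) :
    W.gen 𝕜 s n (.E k d) * y = y * W.gen 𝕜 s n (.E k d) := by
  obtain ⟨a, rfl⟩ : ∃ a, W.mk 𝕜 s n a = y := RingQuot.mkAlgHom_surjective 𝕜 _ y
  induction a using FreeAlgebra.induction with
  | grade0 r => rw [AlgHom.commutes, Algebra.commutes]
  | grade1 g =>
    have := W.mk_eq s (𝕜 := 𝕜) (.E_comm k d g)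
    rwa [map_mul, map_mul] at this
  | mul a b ha hb => rw [map_mul, ← mul_assoc, ha, mul_assoc, hb, mul_assoc]
  | add a b ha hb => rw [map_add, mul_add, ha, hb, add_mul]

/-- The central generators. -/
noncomputable def wCentral (p : Fin m × ℕ) : W 𝕜 s n := W.gen 𝕜 s n (.E p.1 p.2)

/-- The diagonal generators of the redotted Webster algebra. -/
noncomputable def wDiagGens (𝕜 : Type*) [Field 𝕜] {m : ℕ} (s : Fin m → ℕ) (n : ℕ) :
    Set (W 𝕜 s n) :=
  diagGens (fun i => W.gen 𝕜 s n (.e i)) (fun j => W.gen 𝕜 s n (.x j)) (wCentral s)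

theorem w_e_mem (i : WSeq m n) : W.gen 𝕜 s n (.e i) ∈ Algebra.adjoin 𝕜 (wDiagGens 𝕜 s n) :=
  Algebra.subset_adjoin (Or.inl ⟨i, rfl⟩)

theorem w_x_mem (j : Fin (m + n)) :
    WFree.x 𝕜 m n j ∈ (Algebra.adjoin 𝕜 (wDiagGens 𝕜 s n)).comap (W.mk 𝕜 s n) :=
  Algebra.subset_adjoin (Or.inr ⟨Sum.inl j, rfl⟩)

theorem w_E_mem (k : Fin m) (d : ℕ) :
    WFree.E 𝕜 m n k d ∈ (Algebra.adjoin 𝕜 (wDiagGens 𝕜 s n)).comap (W.mk 𝕜 s n) :=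
  Algebra.subset_adjoin (Or.inr ⟨Sum.inr (k, d), rfl⟩)

theorem wQuad_mem (p q : Fin 1 ⊕ Fin m) (j : Fin (m + n - 1)) :
    wQuad s p q j ∈ (Algebra.adjoin 𝕜 (wDiagGens 𝕜 s n)).comap (W.mk 𝕜 s n) := by
  rcases p with p | p <;> rcases q with q | q <;> simp only [wQuad]
  · exact zero_mem _
  · exact sum_mem fun d _ => mul_mem (pow_mem (neg_mem (one_mem _)) _)
      (mul_mem (pow_mem (w_x_mem s _) _) (w_E_mem s _ _))
  · exact sum_mem fun d _ => mul_mem (pow_mem (neg_mem (one_mem _)) _)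
      (mul_mem (pow_mem (w_x_mem s _) _) (w_E_mem s _ _))
  · exact zero_mem _

theorem wCubic_mem (p q r : Fin 1 ⊕ Fin m) (j l : Fin (m + n - 1)) :
    wCubic s p q r j l ∈ (Algebra.adjoin 𝕜 (wDiagGens 𝕜 s n)).comap (W.mk 𝕜 s n) := by
  by_cases h : p.isLeft = true ∧ q.isLeft = false ∧ r.isLeft = true
  · rcases p with p | p <;> rcases q with q | q <;> rcases r with r | r <;> simp at h
    rw [wCubic]
    exact sum_mem fun c _ => sum_mem fun a _ => mul_mem (pow_mem (neg_mem (one_mem _)) _)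
      (mul_mem (mul_mem (pow_mem (w_x_mem s _) _) (w_E_mem s _ _)) (pow_mem (w_x_mem s _) _))
  · rw [wCubic_eq_zero s j l h]
    exact zero_mem _

theorem w_slide_mem (P : Prop) [Decidable P] (i : WSeq m n) :
    W.mk 𝕜 s n (if P then WFree.e 𝕜 m n i else 0) ∈ Algebra.adjoin 𝕜 (wDiagGens 𝕜 s n) := by
  split_ifs
  · exact w_e_mem s i
  · rw [map_zero]; exact zero_mem _

variable (𝕜 n) in
/-- The crossings, extended by zero. -/
noncomputable def wPsi (j : ℕ) : W 𝕜 s n :=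
  if h : j < m + n - 1 then W.gen 𝕜 s n (.psi ⟨j, h⟩) else 0

theorem wPsi_eq (j : Fin (m + n - 1)) : wPsi 𝕜 s n j = W.gen 𝕜 s n (.psi j) := by
  rw [wPsi, dif_pos j.2]

variable (𝕜 n) in
/-- The redotted Webster algebra as a diagram algebra. -/
noncomputable def wDiagram : (wModel 𝕜 s n).DiagramAlgebra (W 𝕜 s n) :=
  DiagramAlgebra.ofRelations (wRep 𝕜 s n) (fun i => W.gen 𝕜 s n (.e i))
    (fun j => W.gen 𝕜 s n (.x j)) (wCentral s) (wPsi 𝕜 s n)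
    (fun i => wRep_gen s _) (fun j => by rw [wPsi_eq]; exact wRep_gen s _)
    (fun j => ⟨_, wRep_gen s _⟩) (fun k => ⟨_, wRep_gen s _⟩)
    (fun j h => by rw [wPsi, dif_neg (by omega)])
    (fun i i' => w_e_mul_e' s i i') (w_sum_e s) (fun k y => w_E_comm s k.1 k.2 y)
    (fun j i i' h => by rw [wPsi_eq]; exact w_psi_e s h)
    (fun j i _ h₁ h₂ => by
      rw [wPsi_eq]
      exact w_e_psi_red_red s (by simpa [wModel] using h₁) (by simpa [wModel] using h₂))
    (fun j p h₁ h₂ => by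
      have := W.mk_eq s (𝕜 := 𝕜) (.psi_x j p h₁ h₂)
      rw [map_mul, map_mul] at this
      rw [wPsi_eq]
      exact this)
    (fun j i => by
      have := W.mk_eq s (𝕜 := 𝕜) (.slide₁ j i)
      rw [map_sub, map_mul, map_mul, map_mul, map_mul, ← sub_mul] at this
      rw [wPsi_eq]
      exact this ▸ w_slide_mem s _ i)
    (fun j i => by
      have := W.mk_eq s (𝕜 := 𝕜) (.slide₂ j i)
      rw [map_sub, map_mul, map_mul, map_mul, map_mul, ← sub_mul] at this
      have h := neg_mem (this ▸ w_slide_mem (𝕜 := 𝕜) s _ i)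
      rw [← neg_mul, neg_sub] at h
      rw [wPsi_eq]
      exact h)
    (fun j i => by
      have := W.mk_eq s (𝕜 := 𝕜) (.quad j i)
      rw [map_mul, map_mul, map_mul] at this
      rw [wPsi_eq]
      exact this ▸ mul_mem (wQuad_mem s _ _ j) (w_e_mem s i))
    (fun j l h i => by
      have := W.mk_eq s (𝕜 := 𝕜) (.cubic j l h i)
      rw [map_mul, map_mul, map_sub, map_mul, map_mul, map_mul, map_mul] at this
      rw [wPsi_eq, wPsi_eq]
      exact this ▸ mul_mem (wCubic_mem s _ _ _ j l) (w_e_mem s i))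
    (fun j l h => by
      have := W.mk_eq s (𝕜 := 𝕜) (.psi_psi j l h)
      rw [map_mul, map_mul] at this
      rw [wPsi_eq, wPsi_eq]
      exact this)
    (by
      rintro u -
      obtain ⟨a, rfl⟩ : ∃ a, W.mk 𝕜 s n a = u := RingQuot.mkAlgHom_surjective 𝕜 _ u
      induction a using FreeAlgebra.induction with
      | grade0 r => rw [AlgHom.commutes]; exact Subalgebra.algebraMap_mem _ r
      | grade1 g =>
        refine Algebra.subset_adjoin ?_
        cases g with
        | e i => exact Or.inl (Or.inl ⟨i, rfl⟩)
        | x j => exact Or.inl (Or.inr ⟨Sum.inl j, rfl⟩)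
        | E k d => exact Or.inl (Or.inr ⟨Sum.inr (k, d), rfl⟩)
        | psi k => exact Or.inr ⟨k, (wPsi_eq s k).symm⟩
      | mul a b ha hb => rw [map_mul]; exact mul_mem ha hb
      | add a b ha hb => rw [map_add]; exact add_mem ha hb)

/-- An element of the redotted Webster algebra that acts by zero on the invariants of the thick
strands is zero. -/
theorem w_eq_zero {u : W 𝕜 s n} (h : ∀ i, ∀ f ∈ thickInvariants 𝕜 s,
    wRep 𝕜 s n u ((wModel 𝕜 s n).single i f) = 0) : u = 0 := by
  refine (wDiagram 𝕜 s n).eq_zero_of_forall (thickInvariants 𝕜 s)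
    (fun f hf ℓ => X_mul_mem_thickInvariants s hf ℓ) ?_ fun i f hf => h i f hf
  intro p hp i hpi
  refine mul_idem_eq_zero_of_algebraicIndependent (wModel 𝕜 s n) (wRep 𝕜 s n)
    (fun i => W.gen 𝕜 s n (.e i)) (Sum.elim (fun j => W.gen 𝕜 s n (.x j)) (wCentral s))
    (diagGens_comm (w_e_mul_e' s) (w_x_e s) (w_x_x s) fun k y => w_E_comm s k.1 k.2 y)
    (w_e_mul_e' s) i
    (Sum.elim (fun j => Sum.inl j.1) (fun p => Sum.inr (p.1, (p.2 : ℕ) + 1)) :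
      {j : Fin (m + n) // (i.1 j).isLeft = true} ⊕ ((k : Fin m) × Fin (s k)) →
        Fin (m + n) ⊕ (Fin m × ℕ)) ?_ _ (algebraicIndependent_w s i) ?_ (wRep_gen s _)
    (allStaircases_ne_zero s) hp (hpi _ (allStaircases_mem s))
  -- On the component of `i` a red dot and `E_{k,d}` with `d > s k` are `0`, and `E_{k,0}` is `1`.
  -- The active generators are the black dots and `E_{k,1}, …, E_{k,s k}`, whence the shift by one.
  · rintro (j | ⟨k, d⟩)
    · rcases hj : (i.1 j).isLeft with _ | _
      · right
        refine ⟨0, ?_⟩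
        have := W.mk_eq s (𝕜 := 𝕜) (.x_red j i hj)
        rw [map_mul, map_zero] at this
        rw [zero_smul]
        exact this
      · exact Or.inl ⟨Sum.inl ⟨j, hj⟩, rfl⟩
    · rcases d with _ | d
      · right
        have := W.mk_eq s (𝕜 := 𝕜) (n := n) (.E_zero k)
        rw [map_one] at this
        exact ⟨1, by rw [Sum.elim_inr, wCentral, ← W.mk_ι, this, one_mul, one_smul]⟩
      · by_cases hd : d < s k
        · exact Or.inl ⟨Sum.inr ⟨k, d, hd⟩, rfl⟩
        · right
          have := W.mk_eq s (𝕜 := 𝕜) (n := n) (.E_large k (d + 1) (by omega))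
          rw [map_zero] at this
          exact ⟨0, by rw [Sum.elim_inr, wCentral, ← W.mk_ι, this, zero_mul, zero_smul]⟩
  · rintro (j | ⟨k, d⟩) f
    · refine (LinearMap.congr_fun (wRep_gen s (.x j.1)) _).trans ?_
      refine ((wModel 𝕜 s n).x_single j.1 i f).trans ?_
      rw [wModel_X_of_black s (by exact j.2)]
      rfl
    · exact (LinearMap.congr_fun (wRep_gen s (.E k (d + 1))) _).trans (wE_single s k _ i f)

end WFaithful

end KLRSub

namespace KLRSub

/-! ### Strands and labels of the word of a sequence -/

section Positions

theorem flatten_ofFn_getElem? {α : Type*} {K : ℕ} (f : Fin K → List α) (j : Fin K) (t : ℕ)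
    (ht : t < (f j).length) :
    (List.ofFn f).flatten[(∑ q ∈ Finset.univ.filter (· < j), (f q).length) + t]?
      = some (f j)[t] := by
  induction K with
  | zero => exact j.elim0
  | succ K ih =>
    rw [List.ofFn_succ, List.flatten_cons]
    induction j using Fin.cases with
    | zero => simp [List.getElem?_append_left ht, List.getElem?_eq_getElem ht]
    | succ j =>
      have h : ∑ q ∈ Finset.univ.filter (· < j.succ), (f q).length
          = (f 0).length + ∑ q ∈ Finset.univ.filter (· < j), (f q.succ).length := by
        rw [Finset.sum_filter, Finset.sum_filter, Fin.sum_univ_succ]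
        simp
      rw [h, add_assoc, List.getElem?_append_right (by omega), Nat.add_sub_cancel_left]
      exact ih (fun q => f q.succ) j ht

variable {m n : ℕ} (s : Fin m → ℕ)

/-- The colour of the strands that an entry stands for. -/
def entryColour : Fin 1 ⊕ Fin m → Fin 1 ⊕ Fin 1 := Sum.map id fun _ => 0

@[simp] theorem width_inl (a : Fin 1) : width (lamOne s) (Sum.inl a) = 1 := rfl

@[simp] theorem width_inr (k : Fin m) : width (lamOne s) (Sum.inr k) = s k := by
  simp [width, lamOne]

theorem eq_entryColour_of_mem {z : Fin 1 ⊕ Fin m} {c : Fin 1 ⊕ Fin 1}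
    (h : c ∈ blockWord (lamOne s) z) : c = entryColour z := by
  rcases z with a | k
  · simpa [blockWord, entryColour] using h
  · simp only [blockWord, List.mem_flatMap, List.mem_replicate] at h
    obtain ⟨a, -, -, rfl⟩ := h
    rw [Subsingleton.elim a 0]
    rfl

variable (i : WSeq m n)

theorem wordList_getElem? {j : Fin (m + n)} {t : ℕ} (ht : t < width (lamOne s) (i.1 j)) :
    (wordList (lamOne s) i)[offset (lamOne s) i j + t]? = some (entryColour (i.1 j)) := by
  have ht' : t < (blockWord (lamOne s) (i.1 j)).length := by rwa [length_blockWord]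
  have h := flatten_ofFn_getElem? (fun j => blockWord (lamOne s) (i.1 j)) j t ht'
  simp only [length_blockWord] at h
  rw [← eq_entryColour_of_mem s (List.getElem_mem ht')]
  exact h

theorem offset_add_lt {j : Fin (m + n)} {t : ℕ} (ht : t < width (lamOne s) (i.1 j)) :
    offset (lamOne s) i j + t < strands (lamOne s) n := by
  obtain ⟨h, -⟩ := List.getElem?_eq_some_iff.1 (wordList_getElem? s i ht)
  rwa [length_wordList] at h

theorem word_offset {j : Fin (m + n)} {t : ℕ} (ht : t < width (lamOne s) (i.1 j))
    (h : offset (lamOne s) i j + t < strands (lamOne s) n) :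
    word (lamOne s) i ⟨offset (lamOne s) i j + t, h⟩ = entryColour (i.1 j) := by
  obtain ⟨h', h''⟩ := List.getElem?_eq_some_iff.1 (wordList_getElem? s i ht)
  exact h''

/-- The number of strands of the first `J` entries. -/
def prefixWidth (J : ℕ) : ℕ :=
  ∑ q ∈ Finset.univ.filter (fun q : Fin (m + n) => (q : ℕ) < J), width (lamOne s) (i.1 q)

theorem offset_eq (j : Fin (m + n)) : offset (lamOne s) i j = prefixWidth s i j := rfl

theorem filter_val_lt_succ {K : ℕ} (j : Fin K) :
    Finset.univ.filter (fun q : Fin K => (q : ℕ) < (j : ℕ) + 1)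
      = insert j (Finset.univ.filter fun q : Fin K => (q : ℕ) < (j : ℕ)) := by
  ext q
  simp only [Finset.mem_filter, Finset.mem_univ, true_and, Finset.mem_insert, Fin.ext_iff]
  omega

theorem prefixWidth_succ (j : Fin (m + n)) :
    prefixWidth s i (j + 1) = prefixWidth s i j + width (lamOne s) (i.1 j) := by
  rw [prefixWidth, filter_val_lt_succ, Finset.sum_insert (by simp), add_comm]
  rfl

theorem prefixWidth_mono {J J' : ℕ} (h : J ≤ J') : prefixWidth s i J ≤ prefixWidth s i J' :=
  Finset.sum_le_sum_of_subset fun q hq => by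
    simp only [Finset.mem_filter, Finset.mem_univ, true_and] at hq ⊢
    omega

theorem prefixWidth_all : prefixWidth s i (m + n) = strands (lamOne s) n := by
  rw [← length_wordList i, prefixWidth, Finset.filter_true_of_mem fun q _ => q.2]
  simp [wordList, List.length_flatten, List.map_ofFn, List.sum_ofFn, Function.comp_def,
    length_blockWord]

theorem exists_offset_of_lt_prefixWidth {J : ℕ} (hJ : J ≤ m + n) {p : ℕ}
    (hp : p < prefixWidth s i J) : ∃ (j : Fin (m + n)) (t : ℕ),
      t < width (lamOne s) (i.1 j) ∧ p = offset (lamOne s) i j + t := by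
  induction J with
  | zero => simp [prefixWidth] at hp
  | succ J ih =>
    by_cases h : p < prefixWidth s i J
    · exact ih (by omega) h
    · have := prefixWidth_succ s i ⟨J, hJ⟩
      simp only at this
      exact ⟨⟨J, hJ⟩, p - prefixWidth s i J, by omega, by rw [offset_eq]; simp only; omega⟩

theorem exists_offset (p : Fin (strands (lamOne s) n)) : ∃ (j : Fin (m + n)) (t : ℕ),
    t < width (lamOne s) (i.1 j) ∧ (p : ℕ) = offset (lamOne s) i j + t :=
  exists_offset_of_lt_prefixWidth s i le_rfl (by rw [prefixWidth_all]; exact p.2)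

/-- The number of letters of colour `c` in the first `P` positions of a word. -/
def countBelow {C : Type} [DecidableEq C] {K : ℕ} (w : Fin K → C) (c : C) (P : ℕ) : ℕ :=
  (Finset.univ.filter fun q : Fin K => (q : ℕ) < P ∧ w q = c).card

theorem countBelow_succ {C : Type} [DecidableEq C] {K : ℕ} (w : Fin K → C) (c : C) (p : Fin K) :
    countBelow w c (p + 1) = countBelow w c p + if w p = c then 1 else 0 := by
  rw [countBelow, countBelow, ← Finset.filter_filter, ← Finset.filter_filter, filter_val_lt_succ,
    Finset.filter_insert]
  split_ifs
  · rw [Finset.card_insert_of_notMem (by simp)]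
  · rfl

theorem countBelow_add (c : Fin 1 ⊕ Fin 1) (j : Fin (m + n)) {t : ℕ}
    (ht : t ≤ width (lamOne s) (i.1 j)) :
    countBelow (word (lamOne s) i) c (offset (lamOne s) i j + t)
      = countBelow (word (lamOne s) i) c (offset (lamOne s) i j)
        + if entryColour (i.1 j) = c then t else 0 := by
  induction t with
  | zero => simp
  | succ t ih =>
    have h := countBelow_succ (word (lamOne s) i) c
      ⟨offset (lamOne s) i j + t, offset_add_lt s i ht⟩
    rw [word_offset s i ht] at h
    rw [← add_assoc]
    refine h.trans ?_
    rw [ih (by omega)]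
    split_ifs <;> omega

theorem countBelow_prefixWidth (c : Fin 1 ⊕ Fin 1) {J : ℕ} (hJ : J ≤ m + n) :
    countBelow (word (lamOne s) i) c (prefixWidth s i J)
      = ∑ q ∈ Finset.univ.filter (fun q : Fin (m + n) => (q : ℕ) < J),
          if entryColour (i.1 q) = c then width (lamOne s) (i.1 q) else 0 := by
  induction J with
  | zero => simp [prefixWidth, countBelow]
  | succ J ih =>
    have h₁ := prefixWidth_succ s i ⟨J, hJ⟩
    have h₂ := countBelow_add s i c ⟨J, hJ⟩ le_rfl
    have h₃ := filter_val_lt_succ (⟨J, hJ⟩ : Fin (m + n))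
    simp only [offset_eq] at h₁ h₂ h₃
    rw [h₁, h₂, h₃, Finset.sum_insert (by simp), ih (by omega), add_comm]

theorem lab_word {j : Fin (m + n)} {t : ℕ} (ht : t < width (lamOne s) (i.1 j))
    (h : offset (lamOne s) i j + t < strands (lamOne s) n) :
    lab (word (lamOne s) i) ⟨offset (lamOne s) i j + t, h⟩ = (entryColour (i.1 j),
      (∑ q ∈ Finset.univ.filter (fun q : Fin (m + n) => (q : ℕ) < j),
        if entryColour (i.1 q) = entryColour (i.1 j) then width (lamOne s) (i.1 q) else 0) + t) := by
  refine Prod.ext (word_offset s i ht h) ?_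
  change countBelow (word (lamOne s) i) (word (lamOne s) i ⟨offset (lamOne s) i j + t, h⟩)
    (offset (lamOne s) i j + t) = _
  rw [word_offset s i ht, countBelow_add s i _ j ht.le, if_pos rfl, offset_eq,
    countBelow_prefixWidth s i _ j.2.le]

/-- A black entry occupies exactly one strand, so counting solid strands is the same as counting
black entries: the two representations assign the same variable. -/
theorem lab_word_black {j : Fin (m + n)} (hj : (i.1 j).isLeft = true)
    (h : offset (lamOne s) i j < strands (lamOne s) n) :
    lab (word (lamOne s) i) ⟨offset (lamOne s) i j, h⟩ = wVar (lab i.1 j) := by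
  obtain ⟨a, ha⟩ := Sum.isLeft_iff.1 hj
  have h₁ := lab_word s i (j := j) (t := 0) (by rw [ha]; exact Nat.one_pos) h
  refine h₁.trans (Prod.ext rfl ?_)
  change _ = rank i.1 j
  rw [rank, Finset.card_eq_sum_ones, add_zero, ← Finset.sum_filter, Finset.filter_filter]
  have key : ∀ q, entryColour (i.1 q) = entryColour (i.1 j) ↔ i.1 q = i.1 j := fun q => by
    rw [ha]
    rcases i.1 q with b | b
    · simp [Subsingleton.elim b a]
    · simp [entryColour]
  have hf : (Finset.univ.filter fun q : Fin (m + n) =>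
      (q : ℕ) < j ∧ entryColour (i.1 q) = entryColour (i.1 j))
        = Finset.univ.filter fun q => q < j ∧ i.1 q = i.1 j :=
    Finset.filter_congr fun q _ => by rw [key, Fin.lt_def]
  refine Finset.sum_congr hf fun q hq => ?_
  · rw [(Finset.mem_filter.1 hq).2.2, ha]; rfl

/-- Thick entries keep their order in every sequence, so the dashed strands before `λ_k` are those
of the earlier thick entries. Hence the block of variables depends on `k` alone. -/
theorem lab_word_red {j : Fin (m + n)} {k : Fin m} (hj : i.1 j = Sum.inr k) {t : ℕ} (ht : t < s k)
    (h : offset (lamOne s) i j + t < strands (lamOne s) n) :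
    lab (word (lamOne s) i) ⟨offset (lamOne s) i j + t, h⟩ = dashedVar s k t := by
  rw [lab_word s i (by rwa [hj, width_inr])]
  refine Prod.ext (by rw [hj]; rfl) ?_
  change _ + t = _ + t
  congr 1
  obtain ⟨π, hπ, hmono⟩ := i.2
  have hjπ : j = π.symm (Sum.inr k) := by
    rw [Equiv.eq_symm_apply]
    rw [hπ] at hj
    rcases hp : π j with a | k'
    · rw [hp] at hj; simp at hj
    · rw [hp] at hj; simpa using hj
  rw [Finset.sum_filter, ← Equiv.sum_comp π.symm, Fintype.sum_sum_type]
  have h₁ : ∀ a, i.1 (π.symm (Sum.inl a)) = Sum.inl 0 := fun a => by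
    rw [hπ, Equiv.apply_symm_apply]; rfl
  have h₂ : ∀ k, i.1 (π.symm (Sum.inr k)) = Sum.inr k := fun a => by
    rw [hπ, Equiv.apply_symm_apply]; rfl
  simp only [h₁, h₂, hj]
  rw [Finset.sum_eq_zero (by intro a _; simp [entryColour]), zero_add, dashedBefore,
    Finset.sum_filter]
  refine Finset.sum_congr rfl fun k' _ => ?_
  have : ((π.symm (Sum.inr k') : Fin (m + n)) : ℕ) < j ↔ k' < k := by
    rw [hjπ, ← Fin.lt_def]
    exact hmono.lt_iff_lt
  simp only [this, entryColour, Sum.map_inr, if_true, width_inr]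

theorem dashedBefore_injective (hs : ∀ k, 0 < s k) : Function.Injective (dashedBefore s) := by
  intro k k' h
  by_contra hne
  rcases lt_or_gt_of_ne hne with h' | h'
  · have := dashedBefore_add_le s h'
    have := hs k
    omega
  · have := dashedBefore_add_le s h'
    have := hs k'
    omega

theorem width_pos (hs : ∀ k, 0 < s k) (z : Fin 1 ⊕ Fin m) : 0 < width (lamOne s) z := by
  rcases z with a | k
  · exact Nat.one_pos
  · rw [width_inr]; exact hs k

/-- Reading from left to right, the colour of the first strand of an entry tells whether it is
thick, and the rank of that strand tells which thick entry it is. Positivity of the `s k` keeps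
thick entries visible in the word. -/
theorem word_injective (hs : ∀ k, 0 < s k) :
    Function.Injective (word (lamOne s) : WSeq m n → _) := by
  intro i i' h
  apply Subtype.ext
  have key : ∀ J ≤ m + n, ∀ q : Fin (m + n), (q : ℕ) < J → i.1 q = i'.1 q := by
    intro J
    induction J with
    | zero => intro _ q hq; omega
    | succ J ih =>
      intro hJ q hq
      by_cases hqJ : (q : ℕ) < J
      · exact ih (by omega) q hqJ
      have hoff : offset (lamOne s) i q = offset (lamOne s) i' q := by
        refine Finset.sum_congr rfl fun q' hq' => ?_
        rw [ih (by omega) q']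
        have := Fin.lt_def.1 (Finset.mem_filter.1 hq').2
        omega
      have hw := width_pos s hs (i.1 q)
      have hw' := width_pos s hs (i'.1 q)
      have e : entryColour (i.1 q) = entryColour (i'.1 q) := by
        rw [← word_offset s i hw (offset_add_lt s i hw),
          ← word_offset s i' hw' (offset_add_lt s i' hw'), h]
        congr 2
      rcases hq₁ : i.1 q with a | k <;> rcases hq₂ : i'.1 q with a' | k'
      · rw [Subsingleton.elim a a']
      · rw [hq₁, hq₂] at e; simp [entryColour] at e
      · rw [hq₁, hq₂] at e; simp [entryColour] at e
      · have l₁ := lab_word_red s i hq₁ (hs k) (offset_add_lt s i hw)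
        have l₂ := lab_word_red s i' hq₂ (hs k') (offset_add_lt s i' hw')
        have : dashedVar s k 0 = dashedVar s k' 0 := by
          rw [← l₁, ← l₂, h]
          congr 2
        rw [dashedBefore_injective s hs (congrArg Prod.snd this)]
  funext q
  exact key _ le_rfl q q.2

theorem prefixWidth_swap {i i' : WSeq m n} {j : Fin (m + n - 1)} (h : i'.1 = swapSeq j i.1) {J : ℕ}
    (hJ : J ≠ j + 1) : prefixWidth s i' J = prefixWidth s i J := by
  refine Finset.sum_equiv (Equiv.swap (lo j) (hi j)) (fun q => ?_) fun q _ => ?_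
  · simp only [Finset.mem_filter, Finset.mem_univ, true_and, Equiv.swap_apply_def, lo, hi,
      Fin.ext_iff]
    split_ifs <;> simp only <;> omega
  · rw [h]; rfl

/-- Characterisation of the word of a sequence after the exchange of two entries. -/
theorem eq_word_of_swap {i i' : WSeq m n} {j : Fin (m + n - 1)} (h : i'.1 = swapSeq j i.1)
    {w : Fin (strands (lamOne s) n) → Fin 1 ⊕ Fin 1}
    (h₁ : ∀ p : Fin (strands (lamOne s) n), (p : ℕ) < offset (lamOne s) i (lo j) ∨
      offset (lamOne s) i (lo j) + width (lamOne s) (i.1 (lo j)) + width (lamOne s) (i.1 (hi j)) ≤ p →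
      w p = word (lamOne s) i p)
    (h₂ : ∀ p : Fin (strands (lamOne s) n), ∀ t < width (lamOne s) (i.1 (hi j)),
      (p : ℕ) = offset (lamOne s) i (lo j) + t → w p = entryColour (i.1 (hi j)))
    (h₃ : ∀ p : Fin (strands (lamOne s) n), ∀ t < width (lamOne s) (i.1 (lo j)),
      (p : ℕ) = offset (lamOne s) i (lo j) + width (lamOne s) (i.1 (hi j)) + t →
      w p = entryColour (i.1 (lo j))) :
    w = word (lamOne s) i' := by
  funext p
  obtain ⟨j', t, ht, hp⟩ := exists_offset s i' p
  have hp' : p = ⟨offset (lamOne s) i' j' + t, hp ▸ p.2⟩ := Fin.ext hp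
  have hw' : word (lamOne s) i' p = entryColour (i'.1 j') := by
    rw [hp', word_offset s i' ht]
  rw [hw']
  have hlo : ((lo j : Fin (m + n)) : ℕ) = j := rfl
  have hhi : ((hi j : Fin (m + n)) : ℕ) = j + 1 := rfl
  have s₁ := prefixWidth_succ s i (lo j)
  have s₂ := prefixWidth_succ s i (hi j)
  have s₃ := prefixWidth_succ s i' (lo j)
  simp only [offset_eq] at h₁ h₂ h₃ hp
  rw [hlo] at s₁ s₃ h₁ h₂ h₃
  rw [hhi] at s₂
  have e₀ := prefixWidth_swap s h (J := j) (by omega)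
  by_cases c₁ : j' = lo j
  · rw [c₁, h, swapSeq_lo] at ht ⊢
    refine h₂ p t ht ?_
    rw [hp, c₁, hlo, e₀]
  by_cases c₂ : j' = hi j
  · rw [c₂, h, swapSeq_hi] at ht ⊢
    refine h₃ p t ht ?_
    rw [hp, c₂, hhi, s₃, e₀, h, swapSeq_lo]
  have hne₁ : (j' : ℕ) ≠ j := fun H => c₁ (Fin.ext H)
  have hne₂ : (j' : ℕ) ≠ j + 1 := fun H => c₂ (Fin.ext H)
  have e₁ := prefixWidth_swap s h (J := j') hne₂
  rw [h, swapSeq_of_ne c₁ c₂] at ht ⊢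
  have s₄ := prefixWidth_succ s i j'
  have hwi : word (lamOne s) i p = entryColour (i.1 j') := by
    have : p = ⟨offset (lamOne s) i j' + t, offset_add_lt s i ht⟩ := Fin.ext (by
      rw [hp, e₁]; rfl)
    rw [this, word_offset s i ht]
  rw [← hwi]
  apply h₁
  rcases Nat.lt_or_ge j' j with hlt | hge
  · left
    have := prefixWidth_mono s i (show (j' : ℕ) + 1 ≤ j from hlt)
    omega
  · right
    have := prefixWidth_mono s i (show (j : ℕ) + 1 + 1 ≤ j' by omega)
    omega

end Positions

end KLRSub

namespace KLRSub

/-! ### The action of products of generators of the ambient algebra -/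

section KLRAction

open PolyModel

variable {𝕜 : Type*} [Field 𝕜] {D : CartanDatum (Fin 1)} (Q : ScalarParams 𝕜 D) (n : ℕ)

theorem klr_x_single {p : ℕ} (hp : p < n) (w : Fin n → Fin 1 ⊕ Fin 1) (f : MvPolynomial Var 𝕜) :
    klrRep Q n (KLR.x n Q.bar p) ((klrModel 𝕜 n).single w f)
      = (klrModel 𝕜 n).single w (MvPolynomial.X (lab w ⟨p, hp⟩) * f) := by
  have h := klrRep_x Q n ⟨p, hp⟩
  simp only at h
  rw [h, x_single, klrModel_X]
  rfl

theorem klr_psi_single_same {p : ℕ} (hp : p + 1 < n) {w : Fin n → Fin 1 ⊕ Fin 1}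
    (h : w ⟨p, by omega⟩ = w ⟨p + 1, hp⟩) (f : MvPolynomial Var 𝕜) :
    klrRep Q n (KLR.psi n Q.bar p) ((klrModel 𝕜 n).single w f)
      = (klrModel 𝕜 n).single w
        (demazure 𝕜 (lab w ⟨p, by omega⟩) (up (lab w ⟨p, by omega⟩)) f) := by
  have h' := klrRep_psi Q n ⟨p, by omega⟩
  simp only at h'
  rw [h']
  exact (klrModel 𝕜 n).psi_same (j := ⟨p, by omega⟩) (i := w) h f

theorem klr_psi_single_swap {p : ℕ} (hp : p + 1 < n) {w : Fin n → Fin 1 ⊕ Fin 1}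
    (h : w ⟨p, by omega⟩ ≠ w ⟨p + 1, hp⟩) (f : MvPolynomial Var 𝕜) :
    klrRep Q n (KLR.psi n Q.bar p) ((klrModel 𝕜 n).single w f)
      = (klrModel 𝕜 n).single (swapSeq ⟨p, by omega⟩ w)
        (klrQ 𝕜 (lab w ⟨p + 1, hp⟩) (lab w ⟨p, by omega⟩) * f) := by
  have h' := klrRep_psi Q n ⟨p, by omega⟩
  simp only at h'
  rw [h']
  exact (klrModel 𝕜 n).psi_swap (j := ⟨p, by omega⟩) (i := w) (i' := swapSeq ⟨p, by omega⟩ w) h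
    (Or.inl trivial) rfl f

theorem list_prod_single {ι : Type*} {K : PolyModel 𝕜 (Fin 1 ⊕ Fin 1) Var
      (Fin n → Fin 1 ⊕ Fin 1) n} {A : Type*} [Ring A] [Algebra 𝕜 A]
    (ρ : A →ₐ[𝕜] Module.End 𝕜 K.Space) (w : Fin n → Fin 1 ⊕ Fin 1) (L : List ι) (a : ι → A)
    (T : ι → Module.End 𝕜 (MvPolynomial Var 𝕜))
    (h : ∀ x ∈ L, ∀ f, ρ (a x) (K.single w f) = K.single w (T x f)) (f : MvPolynomial Var 𝕜) :
    ρ (L.map a).prod (K.single w f) = K.single w ((L.map T).prod f) := by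
  induction L with
  | nil => simp
  | cons x L ih =>
    rw [List.map_cons, List.prod_cons, map_mul, Module.End.mul_apply,
      ih fun y hy => h y (List.mem_cons_of_mem x hy), h x List.mem_cons_self, List.map_cons,
      List.prod_cons, Module.End.mul_apply]

theorem list_prod_mulLeft {ι : Type*} (L : List ι) (g : ι → MvPolynomial Var 𝕜) :
    (L.map fun x => LinearMap.mulLeft 𝕜 (g x)).prod = LinearMap.mulLeft 𝕜 (L.map g).prod := by
  induction L with
  | nil => ext; simp
  | cons x L ih =>
    rw [List.map_cons, List.prod_cons, ih, List.map_cons, List.prod_cons, LinearMap.mulLeft_mul]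
    rfl

/-- The nilHecke idempotent acts by `nilOp`. -/
theorem klr_nilIdem_single {b r : ℕ} (hb : b + r ≤ n) {w : Fin n → Fin 1 ⊕ Fin 1} {z : ℕ → Var}
    (hz : ∀ t (ht : t < r), lab w ⟨b + t, by omega⟩ = z t) (hup : ∀ t, z (t + 1) = up (z t))
    (f : MvPolynomial Var 𝕜) :
    klrRep Q n (KLR.nilIdem n Q.bar b r) ((klrModel 𝕜 n).single w f)
      = (klrModel 𝕜 n).single w (nilOp 𝕜 z r f) := by
  have hx : ∀ t (ht : t < r) (k : ℕ) f, klrRep Q n (KLR.x n Q.bar (b + t) ^ k)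
      ((klrModel 𝕜 n).single w f) = (klrModel 𝕜 n).single w
        (LinearMap.mulLeft 𝕜 (MvPolynomial.X (z t) ^ k) f) := by
    intro t ht k f
    induction k with
    | zero => simp
    | succ k ih =>
      rw [pow_succ', map_mul, Module.End.mul_apply, ih, klr_x_single Q n (by omega), hz t ht,
        LinearMap.mulLeft_apply, LinearMap.mulLeft_apply, pow_succ', mul_assoc]
  have hψ : ∀ t, t + 1 < r → ∀ f, klrRep Q n (KLR.psi n Q.bar (b + t))
      ((klrModel 𝕜 n).single w f)
        = (klrModel 𝕜 n).single w (demazure 𝕜 (z t) (z (t + 1)) f) := by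
    intro t ht f
    have hc : w ⟨b + t, by omega⟩ = w ⟨b + t + 1, by omega⟩ := by
      have h₁ := congrArg Prod.fst (hz t (by omega))
      have h₂ := congrArg Prod.fst (hz (t + 1) ht)
      rw [hup] at h₂
      exact h₁.trans h₂.symm
    rw [klr_psi_single_same Q n (by omega) hc, hz t (by omega), hup]
  rw [KLR.nilIdem, map_mul, Module.End.mul_apply, KLR.psiLongest]
  rw [list_prod_single n (klrRep Q n) w (List.range r) _
    (descProd fun t => demazure 𝕜 (z t) (z (t + 1)))]
  · rw [list_prod_single n (klrRep Q n) w (List.range r) _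
      (fun t => LinearMap.mulLeft 𝕜 (MvPolynomial.X (z t) ^ (r - 1 - t)))]
    · rw [list_prod_mulLeft]
      rfl
    · intro t ht f
      exact hx t (List.mem_range.1 ht) _ f
  · intro a ha f
    refine list_prod_single n (klrRep Q n) w _ _ _ (fun t ht f => hψ t ?_ f) f
    have h₁ := List.mem_range.1 ha
    have h₂ := List.mem_range.1 (List.mem_reverse.1 ht)
    omega

theorem klr_elemSymm_single {b r : ℕ} (hb : b + r ≤ n) {w : Fin n → Fin 1 ⊕ Fin 1} {z : ℕ → Var}
    (hz : ∀ t (ht : t < r), lab w ⟨b + t, by omega⟩ = z t) (d : ℕ) (f : MvPolynomial Var 𝕜) :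
    klrRep Q n (KLR.elemSymm n Q.bar b r d) ((klrModel 𝕜 n).single w f)
      = (klrModel 𝕜 n).single w (seqEsymm (fun t => MvPolynomial.X (z t)) r d * f) := by
  have hL : ∀ L : List (List ℕ), (∀ T ∈ L, ∀ t ∈ T, t < r) → ∀ f,
      klrRep Q n (L.map fun T => (T.map fun t => KLR.x n Q.bar (b + t)).prod).sum
        ((klrModel 𝕜 n).single w f) = (klrModel 𝕜 n).single w
          ((L.map fun T => (T.map fun t => MvPolynomial.X (z t)).prod).sum * f) := by
    intro L hL f
    induction L with
    | nil => simp
    | cons T L ih =>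
      rw [List.map_cons, List.sum_cons, map_add (klrRep Q n), LinearMap.add_apply,
        ih fun T hT => hL T (List.mem_cons_of_mem _ hT), List.map_cons, List.sum_cons, add_mul,
        map_add ((klrModel 𝕜 n).single w)]
      congr 1
      rw [list_prod_single n (klrRep Q n) w T _
        (fun t => LinearMap.mulLeft 𝕜 (MvPolynomial.X (z t))), list_prod_mulLeft]
      · rfl
      · intro t ht f
        have := hL T List.mem_cons_self t ht
        rw [klr_x_single Q n (by omega), hz t this]
        rfl
  refine hL _ (fun T hT t ht => ?_) f
  exact List.mem_range.1 ((List.mem_sublistsLen.1 hT).1.subset ht)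

/-- A strand moves to the left across `r` strands of the other colour. -/
theorem klr_psi_range_single {b r : ℕ} (hb : b + r < n) {w : Fin n → Fin 1 ⊕ Fin 1} {z : ℕ → Var}
    {y : Var} (hz : ∀ t (ht : t < r), lab w ⟨b + t, by omega⟩ = z t) (hy : lab w ⟨b + r, hb⟩ = y)
    (hne : ∀ t < r, (z t).1 ≠ y.1) :
    ∃ w' : Fin n → Fin 1 ⊕ Fin 1,
      (∀ p (hp : p < n), p < b ∨ b + r < p → w' ⟨p, hp⟩ = w ⟨p, hp⟩) ∧
      w' ⟨b, by omega⟩ = y.1 ∧ (∀ t (ht : t < r), w' ⟨b + t + 1, by omega⟩ = (z t).1) ∧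
      ∀ f, klrRep Q n ((List.range r).map fun t => KLR.psi n Q.bar (b + t)).prod
          ((klrModel 𝕜 n).single w f)
        = (klrModel 𝕜 n).single w' ((∏ t ∈ Finset.range r, klrQ 𝕜 y (z t)) * f) := by
  induction r generalizing w with
  | zero =>
    exact ⟨w, fun _ _ _ => rfl, congrArg Prod.fst hy, fun t ht => absurd ht (Nat.not_lt_zero t),
      fun f => by simp⟩
  | succ r ih =>
    have c₁ : w ⟨b + r, by omega⟩ = (z r).1 := congrArg Prod.fst (hz r (by omega))
    have c₂ : w ⟨b + r + 1, hb⟩ = y.1 := congrArg Prod.fst hy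
    have hc : w ⟨b + r, by omega⟩ ≠ w ⟨b + r + 1, hb⟩ := by
      rw [c₁, c₂]; exact hne r (by omega)
    set j : Fin (n - 1) := ⟨b + r, by omega⟩ with hj
    have hl := lab_swapSeq (j := j) (i := w) hc
    have hof : ∀ p (hp : p < n), p ≠ b + r → p ≠ b + r + 1 →
        lab (swapSeq j w) ⟨p, hp⟩ = lab w ⟨p, hp⟩ := fun p hp h₁ h₂ => by
      rw [hl, Equiv.swap_apply_of_ne_of_ne] <;>
        simp only [lo, hi, hj, ne_eq, Fin.mk.injEq] <;> assumption
    -- The last factor of the product acts first, so the induction hypothesis is applied to the word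
    -- already exchanged at `b + r`.
    obtain ⟨w', h₁, h₂, h₃, h₄⟩ := ih (w := swapSeq j w) (by omega)
      (fun t ht => by rw [hof _ _ (by omega) (by omega), hz t (by omega)])
      (by
        have := hl (lo j)
        rw [Equiv.swap_apply_left] at this
        exact this.trans hy)
      (fun t ht => hne t (by omega))
    refine ⟨w', fun p hp h => ?_, h₂, fun t ht => ?_, fun f => ?_⟩
    · rw [h₁ p hp (by omega)]
      exact congrArg Prod.fst (hof p hp (by omega) (by omega))
    · by_cases htr : t < r
      · exact h₃ t htr
      · obtain rfl : t = r := by omega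
        rw [h₁ _ _ (by omega)]
        exact (swapSeq_hi j w).trans c₁
    · rw [List.range_succ, List.map_append, List.prod_append, List.map_singleton,
        List.prod_singleton, map_mul, Module.End.mul_apply, klr_psi_single_swap Q n (by omega) hc,
        h₄, Finset.prod_range_succ, mul_assoc]
      rw [show lab w ⟨b + r + 1, _⟩ = y from hy, hz r (by omega)]

/-- A strand moves to the right across `r` strands of the other colour. -/
theorem klr_psi_reverse_range_single {b r : ℕ} (hb : b + r < n) {w : Fin n → Fin 1 ⊕ Fin 1}
    {z : ℕ → Var} {y : Var} (hz : ∀ t (ht : t < r), lab w ⟨b + t + 1, by omega⟩ = z t)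
    (hy : lab w ⟨b, by omega⟩ = y) (hne : ∀ t < r, (z t).1 ≠ y.1) :
    ∃ w' : Fin n → Fin 1 ⊕ Fin 1,
      (∀ p (hp : p < n), p < b ∨ b + r < p → lab w' ⟨p, hp⟩ = lab w ⟨p, hp⟩) ∧
      lab w' ⟨b + r, by omega⟩ = y ∧ (∀ t (ht : t < r), lab w' ⟨b + t, by omega⟩ = z t) ∧
      ∀ f, klrRep Q n ((List.range r).reverse.map fun t => KLR.psi n Q.bar (b + t)).prod
          ((klrModel 𝕜 n).single w f)
        = (klrModel 𝕜 n).single w' ((∏ t ∈ Finset.range r, klrQ 𝕜 (z t) y) * f) := by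
  induction r with
  | zero =>
    exact ⟨w, fun _ _ _ => rfl, hy, fun t ht => absurd ht (Nat.not_lt_zero t),
      fun f => by simp⟩
  | succ r ih =>
    obtain ⟨w', h₁, h₂, h₃, h₄⟩ := ih (by omega) (fun t ht => hz t (by omega)) hy
      (fun t ht => hne t (by omega))
    have l₁ : lab w' ⟨b + r + 1, hb⟩ = z r := by
      rw [h₁ _ _ (by omega), hz r (by omega)]
    have hc : w' ⟨b + r, by omega⟩ ≠ w' ⟨b + r + 1, hb⟩ := by
      rw [show w' ⟨b + r, _⟩ = y.1 from congrArg Prod.fst h₂,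
        show w' ⟨b + r + 1, _⟩ = (z r).1 from congrArg Prod.fst l₁]
      exact (hne r (by omega)).symm
    set j : Fin (n - 1) := ⟨b + r, by omega⟩ with hj
    have hl := lab_swapSeq (j := j) (i := w') hc
    have hof : ∀ p (hp : p < n), p ≠ b + r → p ≠ b + r + 1 →
        lab (swapSeq j w') ⟨p, hp⟩ = lab w' ⟨p, hp⟩ := fun p hp h₁ h₂ => by
      rw [hl, Equiv.swap_apply_of_ne_of_ne] <;>
        simp only [lo, hi, hj, ne_eq, Fin.mk.injEq] <;> assumption
    refine ⟨swapSeq j w', fun p hp h => ?_, ?_, fun t ht => ?_, fun f => ?_⟩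
    · rw [hof p hp (by omega) (by omega), h₁ p hp (by omega)]
    · have := hl (hi j)
      rw [Equiv.swap_apply_right] at this
      exact this.trans h₂
    · by_cases htr : t < r
      · rw [hof _ _ (by omega) (by omega), h₃ t htr]
      · obtain rfl : t = r := by omega
        have := hl (lo j)
        rw [Equiv.swap_apply_left] at this
        exact this.trans l₁
    · rw [List.range_succ, List.reverse_append, List.reverse_singleton, List.singleton_append,
        List.map_cons, List.prod_cons, map_mul, Module.End.mul_apply, h₄,
        klr_psi_single_swap Q n (by omega) hc, Finset.prod_range_succ, h₂, l₁]
      congr 1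
      ring

end KLRAction

end KLRSub

namespace KLRSub

/-! ### The operators of the thick strands -/

section ThickOps

open PolyModel

variable {𝕜 : Type*} [Field 𝕜]

theorem commute_nilOp {τ : Type*} [DecidableEq τ] {z : ℕ → τ} {r : ℕ}
    {T : Module.End 𝕜 (MvPolynomial τ 𝕜)}
    (h : Commute T (LinearMap.mulLeft 𝕜 (staircase 𝕜 z r)))
    (hd : ∀ t, t + 1 < r → Commute T (demazure 𝕜 (z t) (z (t + 1)))) :
    Commute T (nilOp 𝕜 z r) := by
  refine h.mul_right (Commute.list_prod_right _ _ fun x hx => ?_)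
  obtain ⟨a, ha, rfl⟩ := List.mem_map.1 hx
  refine Commute.list_prod_right _ _ fun x hx => ?_
  obtain ⟨t, ht, rfl⟩ := List.mem_map.1 hx
  have h₁ := List.mem_range.1 ha
  have h₂ := List.mem_range.1 (List.mem_reverse.1 ht)
  exact hd t (by omega)

theorem swapVar_staircase_of_ne {τ : Type*} [DecidableEq τ] {z : ℕ → τ} {r : ℕ} {u v : τ}
    (hu : ∀ t < r, z t ≠ u) (hv : ∀ t < r, z t ≠ v) :
    swapVar 𝕜 u v (staircase 𝕜 z r) = staircase 𝕜 z r := by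
  rw [staircase, list_prod_map_range, map_prod]
  refine Finset.prod_congr rfl fun t ht => ?_
  have ht' := Finset.mem_range.1 ht
  rw [map_pow, swapVar_X, Equiv.swap_apply_of_ne_of_ne (hu t ht') (hv t ht')]

theorem commute_demazure_mulLeft {τ : Type*} [DecidableEq τ] {u v : τ} (h : u ≠ v)
    {g : MvPolynomial τ 𝕜} (hg : swapVar 𝕜 u v g = g) :
    Commute (demazure 𝕜 u v : Module.End 𝕜 (MvPolynomial τ 𝕜)) (LinearMap.mulLeft 𝕜 g) :=
  LinearMap.ext fun f => demazure_mul_of_swapVar_eq h hg f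

theorem commute_demazure_nilOp {τ : Type*} [DecidableEq τ] {z : ℕ → τ} {r : ℕ} {u v : τ}
    (hz : Function.Injective z) (h : u ≠ v) (hu : ∀ t < r, z t ≠ u) (hv : ∀ t < r, z t ≠ v) :
    Commute (demazure 𝕜 u v : Module.End 𝕜 (MvPolynomial τ 𝕜)) (nilOp 𝕜 z r) :=
  commute_nilOp (commute_demazure_mulLeft h (swapVar_staircase_of_ne hu hv)) fun t ht =>
    LinearMap.ext fun f => demazure_comm h (fun H => by have := hz H; omega)
      (hu t (by omega)).symm (hu _ ht).symm (hv t (by omega)).symm (hv _ ht).symm f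

theorem commute_nilOp_nilOp {τ : Type*} [DecidableEq τ] {z z' : ℕ → τ} {r r' : ℕ}
    (hz : Function.Injective z) (hz' : Function.Injective z')
    (h : ∀ t < r, ∀ t' < r', z t ≠ z' t') : Commute (nilOp 𝕜 z r) (nilOp 𝕜 z' r') := by
  refine commute_nilOp ?_ fun t ht => (commute_demazure_nilOp hz
    (fun H => by have := hz' H; omega) (fun t' ht' => h t' ht' t (by omega))
    fun t' ht' => h t' ht' _ ht).symm
  refine (commute_nilOp (LinearMap.ext fun f => ?_) fun t ht => ?_).symm
  · simp only [Module.End.mul_apply, LinearMap.mulLeft_apply]; ring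
  · exact (commute_demazure_mulLeft (fun H => by have := hz H; omega)
      (swapVar_staircase_of_ne (fun t' ht' => (h t (by omega) t' ht').symm)
        fun t' ht' => (h _ ht t' ht').symm)).symm

variable {m : ℕ} (s : Fin m → ℕ) {n : ℕ}

variable (𝕜) in
/-- The operator on polynomials of the idempotent of a single entry. -/
noncomputable def entryOp : Fin 1 ⊕ Fin m → Module.End 𝕜 (MvPolynomial Var 𝕜)
  | Sum.inl _ => 1
  | Sum.inr k => nilOp 𝕜 (dashedVar s k) (s k)

variable (𝕜) in
/-- The operator on polynomials of the idempotent of a sequence. -/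
noncomputable def seqOp (i : WSeq m n) : Module.End 𝕜 (MvPolynomial Var 𝕜) :=
  ((List.finRange (m + n)).map fun j => entryOp 𝕜 s (i.1 j)).prod

theorem commute_nilOp_entryOp (k : Fin m) (z : Fin 1 ⊕ Fin m) :
    Commute (nilOp 𝕜 (dashedVar s k) (s k)) (entryOp 𝕜 s z) := by
  rcases z with a | k'
  · exact Commute.one_right _
  · by_cases h : k = k'
    · subst h; exact Commute.refl _
    · exact commute_nilOp_nilOp (dashedVar_injective s k) (dashedVar_injective s k')
        fun t ht t' ht' => dashedVar_ne s h ht ht'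

theorem mul_list_prod_of_mem {A : Type*} [Monoid A] {a : A} {L : List A} (h : a ∈ L)
    (ha : a * a = a) (hc : ∀ x ∈ L, Commute a x) : a * L.prod = L.prod := by
  induction L with
  | nil => simp at h
  | cons x L ih =>
    rw [List.prod_cons]
    rcases List.mem_cons.1 h with rfl | h'
    · rw [← mul_assoc, ha]
    · rw [← mul_assoc, (hc x List.mem_cons_self).eq, mul_assoc,
        ih h' fun y hy => hc y (List.mem_cons_of_mem x hy)]

theorem exists_eq_red (i : WSeq m n) (k : Fin m) : ∃ j, i.1 j = Sum.inr k := by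
  obtain ⟨π, hπ, -⟩ := i.2
  exact ⟨π.symm (Sum.inr k), by rw [hπ, Equiv.apply_symm_apply]; rfl⟩

/-- Each thick entry occurs in `i`, so its projection is one of the factors. The factors commute
because the blocks are disjoint, and the product absorbs another copy of it. -/
theorem seqOp_mem (i : WSeq m n) (f : MvPolynomial Var 𝕜) :
    seqOp 𝕜 s i f ∈ thickInvariants 𝕜 s := by
  intro k
  obtain ⟨j, hj⟩ := exists_eq_red i k
  have h : nilOp 𝕜 (dashedVar s k) (s k) * seqOp 𝕜 s i = seqOp 𝕜 s i := by
    refine mul_list_prod_of_mem (List.mem_map.2 ⟨j, List.mem_finRange j,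
      congrArg (entryOp 𝕜 s) hj⟩) ?_ ?_
    · refine LinearMap.ext fun f => ?_
      rw [Module.End.mul_apply, nilOp_nilOp (dashedVar_injective s k)]
    · intro x hx
      obtain ⟨j', -, rfl⟩ := List.mem_map.1 hx
      exact commute_nilOp_entryOp s k _
  exact LinearMap.congr_fun h f

theorem seqOp_of_mem (i : WSeq m n) {f : MvPolynomial Var 𝕜} (hf : f ∈ thickInvariants 𝕜 s) :
    seqOp 𝕜 s i f = f := by
  have key : ∀ L : List (Fin (m + n)), (L.map fun j => entryOp 𝕜 s (i.1 j)).prod f = f := by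
    intro L
    induction L with
    | nil => rfl
    | cons j L ih =>
      rw [List.map_cons, List.prod_cons, Module.End.mul_apply, ih]
      rcases i.1 j with a | k
      · rfl
      · exact hf k
  exact key _

theorem swapVar_seqEsymm_dashed (k k' : Fin m) {t : ℕ} (ht : t + 1 < s k') (d : ℕ) :
    swapVar 𝕜 (dashedVar s k' t) (dashedVar s k' (t + 1))
      (seqEsymm (fun u => MvPolynomial.X (dashedVar s k u)) (s k) d)
        = seqEsymm (fun u => MvPolynomial.X (dashedVar s k u)) (s k) d := by
  by_cases h : k = k'
  · subst h
    exact swapVar_seqEsymm (dashedVar_injective s k) ht d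
  · exact swapVar_seqEsymm_of_ne _ _ (fun t' ht' => dashedVar_ne s h ht' (by omega))
      fun t' ht' => dashedVar_ne s h ht' ht

/-- Expanded by Vieta's formula, the crossing polynomial involves dashed variables only through
symmetric functions of a block. Thus crossings preserve `thickInvariants`. -/
theorem swapVar_wQ (a b : (Fin 1 ⊕ Fin m) × ℕ) (k : Fin m) {t : ℕ} (ht : t + 1 < s k) :
    swapVar 𝕜 (dashedVar s k t) (dashedVar s k (t + 1)) (wQ 𝕜 s a b) = wQ 𝕜 s a b := by
  simp only [wQ]
  split
  · rename_i a' k' h₁ h₂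
    have ha : a.1.isLeft = true := by rw [h₁]; rfl
    rw [prod_sub_eq_sum_seqEsymm, map_sum]
    refine Finset.sum_congr rfl fun d _ => ?_
    rw [map_mul, map_mul, map_pow, map_pow, map_neg, map_one, swapVar_X,
      Equiv.swap_apply_of_ne_of_ne (wVar_ne_dashedVar s ha k _).symm
        (wVar_ne_dashedVar s ha k _).symm, swapVar_seqEsymm_dashed s k' k ht]
  · rw [map_one]

theorem demazure_mem_thickInvariants {u v : Var} (h : u ≠ v) (hu : ∀ k t, dashedVar s k t ≠ u)
    (hv : ∀ k t, dashedVar s k t ≠ v) {f : MvPolynomial Var 𝕜} (hf : f ∈ thickInvariants 𝕜 s) :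
    demazure 𝕜 u v f ∈ thickInvariants 𝕜 s := fun k => by
  have := LinearMap.congr_fun (commute_demazure_nilOp (𝕜 := 𝕜) (r := s k)
    (dashedVar_injective s k) h (fun t _ => hu k t) fun t _ => hv k t).eq f
  rw [Module.End.mul_apply, Module.End.mul_apply, hf k] at this
  exact this.symm

theorem zero_mem_thickInvariants : (0 : MvPolynomial Var 𝕜) ∈ thickInvariants 𝕜 s :=
  fun _ => map_zero _

theorem add_mem_thickInvariants {f g : MvPolynomial Var 𝕜} (hf : f ∈ thickInvariants 𝕜 s)
    (hg : g ∈ thickInvariants 𝕜 s) : f + g ∈ thickInvariants 𝕜 s := fun k => by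
  rw [map_add, hf k, hg k]

theorem smul_mem_thickInvariants (c : 𝕜) {f : MvPolynomial Var 𝕜}
    (hf : f ∈ thickInvariants 𝕜 s) : c • f ∈ thickInvariants 𝕜 s := fun k => by
  rw [map_smul, hf k]

variable {D : CartanDatum (Fin 1)} (Q : ScalarParams 𝕜 D)

theorem entryIdem_single (i : WSeq m n) (j : Fin (m + n)) (f : MvPolynomial Var 𝕜) :
    klrRep Q (strands (lamOne s) n) (entryIdem (lamOne s) Q (offset (lamOne s) i j) (i.1 j))
      ((klrModel 𝕜 (strands (lamOne s) n)).single (word (lamOne s) i) f)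
      = (klrModel 𝕜 (strands (lamOne s) n)).single (word (lamOne s) i)
        (entryOp 𝕜 s (i.1 j) f) := by
  rcases hj : i.1 j with a | k
  · rw [entryIdem, map_one]; rfl
  · have h₀ : entryIdem (ℓ := n) (lamOne s) Q (offset (lamOne s) i j) (Sum.inr k)
        = KLR.nilIdem (strands (lamOne s) n) Q.bar (offset (lamOne s) i j) (s k) := by
      simp [entryIdem, List.finRange_succ, blockOffset, lamOne]
    have hlt : ∀ t < s k, offset (lamOne s) i j + t < strands (lamOne s) n := fun t ht =>
      offset_add_lt s i (by rwa [hj, width_inr])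
    have hle : offset (lamOne s) i j + s k ≤ strands (lamOne s) n := by
      have h₁ := prefixWidth_succ s i j
      have h₂ := prefixWidth_mono s i (show (j : ℕ) + 1 ≤ m + n from j.2)
      rw [prefixWidth_all, h₁, hj, width_inr] at h₂
      exact h₂
    rw [h₀]
    exact klr_nilIdem_single Q _ hle (fun t ht => lab_word_red s i hj ht (hlt t ht))
      (fun t => rfl) f

theorem eS_single (i : WSeq m n) (f : MvPolynomial Var 𝕜) :
    klrRep Q (strands (lamOne s) n) (eS (lamOne s) Q i)
      ((klrModel 𝕜 (strands (lamOne s) n)).single (word (lamOne s) i) f)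
      = (klrModel 𝕜 (strands (lamOne s) n)).single (word (lamOne s) i) (seqOp 𝕜 s i f) := by
  rw [eS, map_mul, Module.End.mul_apply, klrRep_e, e_single_self]
  exact list_prod_single _ _ _ _ _ _ (fun j _ f => entryIdem_single s Q i j f) f

theorem eS_single_of_ne (i : WSeq m n) {w : Fin (strands (lamOne s) n) → Fin 1 ⊕ Fin 1}
    (h : w ≠ word (lamOne s) i) (f : MvPolynomial Var 𝕜) :
    klrRep Q (strands (lamOne s) n) (eS (lamOne s) Q i)
      ((klrModel 𝕜 (strands (lamOne s) n)).single w f) = 0 := by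
  rw [eS, map_mul, Module.End.mul_apply, klrRep_e, e_single_of_ne _ h, map_zero]

/-- Checked on polynomials and lifted by faithfulness, which avoids nilHecke computations inside the
ambient algebra. -/
theorem eS_mul_eS (hs : ∀ k, 0 < s k) (i i' : WSeq m n) :
    eS (lamOne s) Q i * eS (lamOne s) Q i' = if i = i' then eS (lamOne s) Q i else 0 := by
  rw [← sub_eq_zero]
  refine klr_eq_zero Q _ fun w f => ?_
  rw [map_sub, map_mul, LinearMap.sub_apply, Module.End.mul_apply]
  by_cases h' : w = word (lamOne s) i'
  · subst h'
    rw [eS_single]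
    split_ifs with h
    · subst h
      rw [eS_single, eS_single, seqOp_of_mem s i (seqOp_mem s i f), sub_self]
    · rw [eS_single_of_ne s Q i fun H => h (word_injective s hs H).symm, map_zero]
      simp
  · rw [eS_single_of_ne s Q i' h', map_zero]
    split_ifs with h
    · subst h
      rw [eS_single_of_ne s Q i h', sub_zero]
    · simp

end ThickOps

end KLRSub

namespace KLRSub

/-! ### Comparison of the two representations -/

section Link

open PolyModel
open scoped Classical

variable {𝕜 : Type*} [Field 𝕜] {m : ℕ} (s : Fin m → ℕ) {n : ℕ}

/-- The inclusion of the representation space of the redotted Webster algebra. -/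
noncomputable def spread :
    (wModel 𝕜 s n).Space →ₗ[𝕜] (klrModel 𝕜 (strands (lamOne s) n)).Space :=
  ∑ i, (klrModel 𝕜 (strands (lamOne s) n)).single (word (lamOne s) i) ∘ₗ LinearMap.proj i

theorem spread_apply (v : (wModel 𝕜 s n).Space) :
    spread s v = ∑ i, (klrModel 𝕜 (strands (lamOne s) n)).single (word (lamOne s) i) (v i) := by
  rw [spread, LinearMap.sum_apply]
  rfl

theorem spread_single (i : WSeq m n) (f : MvPolynomial Var 𝕜) :
    spread s ((wModel 𝕜 s n).single i f)
      = (klrModel 𝕜 (strands (lamOne s) n)).single (word (lamOne s) i) f := by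
  rw [spread_apply, Finset.sum_eq_single i, single_self]
  · intro i' _ h
    rw [(wModel 𝕜 s n).single_of_ne h, map_zero]
  · exact fun h => absurd (Finset.mem_univ i) h

theorem spread_injective (hs : ∀ k, 0 < s k) :
    Function.Injective (spread s : (wModel 𝕜 s n).Space →ₗ[𝕜] _) := by
  intro v v' h
  have key : ∀ (v : (wModel 𝕜 s n).Space) i, spread s v (word (lamOne s) i) = v i := by
    intro v i
    rw [spread_apply, Finset.sum_apply, Finset.sum_eq_single i, single_self]
    · intro i' _ hi
      exact (klrModel 𝕜 _).single_of_ne (fun H => hi (word_injective s hs H).symm) _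
    · exact fun h => absurd (Finset.mem_univ i) h
  funext i
  rw [← key v, h, key]

variable (𝕜 n) in
/-- The vectors with all coordinates in the image of the nilHecke idempotents. -/
noncomputable def thickVectors : Submodule 𝕜 (wModel 𝕜 s n).Space where
  carrier := {v | ∀ i, v i ∈ thickInvariants 𝕜 s}
  zero_mem' := fun _ => zero_mem_thickInvariants s
  add_mem' := fun h h' i => add_mem_thickInvariants s (h i) (h' i)
  smul_mem' := fun c _ h i => smul_mem_thickInvariants s c (h i)

theorem single_mem_thickVectors (i : WSeq m n) {f : MvPolynomial Var 𝕜}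
    (hf : f ∈ thickInvariants 𝕜 s) : (wModel 𝕜 s n).single i f ∈ thickVectors 𝕜 s n := by
  intro i'
  rw [single_apply]
  split_ifs
  · exact hf
  · exact zero_mem_thickInvariants s

variable {D : CartanDatum (Fin 1)} (Q : ScalarParams 𝕜 D)

/-- Both elements act in the same way on the invariants of the thick strands. -/
def Linked (x : W 𝕜 s n) (y : Ambient (lamOne s) n Q) : Prop :=
  ∀ v ∈ thickVectors 𝕜 s n, wRep 𝕜 s n x v ∈ thickVectors 𝕜 s n ∧
    klrRep Q (strands (lamOne s) n) y (spread s v) = spread s (wRep 𝕜 s n x v)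

variable {s Q}

namespace Linked

variable {x x' : W 𝕜 s n} {y y' : Ambient (lamOne s) n Q}

protected theorem zero : Linked s Q (0 : W 𝕜 s n) 0 := fun v _ => by
  simp

protected theorem add (h : Linked s Q x y) (h' : Linked s Q x' y') :
    Linked s Q (x + x') (y + y') := fun v hv => by
  rw [map_add, map_add, LinearMap.add_apply, LinearMap.add_apply, map_add, (h v hv).2, (h' v hv).2]
  exact ⟨add_mem (h v hv).1 (h' v hv).1, rfl⟩

protected theorem smul (c : 𝕜) (h : Linked s Q x y) : Linked s Q (c • x) (c • y) := fun v hv => by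
  rw [map_smul, map_smul, LinearMap.smul_apply, LinearMap.smul_apply, map_smul, (h v hv).2]
  exact ⟨Submodule.smul_mem _ c (h v hv).1, rfl⟩

protected theorem mul (h : Linked s Q x y) (h' : Linked s Q x' y') :
    Linked s Q (x * x') (y * y') := fun v hv => by
  obtain ⟨h₁, h₂⟩ := h' v hv
  obtain ⟨h₃, h₄⟩ := h _ h₁
  rw [map_mul, map_mul, Module.End.mul_apply, Module.End.mul_apply, h₂, h₄]
  exact ⟨h₃, rfl⟩

protected theorem sum {ι : Type*} (T : Finset ι) {x : ι → W 𝕜 s n}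
    {y : ι → Ambient (lamOne s) n Q} (h : ∀ a ∈ T, Linked s Q (x a) (y a)) :
    Linked s Q (∑ a ∈ T, x a) (∑ a ∈ T, y a) := by
  induction T using Finset.induction with
  | empty => exact Linked.zero
  | insert a T ha ih =>
    rw [Finset.sum_insert ha, Finset.sum_insert ha]
    exact (h a (Finset.mem_insert_self a T)).add
      (ih fun b hb => h b (Finset.mem_insert_of_mem hb))

end Linked

variable (s Q)

theorem eS_spread (hs : ∀ k, 0 < s k) (i : WSeq m n) {v : (wModel 𝕜 s n).Space}
    (hv : v ∈ thickVectors 𝕜 s n) :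
    klrRep Q (strands (lamOne s) n) (eS (lamOne s) Q i) (spread s v)
      = (klrModel 𝕜 (strands (lamOne s) n)).single (word (lamOne s) i) (v i) := by
  rw [spread_apply, map_sum, Finset.sum_eq_single i, eS_single, seqOp_of_mem s i (hv i)]
  · intro i' _ hi
    exact eS_single_of_ne s Q i (fun H => hi (word_injective s hs H)) _
  · exact fun h => absurd (Finset.mem_univ i) h

/-- Reduces the comparison for one generator to a single component: both idempotents extract the
component at `i`, since the projection fixes its invariant entries. -/
theorem linked_mul_e (hs : ∀ k, 0 < s k) (i : WSeq m n) {x : W 𝕜 s n}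
    {a : Ambient (lamOne s) n Q}
    (h : ∀ f ∈ thickInvariants 𝕜 s, ∃ i', ∃ g ∈ thickInvariants 𝕜 s,
      wRep 𝕜 s n x ((wModel 𝕜 s n).single i f) = (wModel 𝕜 s n).single i' g ∧
      klrRep Q (strands (lamOne s) n) a
          ((klrModel 𝕜 (strands (lamOne s) n)).single (word (lamOne s) i) f)
        = (klrModel 𝕜 (strands (lamOne s) n)).single (word (lamOne s) i') g) :
    Linked s Q (x * W.gen 𝕜 s n (.e i)) (a * eS (lamOne s) Q i) := fun v hv => by
  obtain ⟨i', g, hg, h₁, h₂⟩ := h (v i) (hv i)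
  have he : wRep 𝕜 s n (W.gen 𝕜 s n (.e i)) v = (wModel 𝕜 s n).single i (v i) := by
    rw [wRep_gen]
    exact (wModel 𝕜 s n).e_apply i v
  rw [map_mul, map_mul, Module.End.mul_apply, Module.End.mul_apply, he, h₁, eS_spread s Q hs i hv,
    h₂, spread_single]
  exact ⟨single_mem_thickVectors s i' hg, rfl⟩

theorem linked_e (hs : ∀ k, 0 < s k) (i : WSeq m n) :
    Linked s Q (W.gen 𝕜 s n (.e i)) (eS (lamOne s) Q i) := by
  have := linked_mul_e s Q hs i (x := 1) (a := 1) fun f hf => ⟨i, f, hf, by simp, by simp⟩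
  rwa [one_mul, one_mul] at this

theorem linked_y (hs : ∀ k, 0 < s k) (j : Fin (m + n)) (i : WSeq m n) :
    Linked s Q (W.gen 𝕜 s n (.x j) * W.gen 𝕜 s n (.e i)) (yS (lamOne s) Q j i) := by
  rcases hj : i.1 j with a | k
  · have hl : (i.1 j).isLeft = true := by rw [hj]; rfl
    have hy : yS (lamOne s) Q j i
        = KLR.x (strands (lamOne s) n) Q.bar (offset (lamOne s) i j) * eS (lamOne s) Q i := by
      simp only [yS, hj]
    rw [hy]
    refine linked_mul_e s Q hs i fun f hf => ⟨i, _,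
      X_mul_mem_thickInvariants s (n := n) hf (lab i.1 j), ?_, ?_⟩
    · rw [wRep_gen]
      exact (wModel 𝕜 s n).x_single j i f
    · have hlt : offset (lamOne s) i j < strands (lamOne s) n :=
        offset_add_lt s i (t := 0) (width_pos s hs _)
      rw [klr_x_single Q _ hlt, lab_word_black s i hl hlt, wModel_X_of_black s (by exact hl)]
  · have hx := W.mk_eq s (𝕜 := 𝕜) (.x_red j i (by rw [hj]; rfl))
    rw [map_mul, map_zero, W.mk_ι, W.mk_ι] at hx
    rw [hx, show yS (lamOne s) Q j i = 0 by simp only [yS, hj]]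
    exact Linked.zero

theorem offset_add_le (i : WSeq m n) (j : Fin (m + n)) :
    offset (lamOne s) i j + width (lamOne s) (i.1 j) ≤ strands (lamOne s) n := by
  rw [offset_eq, ← prefixWidth_succ, ← prefixWidth_all s i]
  exact prefixWidth_mono s i j.2

theorem linked_thickDot (hs : ∀ k, 0 < s k) (k : Fin m) (d : ℕ) {j : Fin (m + n)} {i : WSeq m n}
    (hj : i.1 j = Sum.inr k) :
    Linked s Q (W.gen 𝕜 s n (.E k d) * W.gen 𝕜 s n (.e i))
      (thickDotS (lamOne s) Q k 0 d j i) := by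
  rw [thickDotS, show blockOffset (lamOne s) k 0 = 0 by simp [blockOffset], add_zero]
  refine linked_mul_e s Q hs i fun f hf => ⟨i, _, mul_mem_thickInvariants s
    (fun k' t ht => swapVar_seqEsymm_dashed s k k' ht d) hf, ?_, ?_⟩
  · rw [wRep_gen]
    exact wE_single s k d i f
  · have hle := offset_add_le s i j
    rw [hj, width_inr] at hle
    exact klr_elemSymm_single Q _ hle
      (fun t ht => lab_word_red s i hj ht (lt_of_lt_of_le (Nat.add_lt_add_left ht _) hle)) d f

theorem offset_hi (i : WSeq m n) (j : Fin (m + n - 1)) :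
    offset (lamOne s) i (hi j) = offset (lamOne s) i (lo j) + width (lamOne s) (i.1 (lo j)) :=
  prefixWidth_succ s i (lo j)

theorem linked_psi_black (hs : ∀ k, 0 < s k) {j : Fin (m + n - 1)} {i : WSeq m n}
    (h₁ : (i.1 (lo j)).isLeft = true) (h₂ : (i.1 (hi j)).isLeft = true) :
    Linked s Q (W.gen 𝕜 s n (.psi j) * W.gen 𝕜 s n (.e i))
      (KLR.psi (strands (lamOne s) n) Q.bar (offset (lamOne s) i (lo j)) * eS (lamOne s) Q i) := by
  have hw : width (lamOne s) (i.1 (lo j)) = 1 := by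
    obtain ⟨a, ha⟩ := Sum.isLeft_iff.1 h₁
    rw [ha, width_inl]
  have hoff := offset_hi s i j
  rw [hw] at hoff
  have hlt : offset (lamOne s) i (hi j) < strands (lamOne s) n :=
    offset_add_lt s i (t := 0) (width_pos s hs _)
  have hlt' : offset (lamOne s) i (lo j) + 1 < strands (lamOne s) n := hoff ▸ hlt
  have l₁ := lab_word_black s i h₁ (by omega)
  have hc : word (lamOne s) i ⟨offset (lamOne s) i (lo j), by omega⟩
      = word (lamOne s) i ⟨offset (lamOne s) i (lo j) + 1, hlt'⟩ := by
    have e₁ := congrArg Prod.fst l₁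
    have e₂ := congrArg Prod.fst (lab_word_black s i h₂ hlt)
    simp only [lab_fst, wVar] at e₁ e₂
    rw [e₁, (w_eq_iff_isLeft i j).2 ⟨h₁, h₂⟩, ← e₂]
    congr 2
  refine linked_mul_e s Q hs i fun f hf => ⟨i, _, demazure_mem_thickInvariants s
    (up_ne (wVar (lab i.1 (lo j)))) (fun k t => wVar_ne_dashedVar s (a := lab i.1 (lo j)) h₁ k t)
    (fun k t => wVar_ne_dashedVar s (a := up (lab i.1 (lo j))) h₁ k t) hf, ?_, ?_⟩
  · rw [wRep_gen]
    exact (wModel 𝕜 s n).psi_same ((w_eq_iff_isLeft i j).2 ⟨h₁, h₂⟩) f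
  · rw [klr_psi_single_same Q _ hlt' hc, l₁]

theorem prod_klrQ_eq_wQ {a b : (Fin 1 ⊕ Fin m) × ℕ} (ha : a.1.isLeft = true) {k : Fin m}
    (hb : b.1 = Sum.inr k) :
    ∏ t ∈ Finset.range (s k), klrQ 𝕜 (wVar a) (dashedVar s k t) = wQ 𝕜 s a b := by
  obtain ⟨a', ha'⟩ := Sum.isLeft_iff.1 ha
  simp only [wQ, ha', hb]
  refine Finset.prod_congr rfl fun t _ => ?_
  rw [klrQ, if_pos]
  simp [wVar, ha', dashedVar]

theorem prod_klrQ_eq_one {a b : (Fin 1 ⊕ Fin m) × ℕ} (ha : a.1.isLeft = true) {k : Fin m}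
    (hb : b.1 = Sum.inr k) :
    ∏ t ∈ Finset.range (s k), klrQ 𝕜 (dashedVar s k t) (wVar a) = wQ 𝕜 s b a := by
  obtain ⟨a', ha'⟩ := Sum.isLeft_iff.1 ha
  simp only [wQ, ha', hb]
  refine Finset.prod_eq_one fun t _ => ?_
  rw [klrQ, if_neg]
  simp [dashedVar]

/-- The solid strand moves left across the `s k` dashed strands and collects one factor `X - Z_t`
from each. Their product is the polynomial of the red-black crossing. -/
theorem linked_psi_red_black (hs : ∀ k, 0 < s k) {j : Fin (m + n - 1)} {i : WSeq m n} {k : Fin m}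
    (h₁ : i.1 (lo j) = Sum.inr k) (h₂ : (i.1 (hi j)).isLeft = true) :
    Linked s Q (W.gen 𝕜 s n (.psi j) * W.gen 𝕜 s n (.e i))
      (((List.range (s k)).map fun t => KLR.psi (strands (lamOne s) n) Q.bar
        (offset (lamOne s) i (lo j) + t)).prod * eS (lamOne s) Q i) := by
  have hw : width (lamOne s) (i.1 (hi j)) = 1 := by
    obtain ⟨a, ha⟩ := Sum.isLeft_iff.1 h₂
    rw [ha, width_inl]
  have hoff := offset_hi s i j
  rw [h₁, width_inr] at hoff
  have hlt : offset (lamOne s) i (hi j) < strands (lamOne s) n :=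
    offset_add_lt s i (t := 0) (width_pos s hs _)
  have hlt' : offset (lamOne s) i (lo j) + s k < strands (lamOne s) n := hoff ▸ hlt
  have l₂ : lab (word (lamOne s) i) ⟨offset (lamOne s) i (lo j) + s k, hlt'⟩
      = wVar (lab i.1 (hi j)) := by
    rw [← lab_word_black s i h₂ hlt]
    congr 2
    exact hoff.symm
  have hne : ∀ t < s k, (dashedVar s k t).1 ≠ (wVar (lab i.1 (hi j))).1 := by
    obtain ⟨a, ha⟩ := Sum.isLeft_iff.1 h₂
    intro t _
    simp [dashedVar, wVar, ha]
  obtain ⟨w', c₁, c₂, c₃, c₄⟩ := klr_psi_range_single Q _ hlt'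
    (fun t ht => lab_word_red s i h₁ ht (by omega)) l₂ hne
  set i' : WSeq m n := ⟨swapSeq j i.1, isShuffle_swapSeq i.2 j (Or.inr h₂)⟩ with hi'
  have hw' : w' = word (lamOne s) i' := by
    refine eq_word_of_swap s rfl (fun p hp => ?_) (fun p t ht hp => ?_) fun p t ht hp => ?_
    · rw [h₁, hw, width_inr] at hp
      exact c₁ p p.2 (by omega)
    · rw [hw] at ht
      obtain rfl : t = 0 := by omega
      rw [show p = ⟨offset (lamOne s) i (lo j), by omega⟩ from Fin.ext hp]
      exact c₂
    · rw [h₁, width_inr] at ht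
      rw [hw] at hp
      rw [show p = ⟨offset (lamOne s) i (lo j) + t + 1, by omega⟩ from
        Fin.ext (by simp only; omega),
        c₃ t ht, h₁]
      rfl
  have hne' : i.1 (lo j) ≠ i.1 (hi j) := fun H => by rw [← H, h₁] at h₂; simp at h₂
  refine linked_mul_e s Q hs i fun f hf => ⟨i', _, mul_mem_thickInvariants s
    (fun k' t ht => swapVar_wQ s (lab i.1 (hi j)) (lab i.1 (lo j)) k' ht) hf, ?_, ?_⟩
  · rw [wRep_gen]
    exact (wModel 𝕜 s n).psi_swap (i' := i') hne' (Or.inr h₂) rfl f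
  · rw [c₄, hw', prod_klrQ_eq_wQ s (a := lab i.1 (hi j)) (b := lab i.1 (lo j)) h₂ h₁]

/-- In this direction each thin crossing acts by the factor `1`, as does the thick crossing in `W`;
only the word changes. -/
theorem linked_psi_black_red (hs : ∀ k, 0 < s k) {j : Fin (m + n - 1)} {i : WSeq m n} {k : Fin m}
    (h₁ : (i.1 (lo j)).isLeft = true) (h₂ : i.1 (hi j) = Sum.inr k) :
    Linked s Q (W.gen 𝕜 s n (.psi j) * W.gen 𝕜 s n (.e i))
      (((List.range (s k)).reverse.map fun t => KLR.psi (strands (lamOne s) n) Q.bar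
        (offset (lamOne s) i (lo j) + t)).prod * eS (lamOne s) Q i) := by
  have hw : width (lamOne s) (i.1 (lo j)) = 1 := by
    obtain ⟨a, ha⟩ := Sum.isLeft_iff.1 h₁
    rw [ha, width_inl]
  have hoff := offset_hi s i j
  rw [hw] at hoff
  have hle := offset_add_le s i (hi j)
  rw [h₂, width_inr, hoff] at hle
  have hlt' : offset (lamOne s) i (lo j) + s k < strands (lamOne s) n := by omega
  have l₂ : ∀ t (ht : t < s k),
      lab (word (lamOne s) i) ⟨offset (lamOne s) i (lo j) + t + 1, by omega⟩
        = dashedVar s k t := by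
    intro t ht
    rw [← lab_word_red s i h₂ ht (by omega)]
    congr 2
    omega
  have hne : ∀ t < s k, (dashedVar s k t).1 ≠ (wVar (lab i.1 (lo j))).1 := by
    obtain ⟨a, ha⟩ := Sum.isLeft_iff.1 h₁
    intro t _
    simp [dashedVar, wVar, ha]
  obtain ⟨w', c₁, c₂, c₃, c₄⟩ := klr_psi_reverse_range_single Q _ hlt' l₂
    (lab_word_black s i h₁ (by omega)) hne
  set i' : WSeq m n := ⟨swapSeq j i.1, isShuffle_swapSeq i.2 j (Or.inl h₁)⟩ with hi'
  have hw' : w' = word (lamOne s) i' := by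
    refine eq_word_of_swap s rfl (fun p hp => ?_) (fun p t ht hp => ?_) fun p t ht hp => ?_
    · rw [h₂, hw, width_inr] at hp
      exact congrArg Prod.fst (c₁ p p.2 (by omega))
    · rw [h₂, width_inr] at ht
      rw [show p = ⟨offset (lamOne s) i (lo j) + t, by omega⟩ from Fin.ext hp, h₂]
      exact congrArg Prod.fst (c₃ t ht)
    · rw [hw] at ht
      obtain rfl : t = 0 := by omega
      rw [h₂, width_inr] at hp
      rw [show p = ⟨offset (lamOne s) i (lo j) + s k, by omega⟩ from Fin.ext hp]
      exact congrArg Prod.fst c₂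
  have hne' : i.1 (lo j) ≠ i.1 (hi j) := fun H => by rw [H, h₂] at h₁; simp at h₁
  refine linked_mul_e s Q hs i fun f hf => ⟨i', _, mul_mem_thickInvariants s
    (fun k' t ht => swapVar_wQ s (lab i.1 (hi j)) (lab i.1 (lo j)) k' ht) hf, ?_, ?_⟩
  · rw [wRep_gen]
    exact (wModel 𝕜 s n).psi_swap (i' := i') hne' (Or.inl h₁) rfl f
  · rw [c₄, hw', prod_klrQ_eq_one s (a := lab i.1 (lo j)) (b := lab i.1 (hi j)) h₁ h₂]

theorem linked_Psi (hs : ∀ k, 0 < s k) (j : Fin (m + n - 1)) (i : WSeq m n) :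
    Linked s Q (W.gen 𝕜 s n (.psi j) * W.gen 𝕜 s n (.e i)) (PsiS (lamOne s) Q j i) := by
  have hsum : ∀ k, ∑ a, lamOne s k a = s k := fun k => by simp [lamOne]
  rcases h₁ : i.1 (lo j) with a | k <;> rcases h₂ : i.1 (hi j) with b | k'
  · simp only [PsiS, h₁, h₂]
    exact linked_psi_black s Q hs (by rw [h₁]; rfl) (by rw [h₂]; rfl)
  · simp only [PsiS, h₁, h₂, hsum]
    exact linked_psi_black_red s Q hs (by rw [h₁]; rfl) h₂
  · simp only [PsiS, h₁, h₂, hsum]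
    exact linked_psi_red_black s Q hs h₁ (by rw [h₂]; rfl)
  · simp only [PsiS, h₁, h₂]
    rw [w_psi_red_red s (by rw [h₁]; rfl) (by rw [h₂]; rfl)]
    exact Linked.zero

end Link

end KLRSub

namespace KLRSub

/-! ### The isomorphism -/

section Iso

open PolyModel
open scoped Classical

variable {𝕜 : Type*} [Field 𝕜] {m : ℕ} (s : Fin m → ℕ) {n : ℕ} {D : CartanDatum (Fin 1)}
  (Q : ScalarParams 𝕜 D)

theorem Linked.sub {s : Fin m → ℕ} {Q : ScalarParams 𝕜 D} {x x' : W 𝕜 s n}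
    {y y' : Ambient (lamOne s) n Q} (h : Linked s Q x y) (h' : Linked s Q x' y') :
    Linked s Q (x - x') (y - y') := by
  rw [sub_eq_add_neg, sub_eq_add_neg, ← neg_one_smul 𝕜 x', ← neg_one_smul 𝕜 y']
  exact h.add (h'.smul _)

variable (n) in
/-- The subalgebra `S_C(λ, ν)` in type `A₁`. -/
noncomputable abbrev S₁ : NonUnitalSubalgebra 𝕜 (Ambient (lamOne s) n Q) :=
  S (lamOne s) (fun _ : Fin n => (0 : Fin 1)) Q

variable (n) in
/-- The unit of `S_C(λ, ν)`. -/
noncomputable def oneS : Ambient (lamOne s) n Q := ∑ i : WSeq m n, eS (lamOne s) Q i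

theorem mem_S_of_isGenS {y : Ambient (lamOne s) n Q}
    (h : IsGenS (lamOne s) (fun _ : Fin n => (0 : Fin 1)) Q y) : y ∈ S₁ s n Q :=
  NonUnitalAlgebra.subset_adjoin 𝕜 h

/-- The generators of `S` have `1 ≤ d ≤ s k`, while `W` has symbols for all `d`. The remaining
values give `e(i)` for `d = 0` and `0` for `d > s k`. -/
theorem thickDotS_mem (k : Fin m) (d : ℕ) {j : Fin (m + n)} {i : WSeq m n}
    (hj : i.1 j = Sum.inr k) : thickDotS (lamOne s) Q k 0 d j i ∈ S₁ s n Q := by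
  by_cases h₀ : d = 0
  · subst h₀
    have : thickDotS (lamOne s) Q k 0 0 j i = eS (lamOne s) Q i := by
      simp [thickDotS, KLR.elemSymm]
    rw [this]
    exact mem_S_of_isGenS s Q (.e i)
  by_cases h₁ : d ≤ s k
  · exact mem_S_of_isGenS s Q (.E k 0 d (by omega) h₁ j i hj)
  · have : thickDotS (lamOne s) Q k 0 d j i = 0 := by
      rw [thickDotS, KLR.elemSymm, List.sublistsLen_of_length_lt]
      · simp
      · rw [List.length_range]
        exact not_le.1 h₁
    rw [this]
    exact zero_mem _

theorem linked_one (hs : ∀ k, 0 < s k) : Linked s Q (1 : W 𝕜 s n) (oneS s n Q) := by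
  rw [← w_sum_e s]
  exact Linked.sum _ fun i _ => linked_e s Q hs i

theorem oneS_mem : oneS s n Q ∈ S₁ s n Q :=
  sum_mem fun i _ => mem_S_of_isGenS s Q (.e i)

theorem exists_linked_of_forall_mul_e (x : W 𝕜 s n)
    (h : ∀ i, ∃ y ∈ S₁ s n Q, Linked s Q (x * W.gen 𝕜 s n (.e i)) y) :
    ∃ y ∈ S₁ s n Q, Linked s Q x y := by
  choose y hy hl using h
  refine ⟨∑ i, y i, sum_mem fun i _ => hy i, ?_⟩
  rw [← mul_one x, ← w_sum_e s, Finset.mul_sum]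
  exact Linked.sum _ fun i _ => hl i

theorem exists_linked (hs : ∀ k, 0 < s k) (x : W 𝕜 s n) : ∃ y ∈ S₁ s n Q, Linked s Q x y := by
  obtain ⟨a, rfl⟩ : ∃ a, W.mk 𝕜 s n a = x := RingQuot.mkAlgHom_surjective 𝕜 _ x
  induction a using FreeAlgebra.induction with
  | grade0 r =>
    refine ⟨r • oneS s n Q, SMulMemClass.smul_mem r (oneS_mem s Q), ?_⟩
    rw [AlgHom.commutes, Algebra.algebraMap_eq_smul_one]
    exact (linked_one s Q hs).smul r
  | grade1 g =>
    rw [W.mk_ι]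
    cases g with
    | e i => exact ⟨_, mem_S_of_isGenS s Q (.e i), linked_e s Q hs i⟩
    | x j =>
      exact exists_linked_of_forall_mul_e s Q _ fun i =>
        ⟨_, mem_S_of_isGenS s Q (.y j i), linked_y s Q hs j i⟩
    | E k d =>
      refine exists_linked_of_forall_mul_e s Q _ fun i => ?_
      obtain ⟨j, hj⟩ := exists_eq_red i k
      exact ⟨_, thickDotS_mem s Q k d hj, linked_thickDot s Q hs k d hj⟩
    | psi j =>
      exact exists_linked_of_forall_mul_e s Q _ fun i =>
        ⟨_, mem_S_of_isGenS s Q (.Psi j i), linked_Psi s Q hs j i⟩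
  | mul a b ha hb =>
    obtain ⟨y, hy, hl⟩ := ha
    obtain ⟨y', hy', hl'⟩ := hb
    rw [map_mul]
    exact ⟨_, mul_mem hy hy', hl.mul hl'⟩
  | add a b ha hb =>
    obtain ⟨y, hy, hl⟩ := ha
    obtain ⟨y', hy', hl'⟩ := hb
    rw [map_add]
    exact ⟨_, add_mem hy hy', hl.add hl'⟩

theorem exists_linked' (hs : ∀ k, 0 < s k) {y : Ambient (lamOne s) n Q} (hy : y ∈ S₁ s n Q) :
    ∃ x : W 𝕜 s n, Linked s Q x y := by
  induction hy using NonUnitalAlgebra.adjoin_induction with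
  | mem y h =>
    cases h with
    | e i => exact ⟨_, linked_e s Q hs i⟩
    | y j i => exact ⟨_, linked_y s Q hs j i⟩
    | E k a d h₁ h₂ j i h =>
      rw [Subsingleton.elim a 0]
      exact ⟨_, linked_thickDot s Q hs k d h⟩
    | Psi j i => exact ⟨_, linked_Psi s Q hs j i⟩
  | zero => exact ⟨0, Linked.zero⟩
  | add y y' _ _ h h' =>
    obtain ⟨x, hx⟩ := h
    obtain ⟨x', hx'⟩ := h'
    exact ⟨_, hx.add hx'⟩
  | mul y y' _ _ h h' =>
    obtain ⟨x, hx⟩ := h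
    obtain ⟨x', hx'⟩ := h'
    exact ⟨_, hx.mul hx'⟩
  | smul r y _ h =>
    obtain ⟨x, hx⟩ := h
    exact ⟨_, hx.smul r⟩

theorem mul_eS_mul_oneS (hs : ∀ k, 0 < s k) (a : Ambient (lamOne s) n Q) (i : WSeq m n) :
    a * eS (lamOne s) Q i * oneS s n Q = a * eS (lamOne s) Q i := by
  rw [mul_assoc, oneS, Finset.mul_sum]
  simp only [eS_mul_eS s Q hs, Finset.sum_ite_eq, Finset.mem_univ, if_true]

/-- Each nonzero generator ends in some `e(i)`. This right unit is what confines the action of `y`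
to the invariant vectors, the only place where `Linked` gives information. -/
theorem mul_oneS (hs : ∀ k, 0 < s k) {y : Ambient (lamOne s) n Q} (hy : y ∈ S₁ s n Q) :
    y * oneS s n Q = y := by
  induction hy using NonUnitalAlgebra.adjoin_induction with
  | mem y h =>
    cases h with
    | e i =>
      have := mul_eS_mul_oneS s Q hs 1 i
      rwa [one_mul] at this
    | y j i =>
      rcases h₁ : i.1 j with a | k <;> simp only [yS, h₁]
      · exact mul_eS_mul_oneS s Q hs _ i
      · exact zero_mul _
    | E k a d h₁ h₂ j i h => exact mul_eS_mul_oneS s Q hs _ i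
    | Psi j i =>
      rcases h₁ : i.1 (lo j) with a | k <;> rcases h₂ : i.1 (hi j) with b | k' <;>
        simp only [PsiS, h₁, h₂]
      · exact mul_eS_mul_oneS s Q hs _ i
      · exact mul_eS_mul_oneS s Q hs _ i
      · exact mul_eS_mul_oneS s Q hs _ i
      · exact zero_mul _
  | zero => exact zero_mul _
  | add y y' _ _ h h' => rw [add_mul, h, h']
  | mul y y' _ _ h h' => rw [mul_assoc, h']
  | smul r y _ h => rw [smul_mul_assoc, h]

/-- Since `y = y * oneS`, its action factors through the image of the projections, where it vanishes
by assumption. Faithfulness of the ambient algebra finishes. -/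
theorem eq_zero_of_linked_zero (hs : ∀ k, 0 < s k) {y : Ambient (lamOne s) n Q}
    (hy : y ∈ S₁ s n Q) (h : Linked s Q (0 : W 𝕜 s n) y) : y = 0 := by
  refine klr_eq_zero Q _ fun w f => ?_
  rw [← mul_oneS s Q hs hy, map_mul, Module.End.mul_apply, oneS, map_sum, LinearMap.sum_apply,
    map_sum]
  refine Finset.sum_eq_zero fun i _ => ?_
  by_cases hw : w = word (lamOne s) i
  · subst hw
    rw [eS_single, ← spread_single,
      (h _ (single_mem_thickVectors s i (seqOp_mem s i f))).2, map_zero, LinearMap.zero_apply,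
      map_zero]
  · rw [eS_single_of_ne s Q i hw, map_zero]

theorem eq_of_linked (hs : ∀ k, 0 < s k) {x : W 𝕜 s n} {y y' : Ambient (lamOne s) n Q}
    (hy : y ∈ S₁ s n Q) (hy' : y' ∈ S₁ s n Q) (h : Linked s Q x y) (h' : Linked s Q x y') :
    y = y' := by
  have := h.sub h'
  rw [sub_self] at this
  exact sub_eq_zero.1 (eq_zero_of_linked_zero s Q hs (sub_mem hy hy') this)

/-- `Linked` controls `x - x'` only on invariant vectors, so faithfulness of `W` is needed on
`thickInvariants` and not merely on all polynomials. -/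
theorem eq_of_linked' (hs : ∀ k, 0 < s k) {x x' : W 𝕜 s n} {y : Ambient (lamOne s) n Q}
    (h : Linked s Q x y) (h' : Linked s Q x' y) : x = x' := by
  have H := h.sub h'
  rw [sub_self] at H
  refine sub_eq_zero.1 (w_eq_zero s fun i f hf => spread_injective s hs ?_)
  rw [← (H _ (single_mem_thickVectors s i hf)).2, map_zero, map_zero, LinearMap.zero_apply]

end Iso

end KLRSub

/-- Here `I = Fin 1` carries an arbitrary Cartan datum, necessarily of type `A₁`; `λ_k = s_k · ī` and
`ν = (i, …, i)` has length `n`. The isomorphism matches the generators. -/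
theorem mainTheorem2 {𝕜 : Type*} [Field 𝕜] (D : KLRSub.CartanDatum (Fin 1))
    (Q : KLRSub.ScalarParams 𝕜 D) (m n : ℕ) (s : Fin m → ℕ) (hs : ∀ k, 0 < s k) :
    ∃ φ : KLRSub.W 𝕜 s n →ₙₐ[𝕜] ↥(KLRSub.S (KLRSub.lamOne s) (fun _ : Fin n => (0 : Fin 1)) Q),
      Function.Bijective φ ∧
      (∀ i : KLRSub.WSeq m n,
        (φ (KLRSub.W.gen 𝕜 s n (.e i))).1 = KLRSub.eS (KLRSub.lamOne s) Q i) ∧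
      (∀ (j : Fin (m + n)) (i : KLRSub.WSeq m n),
        (φ (KLRSub.W.gen 𝕜 s n (.x j) * KLRSub.W.gen 𝕜 s n (.e i))).1
          = KLRSub.yS (KLRSub.lamOne s) Q j i) ∧
      (∀ (k : Fin m) (d : ℕ) (j : Fin (m + n)) (i : KLRSub.WSeq m n), i.1 j = Sum.inr k →
        (φ (KLRSub.W.gen 𝕜 s n (.E k d) * KLRSub.W.gen 𝕜 s n (.e i))).1
          = KLRSub.thickDotS (KLRSub.lamOne s) Q k 0 d j i) ∧
      (∀ (j : Fin (m + n - 1)) (i : KLRSub.WSeq m n),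
        (φ (KLRSub.W.gen 𝕜 s n (.psi j) * KLRSub.W.gen 𝕜 s n (.e i))).1
          = KLRSub.PsiS (KLRSub.lamOne s) Q j i) := by
  choose F hF hL using KLRSub.exists_linked (n := n) s Q hs
  -- The partner in `S` is unique, so linearity, multiplicativity and the values on generators all
  -- follow by exhibiting a linked element.
  have eq : ∀ {x y}, y ∈ KLRSub.S₁ s n Q → KLRSub.Linked s Q x y → F x = y := fun hy h =>
    KLRSub.eq_of_linked s Q hs (hF _) hy (hL _) h
  refine ⟨{ toFun := fun x => ⟨F x, hF x⟩
            map_smul' := fun c x => Subtype.ext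
              (eq (SMulMemClass.smul_mem c (hF x)) ((hL x).smul c))
            map_zero' := Subtype.ext (eq (zero_mem _) KLRSub.Linked.zero)
            map_add' := fun x x' => Subtype.ext
              (eq (add_mem (hF x) (hF x')) ((hL x).add (hL x')))
            map_mul' := fun x x' => Subtype.ext
              (eq (mul_mem (hF x) (hF x')) ((hL x).mul (hL x'))) },
    ⟨fun x x' h => ?_, fun y => ?_⟩, fun i => ?_, fun j i => ?_, fun k d j i h => ?_, fun j i => ?_⟩
  · have h' : F x = F x' := congrArg Subtype.val h
    exact KLRSub.eq_of_linked' s Q hs (hL x) (h' ▸ hL x')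
  · obtain ⟨x, hx⟩ := KLRSub.exists_linked' s Q hs y.2
    exact ⟨x, Subtype.ext (eq y.2 hx)⟩
  · exact eq (KLRSub.mem_S_of_isGenS s Q (.e i)) (KLRSub.linked_e s Q hs i)
  · exact eq (KLRSub.mem_S_of_isGenS s Q (.y j i)) (KLRSub.linked_y s Q hs j i)
  · exact eq (KLRSub.thickDotS_mem s Q k d h) (KLRSub.linked_thickDot s Q hs k d h)
  · exact eq (KLRSub.mem_S_of_isGenS s Q (.Psi j i)) (KLRSub.linked_Psi s Q hs j i)
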